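/- **Setting.** Let $\Omega\subset\mathbb R^3$ be a bounded domain (open, connected) with smooth boundary, $\partial\Omega=\Gamma_D\cup\Gamma_N$ with $\Gamma_D\cap\Gamma_N=\emptyset$, $\Gamma_D,\Gamma_N$ measurable and of positive surface measure, and let $T>0$, $\nu\in(0,1]$, $Q=(0,T)\times\Omega$. Put $\boldsymbol H=L^2(\Omega)^3$, $\boldsymbol V=\{\boldsymbol z\in H^1(\Omega)^3:\boldsymbol z=\boldsymbol 0\text{ a.e. on }\Gamma_D\}$ (a Hilbert space for the $H^1$ norm, or equivalently for the norm of the gradient), $\boldsymbol V^*$ its dual, with $\boldsymbol H\subset\boldsymbol V^*$ through $\langle\boldsymbol u,\boldsymbol z\rangle=(\boldsymbol u,\boldsymbol z)_{\boldsymbol H}$, and $$((\boldsymbol z,\tilde{\boldsymbol z}))=\sum_{i,j=1}^3\int_\Omega\frac{\partial z_i}{\partial x_j}\frac{\partial\tilde z_i}{\partial x_j}\,dx,\qquad \varepsilon_{ij}(\boldsymbol z)=\tfrac12\Bigl(\frac{\partial z_i}{\partial x_j}+\frac{\partial z_j}{\partial x_i}\Bigr).$$ Let $\mathbb H=\{\tau=\{\tau_{ij}\}_{i,j=1}^3:\tau_{ij}=\tau_{ji}\in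 L^2(\Omega)\}$ with $(\tau,\tilde\tau)_{\mathbb H}=\sum_{i,j}\int_\Omega\tau_{ij}\tilde\tau_{ij}\,dx$, and let $\mathbb V$ be the set of $\tau\in\mathbb H$ with (weak, row-wise) divergence $\mathbf{div}\,\tau\in\boldsymbol H$ and normal trace zero on $\Gamma_N$, i.e. $(\varepsilon(\boldsymbol z),\tau)_{\mathbb H}+(\mathbf{div}\,\tau,\boldsymbol z)_{\boldsymbol H}=0$ for all $\boldsymbol z\in\boldsymbol V$. For $t\in[0,T]$ let $$\tilde K(t)=\bigl\{\tau\in\mathbb H:\tfrac12|\tau^D(x)|^2\le g(t,x)\text{ for a.a. }x\in\Omega\bigr\},\qquad K(t)=\tilde K(t)-\sigma_*(t),$$ where $\tau^D_{ij}=\tau_{ij}-\frac13\bigl(\sum_k\tau_{kk}\bigr)\delta_{ij}$ and $|\tau|^2=\sum_{i,j}\tau_{ij}^2$. Functions in $H^1(0,T;X)$ are identified with their continuous representatives. **Theorem 2.3.** Assume that - $\boldsymbol f\in L^2(0,T;\boldsymbol H)$ and $h\in L^2(0,T;\mathbb H)$; - $\boldsymbol v_0\in\boldsymbol V$ and $\sigma_0\in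 K(0)\cap\mathbb V$; - $\sigma_*\in H^1(0,T;\mathbb H)$; - $g\in H^1(0,T;C(\overline\Omega))\cap C(\overline Q)$; - there are constants $C_1,C_2>0$ with $C_1\le g(t,x)\le C_2$ for all $(t,x)\in\overline Q$. Then there exists a unique pair $(\boldsymbol v,\sigma)$ with $$\boldsymbol v\in H^1(0,T;\boldsymbol V^*)\cap L^\infty(0,T;\boldsymbol H)\cap L^2(0,T;\boldsymbol V),\qquad \sigma\in H^1(0,T;\mathbb H),\qquad \sigma(t)\in K(t)\ \text{ for all }t\in[0,T],$$ such that $\boldsymbol v(0)=\boldsymbol v_0$ in $\boldsymbol H$, $\sigma(0)=\sigma_0$ in $\mathbb H$, and, for a.a. $t\in(0,T)$, $$\langle\boldsymbol v'(t),\boldsymbol z\rangle_{\boldsymbol V^*,\boldsymbol V}+\nu((\boldsymbol v(t),\boldsymbol z))+(\sigma(t),\varepsilon(\boldsymbol z))_{\mathbb H}=(\boldsymbol f(t),\boldsymbol z)_{\boldsymbol H}\quad\text{for all }\boldsymbol z\in\boldsymbol V,$$ $$(\sigma'(t),\sigma(t)-\tau)_{\mathbb H}-(\varepsilon(\boldsymbol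 v(t)),\sigma(t)-\tau)_{\mathbb H}\le(h(t),\sigma(t)-\tau)_{\mathbb H}\quad\text{for all }\tau\in K(t).$$ The last inequality, with $\sigma(t)\in K(t)$, is the Moreau sweeping process $\sigma'(t)+\partial I_{K(t)}(\sigma(t))\ni\varepsilon(\boldsymbol v(t))+h(t)$ in $\mathbb H$. -/

import Mathlib

open MeasureTheory Set Filter Topology
open scoped ENNReal ContDiff BoundedContinuousFunction

namespace ViscousPlasticity

noncomputable section

/-! ## Domains, vectors and tensors -/

/-- Points of `ℝ³`, and vectors in `ℝ³`. -/
abbrev E3 : Type := EuclideanSpace ℝ (Fin 3)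

/-- All `3 × 3` tensors, with the norm `|τ|² = ∑ i j, τ i j ^ 2`. -/
abbrev Tensor : Type := EuclideanSpace ℝ (Fin 3 × Fin 3)

/-- The symmetric `3 × 3` tensors, with the norm inherited from `Tensor`. -/
def symTensors : Submodule ℝ Tensor where
  carrier := {τ | ∀ i j, τ (i, j) = τ (j, i)}
  add_mem' := by
    intro a b ha hb i j
    simp [ha i j, hb i j]
  zero_mem' := by
    intro i j
    simp
  smul_mem' := by
    intro c a ha i j
    simp [ha i j]

/-- The type of symmetric `3 × 3` tensors, with the Hilbert space structure of `symTensors`. -/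
def SymTensor : Type := symTensors

instance : NormedAddCommGroup SymTensor := inferInstanceAs (NormedAddCommGroup symTensors)

instance : InnerProductSpace ℝ SymTensor := inferInstanceAs (InnerProductSpace ℝ symTensors)

instance : FiniteDimensional ℝ SymTensor := inferInstanceAs (FiniteDimensional ℝ symTensors)

instance : CompleteSpace SymTensor := FiniteDimensional.complete ℝ SymTensor

/-- A symmetric tensor as a tensor. -/
def SymTensor.toTensor (τ : SymTensor) : Tensor := Subtype.val (p := (· ∈ symTensors)) τ

/-- The symmetric part `(G + Gᵀ) / 2` of a tensor, as an element of `symTensors`. -/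
def symPartAux : Tensor →ₗ[ℝ] symTensors where
  toFun := fun G =>
    ⟨WithLp.toLp 2 fun p : Fin 3 × Fin 3 => (1 / 2 : ℝ) * (G (p.1, p.2) + G (p.2, p.1)), by
      intro i j
      simp [add_comm]⟩
  map_add' := by
    intro a b
    ext p
    simp
    ring
  map_smul' := by
    intro c a
    ext p
    simp
    ring

/-- The symmetric part `(G + Gᵀ) / 2` of a tensor. -/
def symPart : Tensor →L[ℝ] SymTensor :=
  LinearMap.toContinuousLinearMap (F' := SymTensor)
    { toFun := fun G => symPartAux G
      map_add' := fun a b => symPartAux.map_add a b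
      map_smul' := fun c a => symPartAux.map_smul c a }

/-- The deviator `τ^D`, with `τ^D i j = τ i j - (1/3) (∑ k, τ k k) δ i j`. -/
def deviator (τ : SymTensor) : Tensor :=
  WithLp.toLp 2 fun p : Fin 3 × Fin 3 =>
    τ.toTensor p - (1 / 3 : ℝ) * (∑ k, τ.toTensor (k, k)) * (if p.1 = p.2 then 1 else 0)

/-- Bounded domains of `ℝ³` with smooth boundary: near each boundary point, `Ω` is the sublevel
set `{ρ < 0}` of a smooth function whose differential does not vanish at that point. -/
structure IsSmoothDomain (Ω : Set E3) : Prop where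
  isOpen : IsOpen Ω
  isConnected : IsConnected Ω
  isBounded : Bornology.IsBounded Ω
  smooth_boundary : ∀ x ∈ frontier Ω, ∃ U ∈ 𝓝 x, ∃ ρ : E3 → ℝ,
    ContDiff ℝ ∞ ρ ∧ fderiv ℝ ρ x ≠ 0 ∧ ∀ y ∈ U, (y ∈ Ω ↔ ρ y < 0)

/-! ## Function spaces on `Ω` -/

/-- `L²(Ω)³`. -/
abbrev HVec (Ω : Set E3) : Type := Lp E3 2 (volume.restrict Ω)

/-- `L²(Ω)^{3×3}`. -/
abbrev HGrad (Ω : Set E3) : Type := Lp Tensor 2 (volume.restrict Ω)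

/-- Symmetric tensor fields with entries in `L²(Ω)`;
the inner product is `∑ i j, ∫_Ω τ i j * τ' i j`. -/
abbrev HSym (Ω : Set E3) : Type := Lp SymTensor 2 (volume.restrict Ω)

/-- The partial derivative `∂φ/∂x_j`. -/
def partialDeriv (φ : E3 → ℝ) (j : Fin 3) (x : E3) : ℝ :=
  fderiv ℝ φ x (EuclideanSpace.single j 1)

/-- The Jacobian of a vector field; its `(i, j)` entry is `∂φ_i/∂x_j`. -/
def jacobian (φ : E3 → E3) (x : E3) : Tensor :=
  WithLp.toLp 2 fun p : Fin 3 × Fin 3 => fderiv ℝ φ x (EuclideanSpace.single p.2 1) p.1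

/-- Scalar test functions on `Ω`, i.e. `C_c^∞(Ω)`. -/
structure IsTest (Ω : Set E3) (φ : E3 → ℝ) : Prop where
  smooth : ContDiff ℝ ∞ φ
  hasCompactSupport : HasCompactSupport φ
  tsupport_subset : tsupport φ ⊆ Ω

/-- `G` is the weak gradient of `z` in `Ω`: `G i j = ∂z_i/∂x_j`. -/
def HasWeakGrad (Ω : Set E3) (z : HVec Ω) (G : HGrad Ω) : Prop :=
  ∀ φ : E3 → ℝ, IsTest Ω φ → ∀ i j : Fin 3,
    ∫ x in Ω, z x i * partialDeriv φ j x = - ∫ x in Ω, G x (i, j) * φ x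

/-- `d` is the weak (row-wise) divergence of `τ` in `Ω`: `d i = ∑ j, ∂τ_ij/∂x_j`. -/
def HasWeakDiv (Ω : Set E3) (τ : HSym Ω) (d : HVec Ω) : Prop :=
  ∀ φ : E3 → ℝ, IsTest Ω φ → ∀ i : Fin 3,
    ∑ j : Fin 3, ∫ x in Ω, (τ x).toTensor (i, j) * partialDeriv φ j x = - ∫ x in Ω, d x i * φ x

/-- The `H¹` field `z` with weak gradient `G` has trace zero almost everywhere on the part `S` of
the boundary: it is the `H¹(Ω)`-limit of fields that are smooth up to the boundary and whose
boundary values tend to zero in `L²(S)` for the surface measure. As the trace operator is the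
continuous extension to `H¹(Ω)³`, with values in `L²(∂Ω)³`, of the restriction of smooth fields to
`∂Ω`, this says that the trace vanishes a.e. on `S`. -/
def HasZeroTraceOn (Ω S : Set E3) (z : HVec Ω) (G : HGrad Ω) : Prop :=
  ∃ φ : ℕ → E3 → E3, (∀ n, ContDiff ℝ ∞ (φ n)) ∧
    Tendsto (fun n => eLpNorm (fun x => φ n x - z x) 2 (volume.restrict Ω)) atTop (𝓝 0) ∧
    Tendsto (fun n => eLpNorm (fun x => jacobian (φ n) x - G x) 2 (volume.restrict Ω))
      atTop (𝓝 0) ∧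
    Tendsto (fun n => eLpNorm (φ n) 2 ((μH[2] : Measure E3).restrict S)) atTop (𝓝 0)

theorem jacobian_add {φ ψ : E3 → E3} (hφ : ContDiff ℝ ∞ φ) (hψ : ContDiff ℝ ∞ ψ) (x : E3) :
    jacobian (φ + ψ) x = jacobian φ x + jacobian ψ x := by
  have h1 : DifferentiableAt ℝ φ x := (hφ.differentiable (by simp)) x
  have h2 : DifferentiableAt ℝ ψ x := (hψ.differentiable (by simp)) x
  ext p
  simp [jacobian, fderiv_add h1 h2]

theorem jacobian_smul {φ : E3 → E3} (hφ : ContDiff ℝ ∞ φ) (c : ℝ) (x : E3) :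
    jacobian (c • φ) x = c • jacobian φ x := by
  have h1 : DifferentiableAt ℝ φ x := (hφ.differentiable (by simp)) x
  ext p
  simp [jacobian, fderiv_const_smul h1 c]

theorem continuous_jacobian {φ : E3 → E3} (hφ : ContDiff ℝ ∞ φ) : Continuous (jacobian φ) := by
  have h1 : Continuous (fderiv ℝ φ) := hφ.continuous_fderiv (by simp)
  unfold jacobian
  fun_prop

theorem tendsto_eLpNorm_add {F : Type*} [NormedAddCommGroup F] {μ : Measure E3}
    {a b c : ℕ → E3 → F} (ha : ∀ n, AEStronglyMeasurable (a n) μ)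
    (hb : ∀ n, AEStronglyMeasurable (b n) μ) (hc : ∀ n, c n =ᵐ[μ] a n + b n)
    (h1 : Tendsto (fun n => eLpNorm (a n) 2 μ) atTop (𝓝 0))
    (h2 : Tendsto (fun n => eLpNorm (b n) 2 μ) atTop (𝓝 0)) :
    Tendsto (fun n => eLpNorm (c n) 2 μ) atTop (𝓝 0) := by
  have h3 := h1.add h2
  rw [add_zero] at h3
  refine tendsto_of_tendsto_of_tendsto_of_le_of_le tendsto_const_nhds h3
    (fun _ => zero_le) (fun n => ?_)
  simp only
  rw [eLpNorm_congr_ae (hc n)]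
  exact eLpNorm_add_le (ha n) (hb n) (by norm_num)

theorem tendsto_eLpNorm_smul {F : Type*} [NormedAddCommGroup F] [NormedSpace ℝ F]
    {μ : Measure E3} {a c : ℕ → E3 → F} (r : ℝ) (hc : ∀ n, c n =ᵐ[μ] r • a n)
    (h1 : Tendsto (fun n => eLpNorm (a n) 2 μ) atTop (𝓝 0)) :
    Tendsto (fun n => eLpNorm (c n) 2 μ) atTop (𝓝 0) := by
  have h3 := ENNReal.Tendsto.const_mul (a := ‖r‖ₑ) h1 (Or.inr enorm_ne_top)
  rw [mul_zero] at h3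
  refine h3.congr (fun n => ?_)
  rw [eLpNorm_congr_ae (hc n), eLpNorm_const_smul]

theorem HasZeroTraceOn.add {Ω S : Set E3} {z z' : HVec Ω} {G G' : HGrad Ω}
    (h : HasZeroTraceOn Ω S z G) (h' : HasZeroTraceOn Ω S z' G') :
    HasZeroTraceOn Ω S (z + z') (G + G') := by
  obtain ⟨φ, hφ, h1, h2, h3⟩ := h
  obtain ⟨ψ, hψ, k1, k2, k3⟩ := h'
  refine ⟨fun n => φ n + ψ n, fun n => (hφ n).add (hψ n), ?_, ?_, ?_⟩
  · refine tendsto_eLpNorm_add (fun n => ?_) (fun n => ?_) (fun n => ?_) h1 k1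
    · exact (hφ n).continuous.aestronglyMeasurable.sub (Lp.aestronglyMeasurable z)
    · exact (hψ n).continuous.aestronglyMeasurable.sub (Lp.aestronglyMeasurable z')
    · filter_upwards [Lp.coeFn_add z z'] with x hx
      simp only [Pi.add_apply, hx]
      abel
  · refine tendsto_eLpNorm_add (fun n => ?_) (fun n => ?_) (fun n => ?_) h2 k2
    · exact (continuous_jacobian (hφ n)).aestronglyMeasurable.sub (Lp.aestronglyMeasurable G)
    · exact (continuous_jacobian (hψ n)).aestronglyMeasurable.sub (Lp.aestronglyMeasurable G')
    · filter_upwards [Lp.coeFn_add G G'] with x hx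
      simp only [Pi.add_apply, hx, jacobian_add (hφ n) (hψ n)]
      abel
  · exact tendsto_eLpNorm_add (fun n => (hφ n).continuous.aestronglyMeasurable)
      (fun n => (hψ n).continuous.aestronglyMeasurable) (fun n => Filter.EventuallyEq.rfl) h3 k3

theorem HasZeroTraceOn.smul {Ω S : Set E3} {z : HVec Ω} {G : HGrad Ω} (r : ℝ)
    (h : HasZeroTraceOn Ω S z G) : HasZeroTraceOn Ω S (r • z) (r • G) := by
  obtain ⟨φ, hφ, h1, h2, h3⟩ := h
  refine ⟨fun n => r • φ n, fun n => contDiff_const.smul (hφ n), ?_, ?_, ?_⟩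
  · refine tendsto_eLpNorm_smul r (fun n => ?_) h1
    filter_upwards [Lp.coeFn_smul r z] with x hx
    simp only [Pi.smul_apply, hx, smul_sub]
  · refine tendsto_eLpNorm_smul r (fun n => ?_) h2
    filter_upwards [Lp.coeFn_smul r G] with x hx
    simp only [Pi.smul_apply, hx, smul_sub, jacobian_smul (hφ n)]
  · exact tendsto_eLpNorm_smul r (fun n => Filter.EventuallyEq.rfl) h3

theorem HasZeroTraceOn.zero (Ω S : Set E3) : HasZeroTraceOn Ω S 0 0 := by
  have hz : ∀ x, jacobian (0 : E3 → E3) x = 0 := by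
    intro x
    ext p
    simp [jacobian]
  refine ⟨fun _ => 0, fun _ => contDiff_const, ?_, ?_, ?_⟩
  · refine tendsto_const_nhds.congr (fun n => ?_)
    rw [eq_comm, ← eLpNorm_zero (p := 2) (μ := volume.restrict Ω) (ε := E3)]
    refine eLpNorm_congr_ae ?_
    filter_upwards [Lp.coeFn_zero E3 2 (volume.restrict Ω)] with x hx
    have hx' : (0 : HVec Ω) x = 0 := hx
    simp only [hx', Pi.zero_apply, sub_zero]
  · refine tendsto_const_nhds.congr (fun n => ?_)
    rw [eq_comm, ← eLpNorm_zero (p := 2) (μ := volume.restrict Ω) (ε := Tensor)]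
    refine eLpNorm_congr_ae ?_
    filter_upwards [Lp.coeFn_zero Tensor 2 (volume.restrict Ω)] with x hx
    have hx' : (0 : HGrad Ω) x = 0 := hx
    have hz' := hz x
    simp only [hx', sub_zero, Pi.zero_apply]
    exact hz'
  · simp

theorem IsTest.memLp {Ω : Set E3} {φ : E3 → ℝ} (h : IsTest Ω φ) :
    MemLp φ 2 (volume.restrict Ω) :=
  h.smooth.continuous.memLp_of_hasCompactSupport h.hasCompactSupport

theorem IsTest.memLp_partialDeriv {Ω : Set E3} {φ : E3 → ℝ} (h : IsTest Ω φ) (j : Fin 3) :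
    MemLp (partialDeriv φ j) 2 (volume.restrict Ω) := by
  have h1 : Continuous (fderiv ℝ φ) := h.smooth.continuous_fderiv (by simp)
  refine Continuous.memLp_of_hasCompactSupport (by unfold partialDeriv; fun_prop) ?_
  exact h.hasCompactSupport.fderiv_apply ℝ _

theorem memLp_coord {ι : Type*} [Fintype ι] {Ω : Set E3}
    (z : Lp (EuclideanSpace ℝ ι) 2 (volume.restrict Ω)) (i : ι) :
    MemLp (fun x => z x i) 2 (volume.restrict Ω) :=
  (EuclideanSpace.proj (𝕜 := ℝ) i : EuclideanSpace ℝ ι →L[ℝ] ℝ).comp_memLp z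

theorem HasWeakGrad.add {Ω : Set E3} {z z' : HVec Ω} {G G' : HGrad Ω}
    (h : HasWeakGrad Ω z G) (h' : HasWeakGrad Ω z' G') :
    HasWeakGrad Ω (z + z') (G + G') := by
  intro φ hφ i j
  have e1 : ∫ x in Ω, (z + z') x i * partialDeriv φ j x
      = ∫ x in Ω, (z x i * partialDeriv φ j x + z' x i * partialDeriv φ j x) := by
    refine integral_congr_ae ?_
    filter_upwards [Lp.coeFn_add z z'] with x hx
    have hx' : (z + z') x = z x + z' x := hx
    rw [hx', PiLp.add_apply, add_mul]
  have e2 : ∫ x in Ω, (G + G') x (i, j) * φ x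
      = ∫ x in Ω, (G x (i, j) * φ x + G' x (i, j) * φ x) := by
    refine integral_congr_ae ?_
    filter_upwards [Lp.coeFn_add G G'] with x hx
    have hx' : (G + G') x = G x + G' x := hx
    rw [hx', PiLp.add_apply, add_mul]
  have e3 := integral_add ((memLp_coord z i).integrable_mul (hφ.memLp_partialDeriv j))
    ((memLp_coord z' i).integrable_mul (hφ.memLp_partialDeriv j))
  have e4 := integral_add ((memLp_coord G (i, j)).integrable_mul hφ.memLp)
    ((memLp_coord G' (i, j)).integrable_mul hφ.memLp)
  simp only [Pi.mul_apply] at e3 e4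
  rw [e1, e2, e3, e4, h φ hφ i j, h' φ hφ i j]
  ring

theorem HasWeakGrad.smul {Ω : Set E3} {z : HVec Ω} {G : HGrad Ω} (r : ℝ)
    (h : HasWeakGrad Ω z G) : HasWeakGrad Ω (r • z) (r • G) := by
  intro φ hφ i j
  have e1 : ∫ x in Ω, (r • z) x i * partialDeriv φ j x
      = ∫ x in Ω, r * (z x i * partialDeriv φ j x) := by
    refine integral_congr_ae ?_
    filter_upwards [Lp.coeFn_smul r z] with x hx
    simp [hx, mul_assoc]
  have e2 : ∫ x in Ω, (r • G) x (i, j) * φ x = ∫ x in Ω, r * (G x (i, j) * φ x) := by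
    refine integral_congr_ae ?_
    filter_upwards [Lp.coeFn_smul r G] with x hx
    simp [hx, mul_assoc]
  rw [e1, e2, integral_const_mul, integral_const_mul, h φ hφ i j]
  ring

theorem HasWeakGrad.zero (Ω : Set E3) : HasWeakGrad Ω 0 0 := by
  intro φ hφ i j
  have e1 : ∫ x in Ω, (0 : HVec Ω) x i * partialDeriv φ j x = 0 := by
    refine integral_eq_zero_of_ae ?_
    filter_upwards [Lp.coeFn_zero E3 2 (volume.restrict Ω)] with x hx
    have hx' : (0 : HVec Ω) x = 0 := hx
    change _ = (0 : ℝ)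
    rw [hx']
    simp
  have e2 : ∫ x in Ω, (0 : HGrad Ω) x (i, j) * φ x = 0 := by
    refine integral_eq_zero_of_ae ?_
    filter_upwards [Lp.coeFn_zero Tensor 2 (volume.restrict Ω)] with x hx
    have hx' : (0 : HGrad Ω) x = 0 := hx
    change _ = (0 : ℝ)
    rw [hx']
    simp
  rw [e1, e2, neg_zero]

/-- The space `V = {z ∈ H¹(Ω)³ : z = 0 a.e. on Γ_D}`, as the space of pairs consisting of a field
`z` and its weak gradient, with the norm `(|z|² + |∇z|²)^{1/2}` of `H¹(Ω)³`. On a bounded domain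
with `|Γ_D| > 0` this norm is equivalent on `V` to the gradient norm (Poincaré's inequality), so
both give the same dual space and the same spaces of functions of time with values in `V`, `V*`. -/
def VSub (Ω ΓD : Set E3) : Submodule ℝ (WithLp 2 (HVec Ω × HGrad Ω)) where
  carrier := {p | HasWeakGrad Ω p.fst p.snd ∧ HasZeroTraceOn Ω ΓD p.fst p.snd}
  add_mem' := fun ha hb => ⟨ha.1.add hb.1, ha.2.add hb.2⟩
  zero_mem' := ⟨HasWeakGrad.zero Ω, HasZeroTraceOn.zero Ω ΓD⟩
  smul_mem' := fun r _ ha => ⟨ha.1.smul r, ha.2.smul r⟩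

/-- The space `V`. -/
abbrev VSp (Ω ΓD : Set E3) : Type := VSub Ω ΓD

/-- The dual space `V*`. -/
abbrev VDual (Ω ΓD : Set E3) : Type := StrongDual ℝ (VSp Ω ΓD)

/-- The inclusion of `V` in `L²(Ω)³`. -/
def toH (Ω ΓD : Set E3) : VSp Ω ΓD →L[ℝ] HVec Ω :=
  (WithLp.fstL 2 ℝ (HVec Ω) (HGrad Ω)).comp (VSub Ω ΓD).subtypeL

/-- The weak gradient `∇z`, with entries `∂z_i/∂x_j`. -/
def grad (Ω ΓD : Set E3) : VSp Ω ΓD →L[ℝ] HGrad Ω :=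
  (WithLp.sndL 2 ℝ (HVec Ω) (HGrad Ω)).comp (VSub Ω ΓD).subtypeL

/-- The strain `ε(z)`, with entries `(1/2) (∂z_i/∂x_j + ∂z_j/∂x_i)`. -/
def strain (Ω ΓD : Set E3) : VSp Ω ΓD →L[ℝ] HSym Ω :=
  (symPart.compLpL 2 (volume.restrict Ω)).comp (grad Ω ΓD)

/-- The bilinear form `((z, z')) = ∑ i j, ∫_Ω (∂z_i/∂x_j) (∂z'_i/∂x_j)`. -/
def gradForm (Ω ΓD : Set E3) (z z' : VSp Ω ΓD) : ℝ :=
  inner ℝ (grad Ω ΓD z) (grad Ω ΓD z')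

/-- The embedding of `L²(Ω)³` in `V*`: `⟨u, z⟩ = (u, z)`. -/
def toVDual (Ω ΓD : Set E3) (u : HVec Ω) : VDual Ω ΓD :=
  (innerSL ℝ u).comp (toH Ω ΓD)

/-- The space `{τ ∈ ℍ : div τ ∈ L²(Ω)³, τ ν = 0 on Γ_N}`. The normal trace `τ ν` is the functional
`z ↦ (ε(z), τ) + (div τ, z)` of the boundary values of `z`; it vanishes on `Γ_N` if it vanishes
on all `z` with zero boundary values on `Γ_D`, the rest of the boundary. -/
def VSym (Ω ΓD : Set E3) : Set (HSym Ω) :=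
  {τ | ∃ d : HVec Ω, HasWeakDiv Ω τ d ∧
    ∀ z : VSp Ω ΓD, inner ℝ (strain Ω ΓD z) τ + inner ℝ d (toH Ω ΓD z) = 0}

/-! ## Functions of time -/

/-- Lebesgue measure on the time interval `(0, T)`. -/
def timeMeasure (T : ℝ) : Measure ℝ := volume.restrict (Ioo 0 T)

/-- `u ∈ H¹(0,T;X)` with `u' = w`, where `u` stands for the continuous representative:
`w ∈ L²(0,T;X)`, and `u` is the indefinite integral of `w` on `[0,T]`. -/
def HasH1Deriv {X : Type*} [NormedAddCommGroup X] [NormedSpace ℝ X] (T : ℝ) (u w : ℝ → X) : Prop :=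
  MemLp w 2 (timeMeasure T) ∧ ∀ t ∈ Icc 0 T, u t = u 0 + ∫ s in (0 : ℝ)..t, w s

/-! ## The model -/

/-- The set `K̃(t) = {τ ∈ ℍ : (1/2) |τ^D(x)|² ≤ g(t,x) for a.a. x ∈ Ω}`,
for the function `gt = g(t, ·)`. -/
def Ktilde (Ω : Set E3) (gt : closure Ω →ᵇ ℝ) : Set (HSym Ω) :=
  {τ | ∀ᵐ x ∂(volume.restrict Ω), ∀ hx : x ∈ Ω,
    (1 / 2 : ℝ) * ‖deviator (τ x)‖ ^ 2 ≤ gt ⟨x, subset_closure hx⟩}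

/-- The constraint set `K(t) = K̃(t) - σ_*(t)`. -/
def K (Ω : Set E3) (g : ℝ → (closure Ω →ᵇ ℝ)) (σstar : ℝ → HSym Ω) (t : ℝ) : Set (HSym Ω) :=
  {τ | τ + σstar t ∈ Ktilde Ω (g t)}

/-- `(v, σ)` is a solution of the viscous perfect plasticity model with viscosity `ν` and data
`f`, `h`, `σ_*`, `g`, `v₀`, `σ₀`. Here `u` is `v` as an element of `L²(0,T;V)`, `v'` is the time
derivative of `v` in `V*`, and `σ'` the time derivative of `σ` in `ℍ`. The values `v t`, `σ t` for
`t ∈ [0,T]` are those of the representatives of `v` and `σ` that are continuous with values in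
`V*` and in `ℍ`. -/
def IsSolution (Ω ΓD : Set E3) (T ν : ℝ) (f : ℝ → HVec Ω) (h σstar : ℝ → HSym Ω)
    (g : ℝ → (closure Ω →ᵇ ℝ)) (v₀ : VSp Ω ΓD) (σ₀ : HSym Ω)
    (v : ℝ → HVec Ω) (σ : ℝ → HSym Ω) : Prop :=
  ∃ (u : ℝ → VSp Ω ΓD) (v' : ℝ → VDual Ω ΓD) (σ' : ℝ → HSym Ω),
    -- `v ∈ H¹(0,T;V*) ∩ L^∞(0,T;H) ∩ L²(0,T;V)`
    HasH1Deriv T (fun t => toVDual Ω ΓD (v t)) v' ∧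
    MemLp v ∞ (timeMeasure T) ∧
    MemLp u 2 (timeMeasure T) ∧ (∀ᵐ t ∂(timeMeasure T), v t = toH Ω ΓD (u t)) ∧
    -- `σ ∈ H¹(0,T;ℍ)` and `σ(t) ∈ K(t)` for all `t`
    HasH1Deriv T σ σ' ∧
    (∀ t ∈ Icc 0 T, σ t ∈ K Ω g σstar t) ∧
    -- the equation of motion
    (∀ᵐ t ∂(timeMeasure T), ∀ z : VSp Ω ΓD,
      v' t z + ν * gradForm Ω ΓD (u t) z + inner ℝ (σ t) (strain Ω ΓD z)
        = inner ℝ (f t) (toH Ω ΓD z)) ∧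
    -- the variational inequality for the stress
    (∀ᵐ t ∂(timeMeasure T), ∀ τ ∈ K Ω g σstar t,
      inner ℝ (σ' t) (σ t - τ) - inner ℝ (strain Ω ΓD (u t)) (σ t - τ)
        ≤ inner ℝ (h t) (σ t - τ)) ∧
    -- the initial conditions
    v 0 = toH Ω ΓD v₀ ∧ σ 0 = σ₀

end

end ViscousPlasticity

/-! The velocity is eliminated. For a given stress, the equation of motion is a linear parabolic
equation; its solution operator `S` for zero initial value satisfies the energy inequality `∫₀ᵗ (F,
S F) ≥ 0` for every `t` (`exists_parabolicOperator`). Put `x = σ + σ_*`, so that the constraint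
becomes `x(t) ∈ K̃(t)`. The system turns into a sweeping process `x' + A x + ∂I(x) ∋ F` with `A = ε
S ε*`, where `ε*` is the adjoint of the strain. This `A` is bounded and monotone on every interval
`(0,t)`, and `exists_sweeping` applies; `exists_coupledSolution` recovers the velocity.

Both evolution problems are solved by one device. Integration in time, `volt`, is bounded and
monotone on `L²(0,T;X)`, because `∫₀ᵗ (w, ∫₀ˢ w) = ½ |∫₀ᵗ w|²`. Replacing `x - x(0) = volt w` by `x
- x(0) = volt w + c w` with `c > 0` makes the derivative `w` a bounded coercive function of `x -
x(0)`, and Lax–Milgram or Lions–Stampacchia gives a solution. As `c → 0` one takes weak limits; the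
quadratic forms of `volt` and `A` are weakly lower semicontinuous by monotonicity.

The delicate point is a bound on `w` in `L²`, uniform in `c`, for the sweeping process. Let `y =
x(0) + volt w`, so that `y + c y' = x` takes values in the moving set. A separation argument in `X ×
ℝ`, the second factor measuring enlargement of the threshold, shows that `y` leaves the moving set
by at most an error controlled by `‖g'‖`. Since `g` has a positive lower bound, multiplying by a
scalar close to one brings `y` back, at a cost of order `c` in `L²` (`exists_selection_near`).
Testing with this corrected function gives `c ‖w‖² ≤ c (const + const ‖w‖)`.

For uniqueness, each stress is inserted in the inequality of the other; the parabolic energy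
inequality has the favourable sign, and the stresses agree. Throughout, `V*` is identified with `V`
by the Riesz map; `V` is complete, and its density in `H` makes the adjoint of the inclusion
injective. -/

namespace ViscousPlasticity

noncomputable section

/-! ### Integration, truncation and pointwise operators on `L²(0,T;X)` -/

section TimeFunctions

set_option linter.unusedSectionVars false

variable {X Y : Type*} [NormedAddCommGroup X] [InnerProductSpace ℝ X] [CompleteSpace X]
  [NormedAddCommGroup Y] [InnerProductSpace ℝ Y] [CompleteSpace Y]
  {Z : Type*} [NormedAddCommGroup Z] [NormedSpace ℝ Z]

/-- The energy identity `∫₀ᵗ (w, W) = ½ |W(t)|²` for the primitive `W` of an integrable `w`. -/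
theorem integral_inner_primitive {w : ℝ → X} {t : ℝ}
    (hw : IntervalIntegrable w volume 0 t) :
    ∫ s in (0 : ℝ)..t, inner ℝ (w s) (∫ r in (0 : ℝ)..s, w r)
      = (1 / 2) * ‖∫ r in (0 : ℝ)..t, w r‖ ^ 2 := by
  set W : ℝ → X := fun s => ∫ r in (0 : ℝ)..s, w r with hW
  have hI : ∀ s ∈ uIcc 0 t, IntervalIntegrable w volume 0 s := fun s hs =>
    hw.mono_set (uIcc_subset_uIcc_left hs)
  have hcont : ContinuousOn W (uIcc 0 t) := intervalIntegral.continuousOn_primitive_interval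
    (((intervalIntegrable_iff' (by simp)).1 hw))
  obtain ⟨C, hC⟩ := isCompact_uIcc.exists_bound_of_continuousOn hcont
  have hC0 : 0 ≤ C := (norm_nonneg _).trans (hC 0 left_mem_uIcc)
  -- With `C` a bound for `|W|`, increments of `½ |W|²` are dominated by those of `C ∫ |w|`. Hence
  -- `½ |W|²` is absolutely continuous and is the integral of its almost everywhere derivative.
  have hΓ := (hw.norm.const_mul C).absolutelyContinuousOnInterval_intervalIntegral
    (c := 0) left_mem_uIcc
  have hAC : AbsolutelyContinuousOnInterval (fun s => (1 / 2 : ℝ) * ‖W s‖ ^ 2) 0 t := by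
    rw [absolutelyContinuousOnInterval_iff] at hΓ ⊢
    intro ε hε
    obtain ⟨δ, hδ, h⟩ := hΓ ε hε
    refine ⟨δ, hδ, fun E hE hEs => lt_of_le_of_lt (Finset.sum_le_sum fun i hi => ?_) (h E hE hEs)⟩
    have hmem := hE.1 i hi
    set a := (E.2 i).1
    set b := (E.2 i).2
    have ha := hmem.1
    have hb := hmem.2
    have hab : IntervalIntegrable w volume a b := (hI a ha).symm.trans (hI b hb)
    have e1 : W a - W b = ∫ r in b..a, w r := by
      rw [hW]
      exact intervalIntegral.integral_interval_sub_left (hI a ha) (hI b hb)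
    have e2 : (∫ v in (0 : ℝ)..a, C * ‖w v‖) - ∫ v in (0 : ℝ)..b, C * ‖w v‖
        = ∫ v in b..a, C * ‖w v‖ :=
      intervalIntegral.integral_interval_sub_left ((hI a ha).norm.const_mul C)
        ((hI b hb).norm.const_mul C)
    rw [Real.dist_eq, Real.dist_eq, e2, intervalIntegral.integral_const_mul, abs_mul,
      abs_of_nonneg hC0]
    have e3 : (1 / 2 : ℝ) * ‖W a‖ ^ 2 - 1 / 2 * ‖W b‖ ^ 2
        = (1 / 2) * ((‖W a‖ - ‖W b‖) * (‖W a‖ + ‖W b‖)) := by ring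
    rw [e3, abs_mul, abs_mul, abs_of_pos (by norm_num : (0 : ℝ) < 1 / 2)]
    have e4 : |‖W a‖ + ‖W b‖| ≤ 2 * C := by
      rw [abs_of_nonneg (by positivity)]
      linarith [hC a ha, hC b hb]
    have e5 : |‖W a‖ - ‖W b‖| ≤ |∫ r in b..a, ‖w r‖| :=
      (abs_norm_sub_norm_le _ _).trans
        (by rw [e1]; exact intervalIntegral.norm_integral_le_abs_integral_norm)
    nlinarith [mul_le_mul e5 e4 (abs_nonneg _) (abs_nonneg _)]
  have hd : ∀ᵐ x, x ∈ uIcc 0 t →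
      HasDerivAt (fun s => (1 / 2 : ℝ) * ‖W s‖ ^ 2) (inner ℝ (w x) (W x)) x := by
    filter_upwards [hw.ae_hasDerivAt_integral] with x hx hxt
    have h1 := (hx hxt 0 left_mem_uIcc).norm_sq.const_mul (1 / 2 : ℝ)
    rw [real_inner_comm]
    have e : (1 / 2 : ℝ) * (2 * inner ℝ (W x) (w x)) = inner ℝ (W x) (w x) := by ring
    rw [← e]
    exact h1
  have h2 := hAC.integral_deriv_eq_sub
  have e0 : W 0 = 0 := intervalIntegral.integral_same
  simp only [e0, norm_zero] at h2
  rw [intervalIntegral.integral_congr_ae (g := fun s => inner ℝ (w s) (W s))] at h2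
  · rw [h2]; ring
  · filter_upwards [hd] with x hx hxt
    exact (hx (uIoc_subset_uIcc hxt)).deriv

instance (T : ℝ) : IsFiniteMeasure (timeMeasure T) := by
  unfold timeMeasure; infer_instance

/-- `L²(0,T;X)`. -/
abbrev TimeL2 (T : ℝ) (X : Type*) [NormedAddCommGroup X] : Type _ := Lp X 2 (timeMeasure T)

variable {T : ℝ}

theorem TimeL2.integrable (w : TimeL2 T Z) : Integrable w (timeMeasure T) :=
  (Lp.memLp w).integrable (by norm_num)

theorem intervalIntegrable_of_integrable {w : ℝ → Z} (hw : Integrable w (timeMeasure T))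
    {t : ℝ} (ht : t ∈ Icc 0 T) : IntervalIntegrable w volume 0 t := by
  rw [intervalIntegrable_iff_integrableOn_Ioo_of_le ht.1]
  exact IntegrableOn.mono_set (t := Ioo 0 T) hw (Ioo_subset_Ioo_right ht.2)

theorem integral_Iic_timeMeasure (w : ℝ → Z) {t : ℝ} (ht : t ∈ Icc 0 T) :
    ∫ s in Iic t, w s ∂(timeMeasure T) = ∫ s in (0 : ℝ)..t, w s := by
  rw [intervalIntegral.integral_of_le ht.1, timeMeasure,
    Measure.restrict_restrict measurableSet_Iic, integral_Ioc_eq_integral_Ioo]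
  rcases eq_or_lt_of_le ht.2 with h | h
  · subst h
    congr 2
    ext s
    simp only [mem_inter_iff, mem_Iic, mem_Ioo]
    grind
  · rw [← integral_Ioc_eq_integral_Ioo]
    congr 2
    ext s
    simp only [mem_inter_iff, mem_Iic, mem_Ioo, mem_Ioc]
    grind

/-- The `L¹`-bound on `(0,T)` by the `L²` norm. -/
theorem TimeL2.integral_norm_le (w : TimeL2 T Z) :
    ∫ s, ‖w s‖ ∂(timeMeasure T) ≤ ((timeMeasure T univ) ^ (1 / 2 : ℝ)).toReal * ‖w‖ := by
  rw [integral_norm_eq_lintegral_enorm (Lp.aestronglyMeasurable w), ← eLpNorm_one_eq_lintegral_enorm,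
    Lp.norm_def, ← ENNReal.toReal_mul]
  refine ENNReal.toReal_mono (ENNReal.mul_ne_top ?_ (Lp.eLpNorm_ne_top w)) ?_
  · exact ENNReal.rpow_ne_top_of_nonneg (by norm_num) (measure_ne_top _ _)
  · have := eLpNorm_le_eLpNorm_mul_rpow_measure_univ (p := 1) (q := 2) (by norm_num)
      (Lp.aestronglyMeasurable w)
    rw [mul_comm]
    convert this using 3
    norm_num

theorem TimeL2.norm_setIntegral_le (w : TimeL2 T X) (A : Set ℝ) :
    ‖∫ s in A, w s ∂(timeMeasure T)‖ ≤ ((timeMeasure T univ) ^ (1 / 2 : ℝ)).toReal * ‖w‖ :=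
  (norm_integral_le_integral_norm _).trans <|
    (setIntegral_le_integral w.integrable.norm (ae_of_all _ fun _ => norm_nonneg _)).trans
      w.integral_norm_le

/-- The primitive `w ↦ ∫₀ᵗ w` as an operator on `L²(0,T;X)`. -/
def primL (T : ℝ) (X : Type*) [NormedAddCommGroup X] [InnerProductSpace ℝ X] [CompleteSpace X]
    (t : ℝ) : TimeL2 T X →L[ℝ] X :=
  LinearMap.mkContinuous
    { toFun := fun w => ∫ s in Iic t, w s ∂(timeMeasure T)
      map_add' := fun a b => by
        rw [← integral_add a.integrable.integrableOn b.integrable.integrableOn]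
        exact integral_congr_ae (ae_restrict_of_ae (Lp.coeFn_add a b))
      map_smul' := fun c a => by
        rw [RingHom.id_apply, ← integral_smul]
        exact integral_congr_ae (ae_restrict_of_ae (Lp.coeFn_smul c a)) }
    ((timeMeasure T univ) ^ (1 / 2 : ℝ)).toReal fun w => w.norm_setIntegral_le _

theorem primL_eq (w : TimeL2 T X) {t : ℝ} (ht : t ∈ Icc 0 T) :
    primL T X t w = ∫ s in (0 : ℝ)..t, w s :=
  integral_Iic_timeMeasure _ ht

theorem norm_primL_le (w : TimeL2 T X) (t : ℝ) :
    ‖primL T X t w‖ ≤ ((timeMeasure T univ) ^ (1 / 2 : ℝ)).toReal * ‖w‖ :=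
  w.norm_setIntegral_le _

theorem continuousOn_primL (w : TimeL2 T X) : ContinuousOn (fun t => primL T X t w) (Icc 0 T) := by
  rcases lt_or_ge T 0 with hT | hT
  · simp [Icc_eq_empty (not_le.2 hT)]
  have h1 := intervalIntegral.continuousOn_primitive_interval
    ((intervalIntegrable_iff' (by simp)).1
      (intervalIntegrable_of_integrable w.integrable (right_mem_Icc.2 hT)))
  rw [uIcc_of_le hT] at h1
  exact h1.congr fun t ht => primL_eq w ht

theorem memLp_of_continuousOn {u : ℝ → Z} (hu : ContinuousOn u (Icc 0 T)) :
    MemLp u 2 (timeMeasure T) := by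
  obtain ⟨C, hC⟩ := isCompact_Icc.exists_bound_of_continuousOn hu
  refine MemLp.of_bound ((hu.mono Ioo_subset_Icc_self).aestronglyMeasurable measurableSet_Ioo) C ?_
  exact ae_restrict_of_forall_mem measurableSet_Ioo fun t ht => hC t (Ioo_subset_Icc_self ht)

theorem TimeL2.norm_le_of_forall_mem (u : TimeL2 T X) {C : ℝ} (hC : 0 ≤ C)
    (hu : ∀ᵐ t ∂(timeMeasure T), ‖u t‖ ≤ C) :
    ‖u‖ ≤ ((timeMeasure T univ) ^ (1 / 2 : ℝ)).toReal * C := by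
  have h := Lp.norm_le_of_ae_bound hC hu
  convert h using 2
  simp [measureUnivNNReal, ← ENNReal.coe_toNNReal_eq_toReal]

/-- The Volterra operator `(volt w)(t) = ∫₀ᵗ w` on `L²(0,T;X)`. -/
def volt (T : ℝ) (X : Type*) [NormedAddCommGroup X] [InnerProductSpace ℝ X] [CompleteSpace X] :
    TimeL2 T X →L[ℝ] TimeL2 T X :=
  LinearMap.mkContinuous
    { toFun := fun w => (memLp_of_continuousOn (continuousOn_primL w)).toLp _
      map_add' := fun a b => by
        rw [← MemLp.toLp_add]
        exact MemLp.toLp_congr _ _ (ae_of_all _ fun t => map_add (primL T X t) a b)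
      map_smul' := fun c a => by
        rw [RingHom.id_apply, ← MemLp.toLp_const_smul]
        exact MemLp.toLp_congr _ _ (ae_of_all _ fun t => map_smul (primL T X t) c a) }
    (((timeMeasure T univ) ^ (1 / 2 : ℝ)).toReal * ((timeMeasure T univ) ^ (1 / 2 : ℝ)).toReal)
    fun w => by
      rw [mul_assoc]
      refine TimeL2.norm_le_of_forall_mem _ (by positivity) ?_
      filter_upwards [(memLp_of_continuousOn (continuousOn_primL w)).coeFn_toLp] with t ht
      rw [LinearMap.coe_mk, AddHom.coe_mk, ht]
      exact norm_primL_le w t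

theorem coeFn_volt (w : TimeL2 T X) : volt T X w =ᵐ[timeMeasure T] fun t => primL T X t w :=
  (memLp_of_continuousOn (continuousOn_primL w)).coeFn_toLp

/-- Restriction of a function to the times in `(0,t)`, extended by zero. -/
def chi (T : ℝ) (X : Type*) [NormedAddCommGroup X] [InnerProductSpace ℝ X]
    (t : ℝ) : TimeL2 T X →L[ℝ] TimeL2 T X :=
  LinearMap.mkContinuous
    { toFun := fun w => ((Lp.memLp w).indicator (measurableSet_Iic (a := t))).toLp _
      map_add' := fun a b => by
        rw [← MemLp.toLp_add]
        refine MemLp.toLp_congr _ _ ?_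
        filter_upwards [Lp.coeFn_add a b] with s hs
        have hs' : (a + b) s = a s + b s := hs
        by_cases h : s ≤ t
        · simp only [indicator, mem_Iic, h, if_true, Pi.add_apply]
          exact hs'
        · simp [indicator, h]
      map_smul' := fun c a => by
        rw [RingHom.id_apply, ← MemLp.toLp_const_smul]
        refine MemLp.toLp_congr _ _ ?_
        filter_upwards [Lp.coeFn_smul c a] with s hs
        have hs' : (c • a) s = c • a s := hs
        by_cases h : s ≤ t
        · simp only [indicator, mem_Iic, h, if_true, Pi.smul_apply]
          exact hs'
        · simp [indicator, h] }
    1 fun w => by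
      rw [one_mul]
      refine Lp.norm_le_norm_of_ae_le ?_
      filter_upwards [((Lp.memLp w).indicator (measurableSet_Iic (a := t))).coeFn_toLp] with s hs
      rw [LinearMap.coe_mk, AddHom.coe_mk, hs]
      exact norm_indicator_le_norm_self _ _

theorem coeFn_chi (t : ℝ) (w : TimeL2 T X) :
    chi T X t w =ᵐ[timeMeasure T] (Iic t).indicator w :=
  ((Lp.memLp w).indicator (measurableSet_Iic (a := t))).coeFn_toLp

theorem inner_chi (t : ℝ) (a b : TimeL2 T X) :
    inner ℝ (chi T X t a) b = ∫ s in Iic t, inner ℝ (a s) (b s) ∂(timeMeasure T) := by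
  rw [L2.inner_def, ← integral_indicator measurableSet_Iic]
  refine integral_congr_ae ?_
  filter_upwards [coeFn_chi t a] with s hs
  rw [hs]
  by_cases h : s ∈ Iic t <;> simp [indicator, h]

theorem inner_chi_right (t : ℝ) (a b : TimeL2 T X) :
    inner ℝ a (chi T X t b) = inner ℝ (chi T X t a) b := by
  rw [real_inner_comm, inner_chi, inner_chi]
  simp_rw [real_inner_comm]

theorem inner_chi_self_nonneg (t : ℝ) (a : TimeL2 T X) : 0 ≤ inner ℝ (chi T X t a) a := by
  rw [inner_chi]
  exact integral_nonneg fun s => real_inner_self_nonneg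

theorem norm_chi_le (t : ℝ) (a : TimeL2 T X) : ‖chi T X t a‖ ≤ ‖a‖ := by
  refine Lp.norm_le_norm_of_ae_le ?_
  filter_upwards [coeFn_chi t a] with s hs
  rw [hs]
  exact norm_indicator_le_norm_self _ _

theorem chi_eq_self (a : TimeL2 T X) : chi T X T a = a := by
  refine Lp.ext ?_
  filter_upwards [coeFn_chi T a, ae_restrict_mem (measurableSet_Ioo (a := 0) (b := T))] with s hs hm
  rw [hs, indicator_of_mem (show s ∈ Iic T from hm.2.le)]

/-- The energy identity in `L²(0,T;X)`. -/
theorem inner_chi_volt (w : TimeL2 T X) {t : ℝ} (ht : t ∈ Icc 0 T) :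
    inner ℝ (chi T X t w) (volt T X w) = (1 / 2) * ‖primL T X t w‖ ^ 2 := by
  have h1 : inner ℝ (chi T X t w) (volt T X w)
      = ∫ s in Iic t, inner ℝ (w s) (primL T X s w) ∂(timeMeasure T) := by
    rw [inner_chi]
    refine integral_congr_ae (ae_restrict_of_ae ?_)
    filter_upwards [coeFn_volt w] with s hs
    rw [hs]
  rw [h1, integral_Iic_timeMeasure _ ht, primL_eq w ht,
    ← integral_inner_primitive (intervalIntegrable_of_integrable w.integrable ht)]
  refine intervalIntegral.integral_congr fun s hs => ?_
  rw [uIcc_of_le ht.1] at hs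
  rw [primL_eq w ⟨hs.1, hs.2.trans ht.2⟩]

/-- The energy identity at `t = T`: this monotonicity is what makes `volt + c` coercive. -/
theorem inner_volt_nonneg (hT : 0 ≤ T) (w : TimeL2 T X) : 0 ≤ inner ℝ w (volt T X w) := by
  have h := inner_chi_volt w (right_mem_Icc.2 hT)
  rw [chi_eq_self] at h
  rw [h]
  positivity

/-- A square integrable function whose primitive vanishes is zero. -/
theorem eq_zero_of_primL_eq_zero (w : TimeL2 T X) (h : ∀ t ∈ Icc 0 T, primL T X t w = 0) :
    w = 0 := by
  rcases lt_or_ge T 0 with hT | hT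
  · refine Lp.ext ?_
    have : timeMeasure T = 0 := by
      rw [timeMeasure, Ioo_eq_empty (by linarith), Measure.restrict_empty]
    change ∀ᵐ t ∂(timeMeasure T), w t = (0 : TimeL2 T X) t
    have h2 : ae (timeMeasure T) = ⊥ := by rw [this, ae_zero]
    rw [h2]
    exact Filter.eventually_bot
  refine Lp.ext ?_
  have hw := intervalIntegrable_of_integrable w.integrable (right_mem_Icc.2 hT)
  filter_upwards [ae_restrict_of_ae hw.ae_hasDerivAt_integral,
    ae_restrict_mem (measurableSet_Ioo (a := 0) (b := T)), Lp.coeFn_zero X 2 (timeMeasure T)]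
    with t ht hm h0
  rw [h0]
  have hm' : t ∈ uIcc 0 T := by rw [uIcc_of_le hT]; exact Ioo_subset_Icc_self hm
  refine (ht hm' 0 left_mem_uIcc).unique ((hasDerivAt_const t (0 : X)).congr_of_eventuallyEq ?_)
  filter_upwards [Ioo_mem_nhds hm.1 hm.2] with s hs
  rw [← h s (Ioo_subset_Icc_self hs), primL_eq w (Ioo_subset_Icc_self hs)]

/-- Two functions that are continuous on `[0,T]` and agree almost everywhere agree on `[0,T]`. -/
theorem eqOn_of_ae_eq (hT : 0 < T) {u v : ℝ → Z} (hu : ContinuousOn u (Icc 0 T))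
    (hv : ContinuousOn v (Icc 0 T)) (h : u =ᵐ[timeMeasure T] v) : EqOn u v (Icc 0 T) := by
  have h1 : EqOn u v (Ioo 0 T) := Measure.eqOn_open_of_ae_eq h isOpen_Ioo
    (hu.mono Ioo_subset_Icc_self) (hv.mono Ioo_subset_Icc_self)
  refine h1.of_subset_closure hu hv Ioo_subset_Icc_self ?_
  rw [closure_Ioo hT.ne]

theorem volt_injective (hT : 0 < T) (w : TimeL2 T X) (h : volt T X w = 0) : w = 0 := by
  refine eq_zero_of_primL_eq_zero w (eqOn_of_ae_eq hT (continuousOn_primL w) continuousOn_const ?_)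
  filter_upwards [coeFn_volt w, Lp.coeFn_zero X 2 (timeMeasure T)] with t ht h0
  rw [← ht, h, h0]
  rfl

/-- The operator induced on `L²(0,T;·)` by an operator acting on the values. -/
abbrev lift (T : ℝ) (L : X →L[ℝ] Y) : TimeL2 T X →L[ℝ] TimeL2 T Y :=
  L.compLpL 2 (timeMeasure T)

theorem primL_lift (L : X →L[ℝ] Y) (w : TimeL2 T X) (t : ℝ) :
    primL T Y t (lift T L w) = L (primL T X t w) := by
  change ∫ s in Iic t, (lift T L w) s ∂(timeMeasure T) = L (∫ s in Iic t, w s ∂(timeMeasure T))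
  rw [← L.integral_comp_comm w.integrable.integrableOn]
  exact integral_congr_ae (ae_restrict_of_ae (L.coeFn_compLpL w))

theorem volt_lift (L : X →L[ℝ] Y) (w : TimeL2 T X) :
    volt T Y (lift T L w) = lift T L (volt T X w) := by
  refine Lp.ext ?_
  filter_upwards [coeFn_volt (lift T L w), L.coeFn_compLpL (volt T X w), coeFn_volt w]
    with t h1 h2 h3
  rw [h1, h2, h3, primL_lift]

theorem chi_lift (L : X →L[ℝ] Y) (t : ℝ) (w : TimeL2 T X) :
    chi T Y t (lift T L w) = lift T L (chi T X t w) := by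
  refine Lp.ext ?_
  filter_upwards [coeFn_chi t (lift T L w), L.coeFn_compLpL (chi T X t w), coeFn_chi t w,
    L.coeFn_compLpL w] with s h1 h2 h3 h4
  rw [h1, h2, h3]
  by_cases h : s ∈ Iic t
  · rw [indicator_of_mem h, indicator_of_mem h, h4]
  · rw [indicator_of_notMem h, indicator_of_notMem h, map_zero]

theorem inner_lift_adjoint (L : X →L[ℝ] Y) (a : TimeL2 T X) (b : TimeL2 T Y) :
    inner ℝ (lift T L.adjoint b) a = inner ℝ b (lift T L a) := by
  rw [L2.inner_def, L2.inner_def]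
  refine integral_congr_ae ?_
  filter_upwards [L.coeFn_compLpL a, L.adjoint.coeFn_compLpL b] with s h1 h2
  rw [h1, h2, ContinuousLinearMap.adjoint_inner_left]

end TimeFunctions

/-! ### Weak limits, projections and coercive problems in Hilbert spaces -/

section HilbertSpaces

set_option linter.unusedSectionVars false

variable {E F : Type*} [NormedAddCommGroup E] [InnerProductSpace ℝ E] [CompleteSpace E]
  [NormedAddCommGroup F] [InnerProductSpace ℝ F] [CompleteSpace F] {ι : Type*}

/-- Weak convergence in a Hilbert space along a filter. -/
def WeakTendsto (u : ι → E) (l : Filter ι) (x : E) : Prop :=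
  ∀ z, Tendsto (fun n => inner ℝ z (u n)) l (𝓝 (inner ℝ z x))

/-- Bounded families have weak limits along ultrafilters. -/
theorem exists_weakTendsto (U : Ultrafilter ι) (u : ι → E) (C : ℝ) (h : ∀ n, ‖u n‖ ≤ C) :
    ∃ x, ‖x‖ ≤ C ∧ WeakTendsto u U x := by
  have hb : ∀ z n, ‖inner ℝ z (u n)‖ ≤ C * ‖z‖ := fun z n =>
    (norm_inner_le_norm z (u n)).trans (by
      rw [mul_comm]; exact mul_le_mul_of_nonneg_right (h n) (norm_nonneg z))
  have hex : ∀ z, ∃ a : ℝ, Tendsto (fun n => inner ℝ z (u n)) U (𝓝 a) := by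
    intro z
    obtain ⟨a, -, ha⟩ := (isCompact_closedBall (0 : ℝ) (C * ‖z‖)).ultrafilter_le_nhds
      (U.map fun n => inner ℝ z (u n)) (by
        rw [le_principal_iff, Ultrafilter.mem_coe, Ultrafilter.mem_map]
        exact Filter.univ_mem' fun n => by simpa using hb z n)
    exact ⟨a, ha⟩
  choose a ha using hex
  have hn : ∀ z, ‖a z‖ ≤ C * ‖z‖ := fun z =>
    le_of_tendsto (ha z).norm (Eventually.of_forall (hb z))
  -- Along an ultrafilter the bounded scalars `(z, u n)` converge for all `z` at once, so neither
  -- separability nor a subsequence is needed; the limit functional is represented by Riesz.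
  let ℓ : StrongDual ℝ E := LinearMap.mkContinuous
    { toFun := a
      map_add' := fun y z => tendsto_nhds_unique (ha (y + z)) (by
        simpa only [inner_add_left] using (ha y).add (ha z))
      map_smul' := fun c z => tendsto_nhds_unique (ha (c • z)) (by
        simpa only [inner_smul_left, conj_trivial, RingHom.id_apply, smul_eq_mul]
          using (ha z).const_mul c) } C hn
  refine ⟨(InnerProductSpace.toDual ℝ E).symm ℓ, ?_, fun z => ?_⟩
  · rw [LinearIsometryEquiv.norm_map]
    rcases isEmpty_or_nonempty ι with hι | ⟨⟨n⟩⟩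
    · exact (U.neBot.nonempty_of_mem Filter.univ_mem).elim fun n _ => (IsEmpty.false n).elim
    · exact LinearMap.mkContinuous_norm_le _ ((norm_nonneg _).trans (h n)) _
  · rw [real_inner_comm, InnerProductSpace.toDual_symm_apply]
    exact ha z

namespace WeakTendsto

variable {u v : ι → E} {l : Filter ι} {x y : E}

theorem map (h : WeakTendsto u l x) (L : E →L[ℝ] F) : WeakTendsto (fun n => L (u n)) l (L x) := by
  intro z
  simpa only [ContinuousLinearMap.adjoint_inner_left] using h (L.adjoint z)

theorem add (h : WeakTendsto u l x) (h' : WeakTendsto v l y) :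
    WeakTendsto (fun n => u n + v n) l (x + y) := by
  intro z
  simpa only [inner_add_right] using (h z).add (h' z)

theorem sub (h : WeakTendsto u l x) (h' : WeakTendsto v l y) :
    WeakTendsto (fun n => u n - v n) l (x - y) := by
  intro z
  simpa only [inner_sub_right] using (h z).sub (h' z)

theorem const (x : E) : WeakTendsto (fun _ : ι => x) l x := fun _ => tendsto_const_nhds

theorem smul_zero (h : WeakTendsto u l x) {c : ι → ℝ} (hc : Tendsto c l (𝓝 0)) :
    WeakTendsto (fun n => c n • u n) l 0 := by
  intro z
  simpa only [inner_smul_right, zero_mul, inner_zero_right] using hc.mul (h z)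

theorem unique [l.NeBot] (h : WeakTendsto u l x) (h' : WeakTendsto u l y) : x = y :=
  ext_inner_left ℝ fun z => tendsto_nhds_unique (h z) (h' z)

end WeakTendsto

/-- The metric projection on a closed convex set. -/
theorem exists_projection {K : Set E} (hne : K.Nonempty) (hcl : IsClosed K) (hcv : Convex ℝ K) :
    ∃ P : E → E, (∀ x, P x ∈ K) ∧ ∀ x, ∀ z ∈ K, inner ℝ (x - P x) (z - P x) ≤ 0 := by
  have h : ∀ x : E, ∃ p ∈ K, ∀ z ∈ K, inner ℝ (x - p) (z - p) ≤ 0 := by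
    intro x
    obtain ⟨p, hp, hpx⟩ := exists_norm_eq_iInf_of_complete_convex hne hcl.isComplete hcv x
    exact ⟨p, hp, (norm_eq_iInf_iff_real_inner_le_zero hcv hp).1 hpx⟩
  choose P hP hP' using h
  exact ⟨P, hP, hP'⟩

/-- Closed convex sets are weakly closed: the inequality characterizing the projection `P x` is
affine in the test point, so it passes to the weak limit and yields `|x - P x|² ≤ 0`. -/
theorem WeakTendsto.mem {u : ι → E} {l : Filter ι} [l.NeBot] {x : E} (h : WeakTendsto u l x)
    {K : Set E} (hcl : IsClosed K) (hcv : Convex ℝ K) (hu : ∀ n, u n ∈ K) : x ∈ K := by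
  obtain ⟨n⟩ : Nonempty ι := l.nonempty_of_neBot
  obtain ⟨P, hP, hP'⟩ := exists_projection ⟨u n, hu n⟩ hcl hcv
  have h1 : inner ℝ (x - P x) (x - P x) ≤ 0 :=
    le_of_tendsto (((h.sub (WeakTendsto.const (P x)))) (x - P x))
      (Eventually.of_forall fun n => hP' x _ (hu n))
  rw [real_inner_self_nonpos, sub_eq_zero] at h1
  rw [h1]
  exact hP x

/-- The Lions–Stampacchia theorem on variational inequalities. -/
theorem exists_variationalInequality (B : E →L[ℝ] E) {c : ℝ} (hc : 0 < c)
    (hB : ∀ z, c * ‖z‖ ^ 2 ≤ inner ℝ (B z) z) {K : Set E} (hne : K.Nonempty) (hcl : IsClosed K)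
    (hcv : Convex ℝ K) (f : E) : ∃ x ∈ K, ∀ z ∈ K, inner ℝ (B x - f) (x - z) ≤ 0 := by
  obtain ⟨P, hP, hP'⟩ := exists_projection hne hcl hcv
  set M : ℝ := ‖B‖ + 1 with hM
  have hM0 : 0 < M := by positivity
  -- Solutions are the fixed points of `x ↦ P (x - ρ (B x - f))`. This `ρ` minimizes `1 - 2 ρ c + ρ²
  -- M²`, the bound for the squared contraction factor; the summand `1` in `M` only secures `M > 0`.
  set ρ : ℝ := c / M ^ 2 with hρ
  have hρ0 : 0 < ρ := by positivity
  have hPn : ∀ x y, ‖P x - P y‖ ≤ ‖x - y‖ := by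
    intro x y
    have h1 := hP' x _ (hP y)
    have h2 := hP' y _ (hP x)
    have h3 : inner ℝ (P x - P y) (P x - P y) ≤ inner ℝ (x - y) (P x - P y) := by
      simp only [inner_sub_left, inner_sub_right] at h1 h2 ⊢
      linarith
    rw [real_inner_self_eq_norm_sq] at h3
    have h4 := real_inner_le_norm (x - y) (P x - P y)
    by_contra h5
    push Not at h5
    nlinarith [norm_nonneg (x - y), norm_nonneg (P x - P y)]
  set k : ℝ := √(1 - c ^ 2 / M ^ 2) with hk
  have hk1 : k < 1 := by
    rw [hk, Real.sqrt_lt' one_pos]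
    have : 0 < c ^ 2 / M ^ 2 := by positivity
    linarith
  have hd : ∀ d : E, ‖d - ρ • B d‖ ≤ k * ‖d‖ := by
    intro d
    have h1 : ‖d - ρ • B d‖ ^ 2 ≤ (1 - c ^ 2 / M ^ 2) * ‖d‖ ^ 2 := by
      rw [norm_sub_sq_real, inner_smul_right, norm_smul, Real.norm_of_nonneg hρ0.le, mul_pow,
        real_inner_comm]
      have h2 : ‖B d‖ ^ 2 ≤ M ^ 2 * ‖d‖ ^ 2 := by
        rw [← mul_pow]
        refine pow_le_pow_left₀ (norm_nonneg _) ((B.le_opNorm d).trans ?_) 2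
        exact mul_le_mul_of_nonneg_right (by rw [hM]; linarith) (norm_nonneg _)
      have h3 := mul_le_mul_of_nonneg_left h2 (sq_nonneg ρ)
      have h4 := mul_le_mul_of_nonneg_left (hB d) hρ0.le
      have h5 : ρ ^ 2 * (M ^ 2 * ‖d‖ ^ 2) = c ^ 2 / M ^ 2 * ‖d‖ ^ 2 := by
        rw [hρ]; field_simp
      have h6 : ρ * (c * ‖d‖ ^ 2) = c ^ 2 / M ^ 2 * ‖d‖ ^ 2 := by
        rw [hρ]; field_simp
      linarith
    have h2 : ‖d - ρ • B d‖ ^ 2 ≤ (k * ‖d‖) ^ 2 := by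
      refine h1.trans ?_
      rw [mul_pow]
      refine mul_le_mul_of_nonneg_right ?_ (sq_nonneg _)
      rcases le_total 0 (1 - c ^ 2 / M ^ 2) with h | h
      · rw [hk, Real.sq_sqrt h]
      · exact h.trans (sq_nonneg _)
    exact le_of_sq_le_sq h2 (mul_nonneg (Real.sqrt_nonneg _) (norm_nonneg _))
  have hcontr : ContractingWith ⟨k, Real.sqrt_nonneg _⟩ fun x => P (x - ρ • (B x - f)) := by
    refine ⟨hk1, LipschitzWith.of_dist_le_mul fun x y => ?_⟩
    rw [dist_eq_norm, dist_eq_norm]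
    refine (hPn _ _).trans ?_
    have : x - ρ • (B x - f) - (y - ρ • (B y - f)) = (x - y) - ρ • B (x - y) := by
      rw [map_sub, smul_sub, smul_sub, smul_sub]; abel
    rw [this]
    exact hd _
  obtain ⟨x, hx⟩ : ∃ x, P (x - ρ • (B x - f)) = x := ⟨_, hcontr.fixedPoint_isFixedPt⟩
  refine ⟨x, hx ▸ hP _, fun z hz => ?_⟩
  have h1 := hP' (x - ρ • (B x - f)) z hz
  rw [hx] at h1
  have h2 : x - ρ • (B x - f) - x = -(ρ • (B x - f)) := by abel
  rw [h2, inner_neg_left, inner_smul_left, conj_trivial] at h1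
  have h3 : 0 ≤ inner ℝ (B x - f) (z - x) := by
    by_contra h; push Not at h; nlinarith
  rw [← neg_sub z x, inner_neg_right]
  linarith

/-- A coercive operator on a Hilbert space is invertible. -/
theorem exists_inverse_of_coercive (B : E →L[ℝ] E) {c : ℝ} (hc : 0 < c)
    (hB : ∀ z, c * ‖z‖ ^ 2 ≤ inner ℝ (B z) z) :
    ∃ R : E →L[ℝ] E, (∀ x, B (R x) = x) ∧ ∀ x, R (B x) = x := by
  have hco : IsCoercive ((innerSL ℝ).comp B : E →L[ℝ] E →L[ℝ] ℝ) :=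
    ⟨c, hc, fun z => by simpa [mul_assoc, sq] using hB z⟩
  have he : ∀ x, hco.continuousLinearEquivOfBilin x = B x := fun x =>
    ext_inner_right ℝ fun z => by
      rw [IsCoercive.continuousLinearEquivOfBilin_apply]; simp
  refine ⟨hco.continuousLinearEquivOfBilin.symm, fun x => ?_, fun x => ?_⟩
  · rw [← he]; simp
  · rw [← he]; simp

end HilbertSpaces

/-! ### Yosida approximation of the time derivative -/

section Resolvent

variable {X : Type*} [NormedAddCommGroup X] [InnerProductSpace ℝ X] [CompleteSpace X] {T : ℝ}

/-- The resolvent of the Volterra operator: `R x` is the Yosida approximation of the time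
derivative of `x`. -/
theorem exists_resolvent (hT : 0 ≤ T) {c : ℝ} (hc : 0 < c) :
    ∃ R : TimeL2 T X →L[ℝ] TimeL2 T X,
      (∀ x, volt T X (R x) + c • R x = x) ∧ ∀ w, R (volt T X w + c • w) = w := by
  obtain ⟨R, h1, h2⟩ := exists_inverse_of_coercive
    (volt T X + c • ContinuousLinearMap.id ℝ (TimeL2 T X)) hc (fun z => by
      have h := inner_volt_nonneg hT z
      rw [real_inner_comm] at h
      simp only [_root_.add_apply, _root_.smul_apply,
        ContinuousLinearMap.id_apply, inner_add_left, inner_smul_left, conj_trivial,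
        real_inner_self_eq_norm_sq]
      linarith)
  exact ⟨R, fun x => by simpa using h1 x, fun x => by simpa using h2 x⟩

theorem inner_chi_resolvent (w : TimeL2 T X) (c : ℝ) {t : ℝ} (ht : t ∈ Icc 0 T) :
    inner ℝ (chi T X t w) (volt T X w + c • w)
      = (1 / 2) * ‖primL T X t w‖ ^ 2 + c * inner ℝ (chi T X t w) w := by
  rw [inner_add_right, inner_chi_volt w ht, inner_smul_right]

end Resolvent

/-! ### The linear parabolic equation for the velocity -/

section Parabolic

set_option linter.unusedSectionVars false

variable {V H W : Type*} [NormedAddCommGroup V] [InnerProductSpace ℝ V] [CompleteSpace V]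
  [NormedAddCommGroup H] [InnerProductSpace ℝ H] [CompleteSpace H]
  [NormedAddCommGroup W] [InnerProductSpace ℝ W] [CompleteSpace W] {T : ℝ}

theorem norm_sq_lift_add {i : V →L[ℝ] H} {D : V →L[ℝ] W}
    (hnorm : ∀ z, ‖z‖ ^ 2 = ‖i z‖ ^ 2 + ‖D z‖ ^ 2) (u : TimeL2 T V) :
    ‖u‖ ^ 2 = ‖lift T i u‖ ^ 2 + ‖lift T D u‖ ^ 2 := by
  rw [← real_inner_self_eq_norm_sq, ← real_inner_self_eq_norm_sq, ← real_inner_self_eq_norm_sq,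
    L2.inner_def, L2.inner_def, L2.inner_def,
    ← integral_add (L2.integrable_inner _ _) (L2.integrable_inner _ _)]
  refine integral_congr_ae ?_
  filter_upwards [i.coeFn_compLpL u, D.coeFn_compLpL u] with t h1 h2
  rw [h1, h2, real_inner_self_eq_norm_sq, real_inner_self_eq_norm_sq, real_inner_self_eq_norm_sq,
    hnorm]

variable (i : V →L[ℝ] H) (D : V →L[ℝ] W) (ν : ℝ)

/-- `u ∈ L²(0,T;V)` solves `u' + ν D*D u = F`, `u(0) = 0`, in integrated form in `V*`, where `V*`
is identified with `V`. -/
def IsParabolicSol (F u : TimeL2 T V) : Prop :=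
  lift T i.adjoint (lift T i u)
    = volt T V (F - ν • lift T D.adjoint (lift T D u))

variable {i D ν}

theorem IsParabolicSol.add {F u F' u' : TimeL2 T V} (h : IsParabolicSol i D ν F u)
    (h' : IsParabolicSol i D ν F' u') : IsParabolicSol i D ν (F + F') (u + u') := by
  unfold IsParabolicSol at *
  simp only [map_add, map_sub, map_smul, smul_add] at *
  rw [h, h']
  abel

theorem IsParabolicSol.smul {F u : TimeL2 T V} (c : ℝ) (h : IsParabolicSol i D ν F u) :
    IsParabolicSol i D ν (c • F) (c • u) := by
  unfold IsParabolicSol at *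
  simp only [map_sub, map_smul] at *
  rw [h, smul_sub, smul_comm c ν]

/-- Testing the integrated equation with `u` itself gives `‖i u‖² = -ν (volt D u, D u) ≤ 0`, since
`volt` commutes with operators acting on values. Then `volt` annihilates `D* D u`, and injectivity
of `volt` leaves `D u = 0`. No product rule for functions with derivative in `V*` is required. -/
theorem IsParabolicSol.eq_zero (hT : 0 < T) (hν : 0 < ν)
    (hnorm : ∀ z, ‖z‖ ^ 2 = ‖i z‖ ^ 2 + ‖D z‖ ^ 2) {u : TimeL2 T V}
    (h : IsParabolicSol i D ν 0 u) : u = 0 := by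
  unfold IsParabolicSol at h
  rw [zero_sub, map_neg, map_smul] at h
  have h1 : ‖lift T i u‖ ^ 2 = -(ν * inner ℝ (volt T W (lift T D u)) (lift T D u)) := by
    rw [← real_inner_self_eq_norm_sq, ← inner_lift_adjoint, h, volt_lift, inner_neg_left,
      inner_smul_left, conj_trivial, inner_lift_adjoint]
  have h2 := inner_volt_nonneg hT.le (lift T D u)
  rw [real_inner_comm] at h2
  have h3 : lift T i u = 0 := by
    rw [← norm_eq_zero]
    nlinarith [sq_nonneg ‖lift T i u‖, mul_nonneg hν.le h2]
  rw [h3, map_zero, eq_comm, neg_eq_zero, smul_eq_zero_iff_right hν.ne'] at h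
  have h4 := volt_injective hT _ h
  have h5 : lift T D u = 0 := by
    rw [← norm_eq_zero, ← sq_eq_zero_iff, ← real_inner_self_eq_norm_sq, ← inner_lift_adjoint, h4,
      inner_zero_left]
  rw [← norm_eq_zero, ← sq_eq_zero_iff, norm_sq_lift_add hnorm, h3, h5]
  simp

theorem IsParabolicSol.unique (hT : 0 < T) (hν : 0 < ν)
    (hnorm : ∀ z, ‖z‖ ^ 2 = ‖i z‖ ^ 2 + ‖D z‖ ^ 2) {F u u' : TimeL2 T V}
    (h : IsParabolicSol i D ν F u) (h' : IsParabolicSol i D ν F u') : u = u' := by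
  have h1 := h.add (h'.smul (-1))
  rw [neg_one_smul, neg_one_smul, ← sub_eq_add_neg, ← sub_eq_add_neg, sub_self] at h1
  exact sub_eq_zero.1 (h1.eq_zero hT hν hnorm)

/-- The parabolic equation with the time derivative replaced by its Yosida approximation. -/
theorem exists_regularized_parabolic (hT : 0 ≤ T) (hν : 0 < ν)
    (hnorm : ∀ z, ‖z‖ ^ 2 = ‖i z‖ ^ 2 + ‖D z‖ ^ 2) {c : ℝ} (hc : 0 < c) (F : TimeL2 T V) :
    ∃ (u : TimeL2 T V) (w : TimeL2 T H), lift T i u = volt T H w + c • w ∧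
      lift T i.adjoint w + ν • lift T D.adjoint (lift T D u) = F := by
  obtain ⟨R, hR, -⟩ := exists_resolvent (X := H) hT hc
  -- Coercivity of the resolvent: `(R x, x) ≥ c ‖R x‖²` by monotonicity of `volt`, while `x = volt
  -- (R x) + c R x` gives `‖x‖ ≤ M ‖R x‖`.
  set M : ℝ := ‖volt T H‖ + c with hM
  have hM0 : 0 < M := by positivity
  have hRc : ∀ x, c / M ^ 2 * ‖x‖ ^ 2 ≤ inner ℝ (R x) x := by
    intro x
    have h1 : inner ℝ (R x) x = inner ℝ (R x) (volt T H (R x)) + c * ‖R x‖ ^ 2 := by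
      conv_lhs => rw [← hR x, hR x]
      nth_rw 2 [← hR x]
      rw [inner_add_right, inner_smul_right, real_inner_self_eq_norm_sq]
    have h2 : ‖x‖ ≤ M * ‖R x‖ := by
      nth_rw 1 [← hR x]
      refine (norm_add_le _ _).trans ?_
      rw [norm_smul, Real.norm_of_nonneg hc.le, hM, add_mul]
      exact add_le_add_left ((volt T H).le_opNorm _) _
    have h3 : ‖x‖ ^ 2 ≤ M ^ 2 * ‖R x‖ ^ 2 := by
      rw [← mul_pow]
      exact pow_le_pow_left₀ (norm_nonneg _) h2 2
    have h4 : c / M ^ 2 * ‖x‖ ^ 2 ≤ c / M ^ 2 * (M ^ 2 * ‖R x‖ ^ 2) :=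
      mul_le_mul_of_nonneg_left h3 (by positivity)
    have h5 : c / M ^ 2 * (M ^ 2 * ‖R x‖ ^ 2) = c * ‖R x‖ ^ 2 := by field_simp
    have h6 := inner_volt_nonneg hT (R x)
    linarith
  obtain ⟨S, hS, -⟩ := exists_inverse_of_coercive
    ((lift T i.adjoint).comp (R.comp (lift T i)) + ν • (lift T D.adjoint).comp (lift T D))
    (c := min (c / M ^ 2) ν) (lt_min (by positivity) hν) (fun z => by
      simp only [_root_.add_apply, _root_.smul_apply, ContinuousLinearMap.comp_apply,
        inner_add_left, inner_smul_left, conj_trivial]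
      rw [inner_lift_adjoint, inner_lift_adjoint, real_inner_self_eq_norm_sq,
        norm_sq_lift_add hnorm, mul_add]
      refine add_le_add (le_trans ?_ (hRc _)) ?_
      · exact mul_le_mul_of_nonneg_right (min_le_left _ _) (sq_nonneg _)
      · exact mul_le_mul_of_nonneg_right (min_le_right _ _) (sq_nonneg _))
  exact ⟨S F, R (lift T i (S F)), (hR _).symm, by simpa using hS F⟩

/-- The energy identity for the regularized equation. -/
theorem regularized_parabolic_energy {c : ℝ} {F u : TimeL2 T V} {w : TimeL2 T H}
    (h1 : lift T i u = volt T H w + c • w)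
    (h2 : lift T i.adjoint w + ν • lift T D.adjoint (lift T D u) = F) {t : ℝ}
    (ht : t ∈ Icc 0 T) :
    (1 / 2) * ‖primL T H t w‖ ^ 2 + c * inner ℝ (chi T H t w) w
      + ν * inner ℝ (chi T W t (lift T D u)) (lift T D u) = inner ℝ (chi T V t F) u := by
  rw [← inner_chi_right t F u, ← h2, inner_add_left, inner_smul_left, inner_lift_adjoint,
    inner_lift_adjoint, ← chi_lift, ← chi_lift, inner_chi_right, inner_chi_right, h1,
    inner_chi_resolvent w c ht, conj_trivial]

/-- With `b = ‖F‖ ‖u‖`, the energy identity bounds `|∫₀ᵗ w|²` by `2 b`, and both `c ‖w‖²` and `ν ‖D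
u‖²` by `b`. Together they give `‖u‖² ≤ C₀ b`, and one factor `‖u‖` cancels. The bound must not
depend on `c`, although `‖w‖` itself is not controlled. -/
theorem exists_bound_regularized_parabolic (hT : 0 ≤ T) (hν : 0 < ν)
    (hnorm : ∀ z, ‖z‖ ^ 2 = ‖i z‖ ^ 2 + ‖D z‖ ^ 2) :
    ∃ C : ℝ, 0 ≤ C ∧ ∀ (c : ℝ) (F u : TimeL2 T V) (w : TimeL2 T H), 0 < c → c ≤ 1 →
      lift T i u = volt T H w + c • w →
      lift T i.adjoint w + ν • lift T D.adjoint (lift T D u) = F →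
      ‖u‖ ≤ C * ‖F‖ ∧ ∀ t ∈ Icc 0 T, ‖primL T H t w‖ ≤ C * ‖F‖ := by
  set κ : ℝ := ((timeMeasure T univ) ^ (1 / 2 : ℝ)).toReal with hκ
  set C₀ : ℝ := 4 * κ ^ 2 + 2 + 1 / ν with hC₀
  have hC₀1 : 2 ≤ C₀ := by
    have : 0 < 1 / ν := by positivity
    linarith [sq_nonneg κ]
  refine ⟨C₀, by linarith, fun c F u w hc hc1 h1 h2 => ?_⟩
  set b : ℝ := ‖F‖ * ‖u‖ with hb
  have hb0 : 0 ≤ b := by positivity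
  have hFt : ∀ t, inner ℝ (chi T V t F) u ≤ b := fun t =>
    (real_inner_le_norm _ _).trans
      (mul_le_mul_of_nonneg_right (norm_chi_le t F) (norm_nonneg u))
  have hp : ∀ t ∈ Icc 0 T, ‖primL T H t w‖ ^ 2 ≤ 2 * b := by
    intro t ht
    have h := regularized_parabolic_energy h1 h2 ht
    have := hFt t
    have := mul_nonneg hc.le (inner_chi_self_nonneg t w)
    have := mul_nonneg hν.le (inner_chi_self_nonneg t (lift T D u))
    linarith
  have hE := regularized_parabolic_energy h1 h2 (right_mem_Icc.2 hT)
  have hFT := hFt T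
  rw [← hE, chi_eq_self, chi_eq_self, real_inner_self_eq_norm_sq, real_inner_self_eq_norm_sq]
    at hFT
  have hw : c * ‖w‖ ^ 2 ≤ b := by
    linarith [sq_nonneg ‖primL T H T w‖, mul_nonneg hν.le (sq_nonneg ‖lift T D u‖)]
  have hD : ‖lift T D u‖ ^ 2 ≤ 1 / ν * b := by
    rw [one_div_mul_eq_div, le_div_iff₀' hν]
    linarith [sq_nonneg ‖primL T H T w‖, mul_nonneg hc.le (sq_nonneg ‖w‖)]
  have hv : ‖volt T H w‖ ≤ κ * √(2 * b) := by
    refine TimeL2.norm_le_of_forall_mem _ (Real.sqrt_nonneg _) ?_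
    filter_upwards [coeFn_volt w, ae_restrict_mem (measurableSet_Ioo (a := 0) (b := T))]
      with t ht hm
    rw [ht]
    exact Real.le_sqrt_of_sq_le (hp t (Ioo_subset_Icc_self hm))
  have hv2 : ‖volt T H w‖ ^ 2 ≤ κ ^ 2 * (2 * b) := by
    rw [← Real.sq_sqrt (by positivity : 0 ≤ 2 * b), ← mul_pow]
    exact pow_le_pow_left₀ (norm_nonneg _) hv 2
  have hi : ‖lift T i u‖ ^ 2 ≤ 2 * ‖volt T H w‖ ^ 2 + 2 * (c * (c * ‖w‖ ^ 2)) := by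
    have h := norm_add_le (volt T H w) (c • w)
    rw [← h1, norm_smul, Real.norm_of_nonneg hc.le] at h
    have h' := pow_le_pow_left₀ (norm_nonneg _) h 2
    linarith [sq_nonneg (‖volt T H w‖ - c * ‖w‖), show (‖volt T H w‖ + c * ‖w‖) ^ 2
      + (‖volt T H w‖ - c * ‖w‖) ^ 2 = 2 * ‖volt T H w‖ ^ 2 + 2 * (c * (c * ‖w‖ ^ 2)) by ring]
  have hcc : c * (c * ‖w‖ ^ 2) ≤ b := 
    (mul_le_of_le_one_left (by positivity) hc1).trans hw
  have hu : ‖u‖ ^ 2 ≤ C₀ * b := by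
    rw [norm_sq_lift_add hnorm, hC₀]
    linarith
  have hu' : ‖u‖ ≤ C₀ * ‖F‖ := by
    rcases eq_or_lt_of_le (norm_nonneg u) with h | h
    · rw [← h]; positivity
    · rw [hb] at hu
      exact le_of_mul_le_mul_right (by linarith [hu, sq ‖u‖]) h
  refine ⟨hu', fun t ht => le_of_sq_le_sq ?_ (by positivity)⟩
  have h3 := hp t ht
  have h4 : b ≤ C₀ * ‖F‖ ^ 2 := by
    rw [hb]
    exact (mul_le_mul_of_nonneg_left hu' (norm_nonneg F)).trans_eq (by ring)
  have h5 : 2 * (C₀ * ‖F‖ ^ 2) ≤ C₀ * (C₀ * ‖F‖ ^ 2) :=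
    mul_le_mul_of_nonneg_right hC₀1 (by positivity)
  linarith [show (C₀ * ‖F‖) ^ 2 = C₀ * (C₀ * ‖F‖ ^ 2) by ring]

/-- Existence for the linear parabolic problem with zero initial value, with the pointwise values
`v t` in `H` and the energy inequality. -/
theorem exists_parabolicSol (hT : 0 < T) (hν : 0 < ν)
    (hnorm : ∀ z, ‖z‖ ^ 2 = ‖i z‖ ^ 2 + ‖D z‖ ^ 2) :
    ∃ C : ℝ, 0 ≤ C ∧ ∀ F : TimeL2 T V, ∃ u : TimeL2 T V, IsParabolicSol i D ν F u ∧
      ‖u‖ ≤ C * ‖F‖ ∧ (∀ t ∈ Icc 0 T, 0 ≤ inner ℝ (chi T V t F) u) ∧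
      ∀ t ∈ Icc 0 T, ∃ v : H, ‖v‖ ≤ C * ‖F‖ ∧
        i.adjoint v = primL T V t (F - ν • lift T D.adjoint (lift T D u)) := by
  obtain ⟨C, hC0, hC⟩ := exists_bound_regularized_parabolic (i := i) (D := D) hT.le hν hnorm
  refine ⟨C, hC0, fun F => ?_⟩
  have hcpos : ∀ n : ℕ, 0 < (1 : ℝ) / (n + 1) := fun n => by positivity
  have hc1 : ∀ n : ℕ, (1 : ℝ) / (n + 1) ≤ 1 := fun n =>
    div_le_one_of_le₀ (by linarith [(n.cast_nonneg : (0 : ℝ) ≤ n)]) (by positivity)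
  have hex := fun n : ℕ => exists_regularized_parabolic hT.le hν hnorm (hcpos n) F
  choose u w h1 h2 using hex
  have hb := fun n => hC _ F (u n) (w n) (hcpos n) (hc1 n) (h1 n) (h2 n)
  have hlim : Tendsto (fun n : ℕ => (1 : ℝ) / (n + 1)) (hyperfilter ℕ) (𝓝 0) :=
    tendsto_one_div_add_atTop_nhds_zero_nat.mono_left (Nat.hyperfilter_le_atTop)
  obtain ⟨u₀, hu₀, hu⟩ := exists_weakTendsto (hyperfilter ℕ) u _ fun n => (hb n).1
  set A : TimeL2 T V →L[ℝ] TimeL2 T V := ν • (lift T D.adjoint).comp (lift T D) with hA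
  -- The equation expresses `i* w n` through `u n`; weak convergence of `u n` therefore suffices,
  -- without a bound on `w n`.
  have hiw : ∀ n, lift T i.adjoint (w n) = F - A (u n) := fun n =>
    eq_sub_of_add_eq (h2 n)
  have hFA : WeakTendsto (fun n => F - A (u n)) (hyperfilter ℕ) (F - A u₀) :=
    (WeakTendsto.const F).sub (hu.map A)
  refine ⟨u₀, ?_, hu₀, fun t ht => ?_, fun t ht => ?_⟩
  · have e1 := ((hu.map (lift T i)).map (lift T i.adjoint))
    have e2 := (hFA.map (volt T V)).add (hFA.smul_zero hlim)
    have e3 : (fun n => lift T i.adjoint (lift T i (u n)))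
        = fun n => volt T V (F - A (u n)) + (1 / ((n : ℝ) + 1)) • (F - A (u n)) := by
      funext n
      rw [h1, map_add, map_smul, ← volt_lift, hiw]
    rw [e3] at e1
    have e4 := e1.unique e2
    rw [add_zero] at e4
    exact e4
  · refine ge_of_tendsto (hu (chi T V t F)) (Eventually.of_forall fun n => ?_)
    rw [← regularized_parabolic_energy (h1 n) (h2 n) ht]
    have := mul_nonneg (hcpos n).le (inner_chi_self_nonneg t (w n))
    have := mul_nonneg hν.le (inner_chi_self_nonneg t (lift T D (u n)))
    positivity
  -- For fixed `t` the primitives of `w n` are bounded in `H`. Their weak limit supplies a value at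
  -- every single time, with the uniform bound needed for `L^∞(0,T;H)`.
  · obtain ⟨v, hv, hvt⟩ := exists_weakTendsto (hyperfilter ℕ) (fun n => primL T H t (w n)) _
      fun n => (hb n).2 t ht
    refine ⟨v, hv, (hvt.map i.adjoint).unique ?_⟩
    have e := hFA.map (primL T V t)
    simp only [← hiw, primL_lift] at e
    exact e

/-- The solution operator of the linear parabolic problem. -/
theorem exists_parabolicOperator (hT : 0 < T) (hν : 0 < ν)
    (hnorm : ∀ z, ‖z‖ ^ 2 = ‖i z‖ ^ 2 + ‖D z‖ ^ 2) :
    ∃ S : TimeL2 T V →L[ℝ] TimeL2 T V, (∀ F, IsParabolicSol i D ν F (S F)) ∧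
      (∀ F, ∀ t ∈ Icc 0 T, 0 ≤ inner ℝ (chi T V t F) (S F)) ∧
      ∀ F, ∃ C : ℝ, ∀ t ∈ Icc 0 T, ∃ v : H, ‖v‖ ≤ C ∧
        i.adjoint v = primL T V t (F - ν • lift T D.adjoint (lift T D (S F))) := by
  obtain ⟨C, hC0, hC⟩ := exists_parabolicSol (i := i) (D := D) hT hν hnorm
  choose S h1 h2 h3 h4 using hC
  -- The solutions are picked by choice; uniqueness makes the choice linear.
  refine ⟨LinearMap.mkContinuous
    { toFun := S
      map_add' := fun a b => (h1 (a + b)).unique hT hν hnorm ((h1 a).add (h1 b))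
      map_smul' := fun c a => (h1 (c • a)).unique hT hν hnorm ((h1 a).smul c) } C h2, h1, h3,
    fun F => ⟨_, h4 F⟩⟩

end Parabolic

/-! ### Curves and closed sets -/

section ClosedSets

/-- If `z` solves `z + c z' ∈ C` with `z(0) ∈ C` for a closed convex set `C`, then `z` stays
in `C`. -/
theorem mem_of_relaxation {E : Type*} [NormedAddCommGroup E] [NormedSpace ℝ E] [CompleteSpace E]
    {C : Set E} (hcl : IsClosed C) (hcv : Convex ℝ C) {z w : ℝ → E} {c t : ℝ} (hc : 0 < c)
    (ht : 0 ≤ t) (hw : IntervalIntegrable w volume 0 t) (h0 : z 0 ∈ C)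
    (hz : ∀ s ∈ Icc 0 t, z s = z 0 + ∫ r in (0 : ℝ)..s, w r)
    (hC : ∀ᵐ s, s ∈ Ioo 0 t → z s + c • w s ∈ C) : z t ∈ C := by
  by_contra hzt
  obtain ⟨f, b, hf, hb⟩ := geometric_hahn_banach_closed_point hcv hcl hzt
  have hcont : ContinuousOn z (Icc 0 t) := by
    have h1 := intervalIntegral.continuousOn_primitive_interval
      ((intervalIntegrable_iff' (by simp)).1 hw)
    rw [uIcc_of_le ht] at h1
    exact (continuousOn_const.add h1).congr hz
  -- Let `f < b` on `C` and `f (z t) > b`, and let `m` be the last time with `f (z m) ≤ b`. After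
  -- `m`, `f (z s) > b` and `f (z s + c w s) < b` force `f (w s) < 0`, so `f ∘ z` cannot rise above
  -- `b`.
  have hS : IsCompact (Icc 0 t ∩ (fun s => f (z s)) ⁻¹' Iic b) :=
    isCompact_Icc.of_isClosed_subset
      ((f.continuous.comp_continuousOn hcont).preimage_isClosed_of_isClosed isClosed_Icc isClosed_Iic)
      inter_subset_left
  obtain ⟨m, ⟨hm, hmb⟩, hmax⟩ := hS.exists_isGreatest
    ⟨0, left_mem_Icc.2 ht, (hf _ h0).le⟩
  have hI : ∀ s ∈ Icc 0 t, IntervalIntegrable w volume 0 s := fun s hs =>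
    hw.mono_set (uIcc_subset_uIcc_left (by rwa [uIcc_of_le ht]))
  have hmt : IntervalIntegrable w volume m t := (hI m hm).symm.trans hw
  have h1 : z t - z m = ∫ r in m..t, w r := by
    rw [hz t (right_mem_Icc.2 ht), hz m hm, add_sub_add_left_eq_sub]
    exact intervalIntegral.integral_interval_sub_left hw (hI m hm)
  have h2 : f (z t) - f (z m) = ∫ r in m..t, f (w r) := by
    rw [← map_sub, h1, ← f.intervalIntegral_comp_comm hmt]
  have h3 : ∫ r in m..t, f (w r) ≤ ∫ r in m..t, (0 : ℝ) := by
    refine intervalIntegral.integral_mono_ae_restrict hm.2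
      ⟨f.integrable_comp hmt.1, f.integrable_comp hmt.2⟩ intervalIntegrable_const ?_
    rw [Measure.restrict_congr_set Ioo_ae_eq_Icc.symm]
    filter_upwards [ae_restrict_of_ae hC, ae_restrict_mem measurableSet_Ioo] with s hs hsm
    have h4 := hf _ (hs ⟨hm.1.trans_lt hsm.1, hsm.2⟩)
    have h5 : b < f (z s) := by
      by_contra h
      exact absurd (hmax ⟨⟨hm.1.trans hsm.1.le, hsm.2.le⟩, not_lt.1 h⟩) (not_le.2 hsm.1)
    rw [map_add, map_smul, smul_eq_mul] at h4
    by_contra h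
    push Not at h
    nlinarith [mul_pos hc h]
  rw [intervalIntegral.integral_zero] at h3
  have : f (z m) ≤ b := hmb
  linarith

/-- A continuous curve that lies in a closed set for almost all times lies in it. -/
theorem forall_mem_of_ae_mem {E : Type*} [NormedAddCommGroup E] {T : ℝ} (hT : 0 < T)
    {S : Set E} (hS : IsClosed S) (hne : S.Nonempty) {u : ℝ → E}
    (hu : ContinuousOn u (Icc 0 T)) (h : ∀ᵐ t ∂(timeMeasure T), u t ∈ S) :
    ∀ t ∈ Icc 0 T, u t ∈ S := by
  have h1 : EqOn (fun t => Metric.infDist (u t) S) (fun _ => (0 : ℝ)) (Icc 0 T) := by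
    refine eqOn_of_ae_eq hT ((Metric.continuous_infDist_pt S).comp_continuousOn hu)
      continuousOn_const ?_
    filter_upwards [h] with t ht using Metric.infDist_zero_of_mem ht
  intro t ht
  exact (hS.mem_iff_infDist_zero hne).2 (h1 ht)

end ClosedSets

/-! ### Moving convex sets and their relaxations -/

section SweepingFamily

set_option linter.unusedSectionVars false

variable {X : Type*} [NormedAddCommGroup X] [InnerProductSpace ℝ X] [CompleteSpace X] {T κ : ℝ}
  {ρ : TimeL2 T ℝ} {K : ℝ → ℝ → Set X}

theorem primL_zero (hT : 0 ≤ T) (w : TimeL2 T X) : primL T X 0 w = 0 := by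
  rw [primL_eq w (left_mem_Icc.2 hT), intervalIntegral.integral_same]

/-- A family of closed convex sets `K t c`, where `K t 0` is the moving set of a sweeping process
and `K t c` a relaxation of it. The motion is controlled by the absolutely continuous function
`t ↦ ∫₀ᵗ ρ`: `K s 0` is contained in the relaxation of `K t 0` of size `|∫ₛᵗ ρ|`, and a point of
the relaxation of size `c` is moved into `K t 0` by multiplication with `κ / (κ + c)`. -/
structure IsSweepingFamily (T κ : ℝ) (ρ : TimeL2 T ℝ) (K : ℝ → ℝ → Set X) : Prop where
  pos : 0 < κ
  monotone_prim : MonotoneOn (fun t => primL T ℝ t ρ) (Icc 0 T)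
  isClosed : ∀ t ∈ Icc 0 T, IsClosed {p : X × ℝ | p.1 ∈ K t p.2}
  convex : ∀ t ∈ Icc 0 T, Convex ℝ {p : X × ℝ | p.1 ∈ K t p.2}
  zero_mem : ∀ t ∈ Icc 0 T, 0 ∈ K t 0
  mono : ∀ t ∈ Icc 0 T, ∀ c c', c ≤ c' → K t c ⊆ K t c'
  shift : ∀ s ∈ Icc 0 T, ∀ t ∈ Icc 0 T, K s 0 ⊆ K t |primL T ℝ t ρ - primL T ℝ s ρ|
  scale : ∀ t ∈ Icc 0 T, ∀ c, 0 ≤ c → ∀ τ ∈ K t c, (κ / (κ + c)) • τ ∈ K t 0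

/-- The `L²` functions with values in the moving set. -/
def selections (T : ℝ) (K : ℝ → ℝ → Set X) : Set (TimeL2 T X) :=
  {x | ∀ᵐ t ∂(timeMeasure T), x t ∈ K t 0}

namespace IsSweepingFamily

variable (h : IsSweepingFamily T κ ρ K)
include h

theorem isClosed_zero {t : ℝ} (ht : t ∈ Icc 0 T) : IsClosed (K t 0) :=
  (h.isClosed t ht).preimage (Continuous.prodMk_left (0 : ℝ))

theorem convex_zero {t : ℝ} (ht : t ∈ Icc 0 T) : Convex ℝ (K t 0) := by
  intro x hx y hy a b ha hb hab
  have := h.convex t ht (show (x, (0 : ℝ)) ∈ _ from hx) (show (y, (0 : ℝ)) ∈ _ from hy) ha hb hab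
  simpa using this

theorem isClosed_selections : IsClosed (selections T K) := by
  refine IsSeqClosed.isClosed fun u x hu hux => ?_
  obtain ⟨φ, -, hφ⟩ := (tendstoInMeasure_of_tendsto_Lp hux).exists_seq_tendsto_ae
  have hu' : ∀ᵐ t ∂(timeMeasure T), ∀ n, u (φ n) t ∈ K t 0 := ae_all_iff.2 fun n => hu (φ n)
  filter_upwards [hφ, hu', ae_restrict_mem (measurableSet_Ioo (a := 0) (b := T))] with t h1 h2 h3
  exact (h.isClosed_zero (Ioo_subset_Icc_self h3)).mem_of_tendsto h1 (Eventually.of_forall h2)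

theorem convex_selections : Convex ℝ (selections T K) := by
  intro x hx y hy a b ha hb hab
  filter_upwards [hx, hy, Lp.coeFn_add (a • x) (b • y), Lp.coeFn_smul a x, Lp.coeFn_smul b y,
    ae_restrict_mem (measurableSet_Ioo (a := 0) (b := T))] with t h1 h2 h3 h4 h5 h6
  rw [h3, Pi.add_apply, h4, h5]
  exact h.convex_zero (Ioo_subset_Icc_self h6) h1 h2 ha hb hab

theorem zero_mem_selections : (0 : TimeL2 T X) ∈ selections T K := by
  filter_upwards [Lp.coeFn_zero X 2 (timeMeasure T),
    ae_restrict_mem (measurableSet_Ioo (a := 0) (b := T))] with t h1 h2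
  have h1' : (0 : TimeL2 T X) t = 0 := h1
  rw [h1']
  exact h.zero_mem t (Ioo_subset_Icc_self h2)

/-- Because `0` is always admissible, a selection may be switched off up to time `t`. As a test
function this localizes the variational inequality to `(0,t)`. -/
theorem sub_chi_mem_selections {x : TimeL2 T X} (hx : x ∈ selections T K) (t : ℝ) :
    x - chi T X t x ∈ selections T K := by
  filter_upwards [hx, Lp.coeFn_sub x (chi T X t x), coeFn_chi t x,
    ae_restrict_mem (measurableSet_Ioo (a := 0) (b := T))] with s h1 h2 h3 h4
  rw [h2, Pi.sub_apply, h3]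
  by_cases hs : s ∈ Iic t
  · rw [indicator_of_mem hs, sub_self]
    exact h.zero_mem s (Ioo_subset_Icc_self h4)
  · rwa [indicator_of_notMem hs, sub_zero]

/-- A function `x` with values in the moving set and the solution `y` of `y + c y' = x`:
up to an error of order `c`, also `y` has values in the moving set. -/
theorem exists_selection_near (hT : 0 < T) {σ₀ : X} (h0 : σ₀ ∈ K 0 0) {c M : ℝ} (hc : 0 < c)
    {x w : TimeL2 T X} (hx : x ∈ selections T K)
    (hxw : x = Lp.const 2 (timeMeasure T) σ₀ + volt T X w + c • w)
    (hM : ∀ t ∈ Icc 0 T, ‖σ₀ + primL T X t w‖ ≤ M) :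
    ∃ Y ∈ selections T K,
      ‖Lp.const 2 (timeMeasure T) σ₀ + volt T X w - Y‖ ≤ c * (M / κ * ‖ρ‖) := by
  have hκ := h.pos
  have hm0 : (0 : ℝ) ∈ Icc 0 T := left_mem_Icc.2 hT.le
  have hM0 : 0 ≤ M := (norm_nonneg _).trans (hM 0 hm0)
  obtain ⟨R, hR, -⟩ := exists_resolvent (X := ℝ) hT.le hc
  -- Write `r` and `q` for the primitives of `ρ` and `p`. Then `q + c q' = r`, the same relaxation
  -- that links `y` to `x`, and the lag `e = r - q` equals `c p` almost everywhere.
  set p : TimeL2 T ℝ := R (volt T ℝ ρ) with hp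
  have hpe : volt T ℝ p + c • p = volt T ℝ ρ := hR _
  -- Test `volt (p - ρ) + c p = 0` with `p - ρ`; monotonicity leaves `(p - ρ, p) ≤ 0`, a bound
  -- independent of `c`.
  have hpn : ‖p‖ ≤ ‖ρ‖ := by
    have h1 : inner ℝ (p - ρ) (volt T ℝ (p - ρ)) + c * inner ℝ (p - ρ) p = 0 := by
      rw [← real_inner_smul_right, ← inner_add_right, map_sub]
      have : volt T ℝ p - volt T ℝ ρ + c • p = 0 := by rw [← hpe]; abel
      rw [this, inner_zero_right]
    have h2 := inner_volt_nonneg hT.le (p - ρ)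
    have h3 : inner ℝ (p - ρ) p ≤ 0 := by
      by_contra h'
      push Not at h'
      linarith [mul_pos hc h']
    rw [inner_sub_left, real_inner_self_eq_norm_sq] at h3
    have h4 := real_inner_le_norm ρ p
    by_contra h5
    push Not at h5
    nlinarith [norm_nonneg ρ]
  set e : ℝ → ℝ := fun t => primL T ℝ t ρ - primL T ℝ t p with he
  have hec : ContinuousOn e (Icc 0 T) := (continuousOn_primL ρ).sub (continuousOn_primL p)
  have hea : ∀ᵐ t ∂(timeMeasure T), e t = c * p t := by
    filter_upwards [coeFn_volt p, coeFn_volt ρ, Lp.coeFn_add (volt T ℝ p) (c • p),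
      Lp.coeFn_smul c p] with t h1 h2 h3 h4
    rw [hpe, h2, Pi.add_apply, h1, h4, Pi.smul_apply, smul_eq_mul] at h3
    rw [he]
    simp only
    linarith
  have hxa : ∀ᵐ t ∂(timeMeasure T), σ₀ + primL T X t w + c • w t ∈ K t 0 := by
    filter_upwards [hx, Lp.coeFn_add (Lp.const 2 (timeMeasure T) σ₀ + volt T X w) (c • w),
      Lp.coeFn_add (Lp.const 2 (timeMeasure T) σ₀) (volt T X w), Lp.coeFn_smul c w,
      coeFn_volt w, Lp.coeFn_const (p := 2) (μ := timeMeasure T) σ₀] with t h1 h2 h3 h4 h5 h6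
    rw [hxw, h2, Pi.add_apply, h3, Pi.add_apply, h4, h5, h6] at h1
    exact h1
  have hy : ∀ t ∈ Icc 0 T, σ₀ + primL T X t w ∈ K t (e t) := by
    intro t ht
    have hwt := intervalIntegrable_of_integrable w.integrable ht
    have hpt := intervalIntegrable_of_integrable p.integrable ht
    have hsub : ∀ s ∈ Icc 0 t, s ∈ Icc 0 T := fun s hs => ⟨hs.1, hs.2.trans ht.2⟩
    have hI : ∀ s ∈ Icc 0 t, IntervalIntegrable (fun r => (w r, -p r)) volume 0 s := fun s hs =>
      have h1 := intervalIntegrable_of_integrable w.integrable (hsub s hs)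
      have h2 := (intervalIntegrable_of_integrable p.integrable (hsub s hs)).neg
      ⟨h1.1.prodMk h2.1, h1.2.prodMk h2.2⟩
    -- Freezing `t` replaces the moving sets by the single closed convex set of pairs `(ξ, a)` with
    -- `ξ ∈ K t a`. The curve `z s = (y s, r t - q s)` satisfies `z + c z' = (x s, r t - r s)`,
    -- which lies in this set by `shift`; the conclusion at `s = t` is `y t ∈ K t (e t)`.
    refine mem_of_relaxation (E := X × ℝ) (h.isClosed t ht) (h.convex t ht)
      (z := fun s => (σ₀ + primL T X s w, primL T ℝ t ρ - primL T ℝ s p))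
      (w := fun s => (w s, -p s)) hc ht.1 (hI t (right_mem_Icc.2 ht.1)) ?_ ?_ ?_
    · have h1 := h.shift 0 hm0 t ht h0
      rw [primL_zero hT.le, sub_zero, abs_of_nonneg] at h1
      · simpa [primL_zero hT.le] using h1
      · have := h.monotone_prim hm0 ht ht.1
        simpa [primL_zero hT.le] using this
    · intro s hs
      have h1 := (ContinuousLinearMap.fst ℝ X ℝ).intervalIntegral_comp_comm (hI s hs)
      have h2 := (ContinuousLinearMap.snd ℝ X ℝ).intervalIntegral_comp_comm (hI s hs)
      simp only [ContinuousLinearMap.coe_fst', ContinuousLinearMap.coe_snd',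
        intervalIntegral.integral_neg] at h1 h2
      refine Prod.ext ?_ ?_
      · simp only [Prod.fst_add, primL_zero hT.le, add_zero, ← h1]
        rw [primL_eq w (hsub s hs)]
      · simp only [Prod.snd_add, primL_zero hT.le, sub_zero, ← h2]
        rw [primL_eq p (hsub s hs), sub_eq_add_neg]
    · have hxa' := (ae_restrict_iff' measurableSet_Ioo).1 hxa
      have hea' := (ae_restrict_iff' measurableSet_Ioo).1 hea
      filter_upwards [hxa', hea'] with s h1 h2 hs
      have hsT : s ∈ Ioo 0 T := ⟨hs.1, hs.2.trans_le ht.2⟩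
      have hsT' := Ioo_subset_Icc_self hsT
      have h3 := h.shift s hsT' t ht (h1 hsT)
      rw [abs_of_nonneg (sub_nonneg.2 (h.monotone_prim hsT' ht hs.2.le))] at h3
      have h4 := h2 hsT
      change σ₀ + primL T X s w + c • w s ∈ K t (primL T ℝ t ρ - primL T ℝ s p + c • (-p s))
      have h5 : primL T ℝ t ρ - primL T ℝ s p + c • (-p s)
          = primL T ℝ t ρ - primL T ℝ s ρ := by
        rw [smul_eq_mul, mul_neg, ← h4, he]
        ring
      rwa [h5]
  have hden : ∀ t, 0 < κ + |e t| := fun t => by positivity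
  -- Scaling towards `0` restores the constraint and moves `y` by at most `M |e| / κ`, that is, by
  -- `c M |p| / κ` almost everywhere.
  set Z : ℝ → X := fun t => (κ / (κ + |e t|)) • (σ₀ + primL T X t w) with hZ
  have hZc : ContinuousOn Z (Icc 0 T) :=
    (continuousOn_const.div (continuousOn_const.add hec.abs) fun t _ => (hden t).ne').smul
      (continuousOn_const.add (continuousOn_primL w))
  have hZm := memLp_of_continuousOn hZc
  refine ⟨hZm.toLp Z, ?_, ?_⟩
  · filter_upwards [hZm.coeFn_toLp, ae_restrict_mem (measurableSet_Ioo (a := 0) (b := T))]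
      with t h1 h2
    have h2' := Ioo_subset_Icc_self h2
    rw [h1]
    exact h.scale t h2' _ (abs_nonneg _) _ (h.mono t h2' _ _ (le_abs_self _) (hy t h2'))
  · have h1 : ‖Lp.const 2 (timeMeasure T) σ₀ + volt T X w - hZm.toLp Z‖
        ≤ (c * (M / κ)) * ‖p‖ := by
      refine Lp.norm_le_mul_norm_of_ae_le_mul ?_
      filter_upwards [hZm.coeFn_toLp, ae_restrict_mem (measurableSet_Ioo (a := 0) (b := T)),
        Lp.coeFn_sub (Lp.const 2 (timeMeasure T) σ₀ + volt T X w) (hZm.toLp Z),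
        Lp.coeFn_add (Lp.const 2 (timeMeasure T) σ₀) (volt T X w),
        coeFn_volt w, Lp.coeFn_const (p := 2) (μ := timeMeasure T) σ₀, hea]
        with t h1 h2 h3 h4 h5 h6 h7
      rw [h3, Pi.sub_apply, h4, Pi.add_apply, h5, h6, h1, hZ, Function.const_apply]
      simp only
      have h8 : σ₀ + primL T X t w - (κ / (κ + |e t|)) • (σ₀ + primL T X t w)
          = (|e t| / (κ + |e t|)) • (σ₀ + primL T X t w) := by
        nth_rw 1 [← one_smul ℝ (σ₀ + primL T X t w)]
        rw [← sub_smul]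
        congr 1
        field_simp [(hden t).ne']
        ring
      rw [h8, norm_smul, Real.norm_of_nonneg (div_nonneg (abs_nonneg _) (hden t).le)]
      have h9 : |e t| / (κ + |e t|) ≤ |e t| / κ :=
        div_le_div_of_nonneg_left (abs_nonneg _) hκ (by linarith [abs_nonneg (e t)])
      calc |e t| / (κ + |e t|) * ‖σ₀ + primL T X t w‖ ≤ |e t| / κ * M :=
            mul_le_mul h9 (hM t (Ioo_subset_Icc_self h2)) (norm_nonneg _) (by positivity)
        _ = c * (M / κ) * ‖p t‖ := by
            rw [h7, abs_mul, abs_of_pos hc, Real.norm_eq_abs]; ring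
    calc _ ≤ (c * (M / κ)) * ‖p‖ := h1
      _ ≤ (c * (M / κ)) * ‖ρ‖ := mul_le_mul_of_nonneg_left hpn (by positivity)
      _ = _ := by ring

end IsSweepingFamily

end SweepingFamily

/-! ### The sweeping process with a monotone perturbation -/

section SweepingProcess

set_option linter.unusedSectionVars false

variable {X : Type*} [NormedAddCommGroup X] [InnerProductSpace ℝ X] [CompleteSpace X] {T κ : ℝ}
  {ρ : TimeL2 T ℝ} {K : ℝ → ℝ → Set X}

theorem inner_chi_const (w : TimeL2 T X) (a : X) (t : ℝ) :
    inner ℝ (chi T X t w) (Lp.const 2 (timeMeasure T) a) = inner ℝ (primL T X t w) a := by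
  have h1 : inner ℝ (primL T X t w) a
      = ∫ s in Iic t, inner ℝ (w s) a ∂(timeMeasure T) := by
    rw [real_inner_comm]
    simp_rw [real_inner_comm a]
    exact (integral_inner w.integrable.integrableOn a).symm
  rw [inner_chi, h1]
  refine integral_congr_ae (ae_restrict_of_ae ?_)
  filter_upwards [Lp.coeFn_const (p := 2) (μ := timeMeasure T) a] with s hs
  rw [hs, Function.const_apply]

theorem le_of_sq_le_add_mul {x a b : ℝ} (ha : 0 ≤ a) (hb : 0 ≤ b)
    (h : x ^ 2 ≤ a + b * x) : x ≤ a + b + 1 := by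
  by_contra h'
  push Not at h'
  nlinarith

/-- The sweeping process with the time derivative replaced by its Yosida approximation. -/
theorem exists_regularized_sweeping (hT : 0 ≤ T) (h : IsSweepingFamily T κ ρ K) (σ₀ : X)
    (A : TimeL2 T X →L[ℝ] TimeL2 T X) (hA : ∀ x, 0 ≤ inner ℝ (A x) x) {c : ℝ} (hc : 0 < c)
    (F : TimeL2 T X) :
    ∃ x w : TimeL2 T X, x ∈ selections T K ∧
      x = Lp.const 2 (timeMeasure T) σ₀ + volt T X w + c • w ∧
      ∀ τ ∈ selections T K, inner ℝ (w + A x - F) (x - τ) ≤ 0 := by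
  obtain ⟨R, hR, -⟩ := exists_resolvent (X := X) hT hc
  set M : ℝ := ‖volt T X‖ + c with hM
  have hM0 : 0 < M := by positivity
  have hRc : ∀ x, c / M ^ 2 * ‖x‖ ^ 2 ≤ inner ℝ (R x) x := by
    intro x
    have h1 : inner ℝ (R x) x = inner ℝ (R x) (volt T X (R x)) + c * ‖R x‖ ^ 2 := by
      nth_rw 2 [← hR x]
      rw [inner_add_right, inner_smul_right, real_inner_self_eq_norm_sq]
    have h2 : ‖x‖ ≤ M * ‖R x‖ := by
      nth_rw 1 [← hR x]
      refine (norm_add_le _ _).trans ?_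
      rw [norm_smul, Real.norm_of_nonneg hc.le, hM, add_mul]
      exact add_le_add_left ((volt T X).le_opNorm _) _
    have h3 : ‖x‖ ^ 2 ≤ M ^ 2 * ‖R x‖ ^ 2 := by
      rw [← mul_pow]
      exact pow_le_pow_left₀ (norm_nonneg _) h2 2
    have h4 : c / M ^ 2 * ‖x‖ ^ 2 ≤ c / M ^ 2 * (M ^ 2 * ‖R x‖ ^ 2) :=
      mul_le_mul_of_nonneg_left h3 (by positivity)
    have h5 : c / M ^ 2 * (M ^ 2 * ‖R x‖ ^ 2) = c * ‖R x‖ ^ 2 := by field_simp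
    have h6 := inner_volt_nonneg hT (R x)
    linarith
  set a : TimeL2 T X := Lp.const 2 (timeMeasure T) σ₀ with ha
  -- The approximate derivative is `w = R (x - a)`, so the inequality has the coercive operator `R +
  -- A`, and the initial value enters on the right as `R a`.
  obtain ⟨x, hx, hxi⟩ := exists_variationalInequality (R + A) (c := c / M ^ 2) (by positivity)
    (fun z => by
      rw [_root_.add_apply, inner_add_left]
      linarith [hRc z, hA z]) ⟨0, h.zero_mem_selections⟩ h.isClosed_selections
    h.convex_selections (F + R a)
  refine ⟨x, R (x - a), hx, ?_, fun τ hτ => ?_⟩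
  · rw [add_assoc, hR]; abel
  · have h1 : R (x - a) + A x - F = (R + A) x - (F + R a) := by
      rw [_root_.add_apply, map_sub]
      abel
    rw [h1]
    exact hxi τ hτ

/-- The energy inequality for the regularized sweeping process. -/
theorem regularized_sweeping_energy (h : IsSweepingFamily T κ ρ K) {σ₀ : X}
    {A : TimeL2 T X →L[ℝ] TimeL2 T X}
    (hA : ∀ x, ∀ t ∈ Icc 0 T, 0 ≤ inner ℝ (chi T X t (A x)) x) {c : ℝ}
    {F x w : TimeL2 T X} (hx : x ∈ selections T K)
    (hxw : x = Lp.const 2 (timeMeasure T) σ₀ + volt T X w + c • w)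
    (hvi : ∀ τ ∈ selections T K, inner ℝ (w + A x - F) (x - τ) ≤ 0) {t : ℝ} (ht : t ∈ Icc 0 T) :
    ‖σ₀ + primL T X t w‖ ^ 2 + 2 * (c * inner ℝ (chi T X t w) w)
      ≤ ‖σ₀‖ ^ 2 + 2 * (‖F‖ * ‖x‖) := by
  have h1 := hvi _ (h.sub_chi_mem_selections hx t)
  rw [sub_sub_cancel, inner_sub_left, inner_add_left, inner_chi_right, inner_chi_right,
    inner_chi_right] at h1
  have h2 : inner ℝ (chi T X t w) x = inner ℝ (primL T X t w) σ₀
      + ((1 / 2) * ‖primL T X t w‖ ^ 2 + c * inner ℝ (chi T X t w) w) := by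
    nth_rw 1 [hxw]
    rw [add_assoc, inner_add_right, inner_chi_const, inner_chi_resolvent w c ht]
  have h3 : inner ℝ (chi T X t F) x ≤ ‖F‖ * ‖x‖ := (real_inner_le_norm _ _).trans
    (mul_le_mul_of_nonneg_right (norm_chi_le t F) (norm_nonneg x))
  have h4 := hA x t ht
  rw [norm_add_sq_real, real_inner_comm]
  linarith

/-- Test with the selection `Y` near `y = σ₀ + volt w`: then `x - Y = c w + (y - Y)` with `‖y - Y‖ ≤
c N`, so every term carries a factor `c`. After division, `‖w‖² ≤ N k₀ + (N + k₀) ‖w‖`. -/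
theorem exists_bound_regularized_sweeping (hT : 0 < T) (h : IsSweepingFamily T κ ρ K) {σ₀ : X}
    (h0 : σ₀ ∈ K 0 0) (A : TimeL2 T X →L[ℝ] TimeL2 T X)
    (hA : ∀ x, ∀ t ∈ Icc 0 T, 0 ≤ inner ℝ (chi T X t (A x)) x) (F : TimeL2 T X) :
    ∃ C : ℝ, ∀ (c : ℝ) (x w : TimeL2 T X), 0 < c → c ≤ 1 → x ∈ selections T K →
      x = Lp.const 2 (timeMeasure T) σ₀ + volt T X w + c • w →
      (∀ τ ∈ selections T K, inner ℝ (w + A x - F) (x - τ) ≤ 0) → ‖w‖ ≤ C := by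
  set k : ℝ := ((timeMeasure T univ) ^ (1 / 2 : ℝ)).toReal with hk
  -- The energy inequality gives `‖x‖² ≤ D (‖σ₀‖² + 2 ‖F‖ ‖x‖)`, whence `‖x‖ ≤ B`. Then `M` bounds
  -- `|y(t)|`, `c N` bounds the distance from `y` to `Y`, and `k₀` bounds `‖A x - F‖`.
  set D : ℝ := 2 * k ^ 2 + 1 with hD
  have hD0 : 0 ≤ D := by positivity
  set B : ℝ := D * ‖σ₀‖ ^ 2 + D * (2 * ‖F‖) + 1 with hB
  have hB0 : 0 ≤ B := by positivity
  set M : ℝ := √(‖σ₀‖ ^ 2 + 2 * (‖F‖ * B)) with hM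
  set N : ℝ := M / κ * ‖ρ‖ with hN
  have hN0 : 0 ≤ N := mul_nonneg (div_nonneg (Real.sqrt_nonneg _) h.pos.le) (norm_nonneg _)
  set k₀ : ℝ := ‖F‖ + ‖A‖ * B with hk₀
  have hk₀0 : 0 ≤ k₀ := by positivity
  refine ⟨N * k₀ + (N + k₀) + 1, fun c x w hc hc1 hx hxw hvi => ?_⟩
  have hE := fun t (ht : t ∈ Icc 0 T) => regularized_sweeping_energy h hA hx hxw hvi ht
  set a : ℝ := ‖σ₀‖ ^ 2 + 2 * (‖F‖ * ‖x‖) with ha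
  have ha0 : 0 ≤ a := by positivity
  have hy : ∀ t ∈ Icc 0 T, ‖σ₀ + primL T X t w‖ ^ 2 ≤ a := fun t ht => by
    have := mul_nonneg hc.le (inner_chi_self_nonneg t w)
    linarith [hE t ht]
  have hw : 2 * (c * ‖w‖ ^ 2) ≤ a := by
    have := hE T (right_mem_Icc.2 hT.le)
    rw [chi_eq_self, real_inner_self_eq_norm_sq] at this
    linarith [sq_nonneg ‖σ₀ + primL T X T w‖]
  have hyn : ‖Lp.const 2 (timeMeasure T) σ₀ + volt T X w‖ ≤ k * √a := by
    refine TimeL2.norm_le_of_forall_mem _ (Real.sqrt_nonneg _) ?_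
    filter_upwards [Lp.coeFn_add (Lp.const 2 (timeMeasure T) σ₀) (volt T X w),
      coeFn_volt w, Lp.coeFn_const (p := 2) (μ := timeMeasure T) σ₀,
      ae_restrict_mem (measurableSet_Ioo (a := 0) (b := T))] with t h1 h2 h3 h4
    rw [h1, Pi.add_apply, h2, h3]
    exact Real.le_sqrt_of_sq_le (hy t (Ioo_subset_Icc_self h4))
  have hxn : ‖x‖ ^ 2 ≤ D * a := by
    have h1 : ‖x‖ ≤ k * √a + c * ‖w‖ := by
      nth_rw 1 [hxw]
      refine (norm_add_le _ _).trans ?_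
      rw [norm_smul, Real.norm_of_nonneg hc.le]
      exact add_le_add_left hyn _
    have h2 := pow_le_pow_left₀ (norm_nonneg _) h1 2
    have h3 : (k * √a + c * ‖w‖) ^ 2 + (k * √a - c * ‖w‖) ^ 2
        = 2 * k ^ 2 * a + c * (2 * (c * ‖w‖ ^ 2)) := by
      linear_combination 2 * k ^ 2 * Real.sq_sqrt ha0
    have h4 : c * (2 * (c * ‖w‖ ^ 2)) ≤ a :=
      (mul_le_of_le_one_left (by positivity) hc1).trans hw
    rw [hD]
    linarith [sq_nonneg (k * √a - c * ‖w‖)]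
  have hxB : ‖x‖ ≤ B := by
    refine le_of_sq_le_add_mul (by positivity) (by positivity) (hxn.trans_eq ?_)
    rw [ha]; ring
  have haM : ∀ t ∈ Icc 0 T, ‖σ₀ + primL T X t w‖ ≤ M := fun t ht => by
    refine Real.le_sqrt_of_sq_le ((hy t ht).trans ?_)
    rw [ha]
    have := mul_le_mul_of_nonneg_left hxB (norm_nonneg F)
    linarith
  obtain ⟨Y, hY, hYn⟩ := h.exists_selection_near hT h0 hc hx hxw haM
  rw [← hN] at hYn
  set d : TimeL2 T X := Lp.const 2 (timeMeasure T) σ₀ + volt T X w - Y with hd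
  have hxY : x - Y = c • w + d := by
    nth_rw 1 [hxw]
    rw [hd]; abel
  have h1 := hvi Y hY
  rw [hxY, add_sub_assoc, inner_add_left, inner_add_right w, inner_smul_right,
    real_inner_self_eq_norm_sq] at h1
  have h2 : -(‖w‖ * (c * N)) ≤ inner ℝ w d := by
    have := neg_le_of_abs_le ((abs_real_inner_le_norm w d).trans
      (mul_le_mul_of_nonneg_left hYn (norm_nonneg w)))
    exact this
  have hkn : ‖A x - F‖ ≤ k₀ := by
    refine (norm_sub_le _ _).trans ?_
    have := (A.le_opNorm x).trans (mul_le_mul_of_nonneg_left hxB (norm_nonneg A))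
    rw [hk₀]; linarith
  have hdn : ‖c • w + d‖ ≤ c * (‖w‖ + N) := by
    refine (norm_add_le _ _).trans ?_
    rw [norm_smul, Real.norm_of_nonneg hc.le]
    linarith
  have h3 : -(k₀ * (c * (‖w‖ + N))) ≤ inner ℝ (A x - F) (c • w + d) :=
    neg_le_of_abs_le ((abs_real_inner_le_norm _ _).trans
      (mul_le_mul hkn hdn (norm_nonneg _) hk₀0))
  have h4 : c * ‖w‖ ^ 2 ≤ c * (N * k₀ + (N + k₀) * ‖w‖) := by linarith
  exact le_of_sq_le_add_mul (by positivity) (by positivity) (le_of_mul_le_mul_left h4 hc)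

/-- Existence for the sweeping process perturbed by a monotone causal operator, in integrated
form. -/
theorem exists_sweeping (hT : 0 < T) (h : IsSweepingFamily T κ ρ K) {σ₀ : X}
    (h0 : σ₀ ∈ K 0 0) (A : TimeL2 T X →L[ℝ] TimeL2 T X)
    (hA : ∀ x, ∀ t ∈ Icc 0 T, 0 ≤ inner ℝ (chi T X t (A x)) x) (F : TimeL2 T X) :
    ∃ x w : TimeL2 T X, x ∈ selections T K ∧
      x = Lp.const 2 (timeMeasure T) σ₀ + volt T X w ∧
      ∀ τ ∈ selections T K, inner ℝ (w + A x - F) (x - τ) ≤ 0 := by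
  have hA' : ∀ x, 0 ≤ inner ℝ (A x) x := fun x => by
    simpa only [chi_eq_self] using hA x T (right_mem_Icc.2 hT.le)
  obtain ⟨C, hC⟩ := exists_bound_regularized_sweeping hT h h0 A hA F
  have hcpos : ∀ n : ℕ, 0 < (1 : ℝ) / (n + 1) := fun n => by positivity
  have hc1 : ∀ n : ℕ, (1 : ℝ) / (n + 1) ≤ 1 := fun n =>
    div_le_one_of_le₀ (by linarith [(n.cast_nonneg : (0 : ℝ) ≤ n)]) (by positivity)
  have hex := fun n : ℕ => exists_regularized_sweeping hT.le h σ₀ A hA' (hcpos n) F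
  choose x w hx hxw hvi using hex
  have hlim : Tendsto (fun n : ℕ => (1 : ℝ) / (n + 1)) (hyperfilter ℕ) (𝓝 0) :=
    tendsto_one_div_add_atTop_nhds_zero_nat.mono_left (Nat.hyperfilter_le_atTop)
  obtain ⟨w₀, -, hw⟩ := exists_weakTendsto (hyperfilter ℕ) w C fun n =>
    hC _ (x n) (w n) (hcpos n) (hc1 n) (hx n) (hxw n) (hvi n)
  set a : TimeL2 T X := Lp.const 2 (timeMeasure T) σ₀ with ha
  set x₀ : TimeL2 T X := a + volt T X w₀ with hx₀
  have hxlim : WeakTendsto x (hyperfilter ℕ) x₀ := by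
    have h1 := ((WeakTendsto.const a).add (hw.map (volt T X))).add (hw.smul_zero hlim)
    rw [add_zero] at h1
    convert h1 using 2 with n
    exact hxw n
  refine ⟨x₀, w₀, hxlim.mem h.isClosed_selections h.convex_selections hx, rfl, fun τ hτ => ?_⟩
  have hV : ∀ z, 0 ≤ inner ℝ (volt T X z) z := fun z => by
    rw [real_inner_comm]; exact inner_volt_nonneg hT.le z
  -- The sequence `r` collects the terms affine in `(w n, x n)`, which converge. What remains is two
  -- quadratic forms of monotone operators and a term `c ‖w n‖²` of favourable sign.
  let r : ℕ → ℝ := fun n => inner ℝ τ (w n) + inner ℝ (A.adjoint τ) (x n) + inner ℝ F (x n)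
    - inner ℝ F τ - inner ℝ a (w n)
  have hr : Tendsto r (hyperfilter ℕ) (𝓝 (inner ℝ τ w₀ + inner ℝ (A.adjoint τ) x₀
      + inner ℝ F x₀ - inner ℝ F τ - inner ℝ a w₀)) :=
    ((((hw τ).add (hxlim (A.adjoint τ))).add (hxlim F)).sub tendsto_const_nhds).sub (hw a)
  have hkey : ∀ n, inner ℝ (volt T X (w n)) (w n) + inner ℝ (A (x n)) (x n) ≤ r n := by
    intro n
    have h1 := hvi n τ hτ
    have h2 : inner ℝ (w n) (x n) = inner ℝ a (w n) + inner ℝ (volt T X (w n)) (w n)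
        + 1 / ((n : ℝ) + 1) * ‖w n‖ ^ 2 := by
      nth_rw 1 [hxw n]
      rw [inner_add_right, inner_add_right, inner_smul_right, real_inner_self_eq_norm_sq,
        real_inner_comm a, real_inner_comm (volt T X (w n))]
    have h3 := mul_nonneg (hcpos n).le (sq_nonneg ‖w n‖)
    simp only [inner_sub_left, inner_sub_right, inner_add_left] at h1
    simp only [r, ContinuousLinearMap.adjoint_inner_left]
    rw [real_inner_comm (w n) τ, real_inner_comm (A (x n)) τ]
    linarith
  -- Weak lower semicontinuity of a monotone quadratic form: expand `0 ≤ (B (zₙ - z), zₙ - z)` and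
  -- pass to the limit in the mixed terms.
  have hlsc : inner ℝ (volt T X w₀) w₀ + inner ℝ (A x₀) x₀ ≤ inner ℝ τ w₀
      + inner ℝ (A.adjoint τ) x₀ + inner ℝ F x₀ - inner ℝ F τ - inner ℝ a w₀ := by
    have e1 := ((hw.map (volt T X)) w₀).add (hw (volt T X w₀))
    have e2 := ((hxlim.map A) x₀).add (hxlim (A x₀))
    have e3 := le_of_tendsto_of_tendsto
      ((e1.sub (tendsto_const_nhds (x := (inner ℝ (volt T X w₀) w₀ : ℝ)))).add
        (e2.sub (tendsto_const_nhds (x := (inner ℝ (A x₀) x₀ : ℝ))))) hr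
      (Eventually.of_forall fun n => by
        refine le_trans ?_ (hkey n)
        have f1 := hV (w n - w₀)
        have f2 := hA' (x n - x₀)
        simp only [map_sub, inner_sub_left, inner_sub_right] at f1 f2
        have f3 := real_inner_comm w₀ (volt T X (w n))
        have f4 := real_inner_comm x₀ (A (x n))
        simp only
        linarith)
    have f5 := real_inner_comm w₀ (volt T X w₀)
    have f6 := real_inner_comm x₀ (A x₀)
    linarith
  have h2 : inner ℝ w₀ x₀ = inner ℝ a w₀ + inner ℝ (volt T X w₀) w₀ := by
    rw [hx₀, inner_add_right, real_inner_comm a, real_inner_comm (volt T X w₀)]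
  rw [ContinuousLinearMap.adjoint_inner_left] at hlsc
  simp only [inner_sub_left, inner_sub_right, inner_add_left]
  have g1 := real_inner_comm w₀ τ
  have g2 := real_inner_comm (A x₀) τ
  linarith

/-- The integrated variational inequality holds at almost all times. -/
theorem variationalInequality_pointwise (hT : 0 < T) (h : IsSweepingFamily T κ ρ K)
    {σ : ℝ → X} (hσ : ContinuousOn σ (Icc 0 T)) {x q : TimeL2 T X}
    (hxσ : x =ᵐ[timeMeasure T] σ) (hx : x ∈ selections T K)
    (hvi : ∀ τ ∈ selections T K, inner ℝ q (x - τ) ≤ 0) :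
    ∀ᵐ t ∂(timeMeasure T), ∀ τ ∈ K t 0, inner ℝ (q t) (σ t - τ) ≤ 0 := by
  have hq := intervalIntegrable_of_integrable q.integrable (right_mem_Icc.2 hT.le)
  -- The exceptional times depend only on `q` and `|q|`; they are fixed before `τ`, so no countable
  -- dense set of test tensors is needed.
  filter_upwards [ae_restrict_of_ae hq.ae_hasDerivAt_integral,
    ae_restrict_of_ae hq.norm.ae_hasDerivAt_integral,
    ae_restrict_mem (measurableSet_Ioo (a := 0) (b := T))] with t hd1 hd2 hm τ hτ
  have hm' := Ioo_subset_Icc_self hm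
  have hmu : t ∈ uIcc 0 T := by rwa [uIcc_of_le hT.le]
  replace hd1 := (hd1 hmu t hmu).hasDerivWithinAt (s := Ioi t)
  replace hd2 := (hd2 hmu t hmu).hasDerivWithinAt (s := Ioi t)
  rw [hasDerivWithinAt_iff_tendsto_slope' self_notMem_Ioi] at hd1 hd2
  have hκ := h.pos
  set e : ℝ → ℝ := fun s => |primL T ℝ s ρ - primL T ℝ t ρ| with he
  have hec : ContinuousOn e (Icc 0 T) := ((continuousOn_primL ρ).sub continuousOn_const).abs
  -- A continuous continuation of `τ` to nearby times that stays in the moving sets: `shift` bounds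
  -- how far `τ` leaves them and `scale` corrects it.
  set ξ : ℝ → X := fun s => (κ / (κ + e s)) • τ with hξ
  have hden : ∀ s, 0 < κ + e s := fun s => by positivity
  have hξc : ContinuousOn ξ (Icc 0 T) :=
    (continuousOn_const.div (continuousOn_const.add hec) fun s _ => (hden s).ne').smul
      continuousOn_const
  have hξt : ξ t = τ := by simp [hξ, he, hκ.ne']
  have hξm := memLp_of_continuousOn hξc
  set y : TimeL2 T X := hξm.toLp ξ with hy
  have hyK : ∀ s ∈ Icc 0 T, ξ s ∈ K s 0 := fun s hs =>
    h.scale s hs _ (abs_nonneg _) _ (h.shift t hm' s hs hτ)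
  have hdc : ContinuousOn (fun s => σ s - ξ s) (Icc 0 T) := hσ.sub hξc
  have hint : ∀ s ∈ Ioc t T, ∫ r in t..s, inner ℝ (q r) (σ r - ξ r) ≤ 0 := by
    intro s hs
    have hs' : s ∈ Icc 0 T := ⟨hm.1.le.trans hs.1.le, hs.2⟩
    -- The test function is `x` with `ξ` inserted on `(t,s]`.
    set z : TimeL2 T X := x + (chi T X s (y - x) - chi T X t (y - x)) with hz
    have hzK : z ∈ selections T K := by
      filter_upwards [hx, Lp.coeFn_add x (chi T X s (y - x) - chi T X t (y - x)),
        Lp.coeFn_sub (chi T X s (y - x)) (chi T X t (y - x)), coeFn_chi s (y - x),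
        coeFn_chi t (y - x), Lp.coeFn_sub y x, hξm.coeFn_toLp,
        ae_restrict_mem (measurableSet_Ioo (a := 0) (b := T))] with r h1 h2 h3 h4 h5 h6 h7 h8
      rw [h2, Pi.add_apply, h3, Pi.sub_apply, h4, h5]
      by_cases h9 : r ≤ t
      · rw [indicator_of_mem (show r ∈ Iic s from h9.trans hs.1.le),
          indicator_of_mem (show r ∈ Iic t from h9), sub_self, add_zero]
        exact h1
      · rw [indicator_of_notMem (show r ∉ Iic t from h9), sub_zero]
        by_cases h10 : r ≤ s
        · rw [indicator_of_mem (show r ∈ Iic s from h10), h6, Pi.sub_apply, add_sub_cancel, h7]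
          exact hyK r (Ioo_subset_Icc_self h8)
        · rw [indicator_of_notMem (show r ∉ Iic s from h10), add_zero]
          exact h1
    have h1 := hvi z hzK
    have h2 : x - z = chi T X s (x - y) - chi T X t (x - y) := by
      rw [hz, ← neg_sub y x, map_neg, map_neg]; abel
    have h3 : ∀ r ∈ Icc 0 T, inner ℝ q (chi T X r (x - y))
        = ∫ p in (0 : ℝ)..r, inner ℝ (q p) (σ p - ξ p) := by
      intro r hr
      rw [inner_chi_right, inner_chi, ← integral_Iic_timeMeasure _ hr]
      refine integral_congr_ae (ae_restrict_of_ae ?_)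
      filter_upwards [hxσ, Lp.coeFn_sub x y, hξm.coeFn_toLp] with p h4 h5 h6
      rw [h5, Pi.sub_apply, h4, h6]
    have hii : ∀ r ∈ Icc 0 T,
        IntervalIntegrable (fun p => inner ℝ (q p) (σ p - ξ p)) volume 0 r := by
      intro r hr
      refine intervalIntegrable_of_integrable ?_ hr
      refine (L2.integrable_inner (𝕜 := ℝ) q (x - y)).congr ?_
      filter_upwards [hxσ, Lp.coeFn_sub x y, hξm.coeFn_toLp] with p h4 h5 h6
      rw [h5, Pi.sub_apply, h4, h6]
    rw [h2, inner_sub_right, h3 s hs', h3 t hm',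
      intervalIntegral.integral_interval_sub_left (hii s hs') (hii t hm')] at h1
    exact h1
  by_contra hneg
  push Not at hneg
  set b : ℝ := inner ℝ (q t) (σ t - τ) with hb
  -- Near `t` the main term exceeds `(b/2)(s - t)`, while replacing `σ - ξ` by its value at `t`
  -- costs at most `ε (‖q t‖ + 1)(s - t) = (b/4)(s - t)`. The integral over `(t,s]` would then be
  -- positive.
  set ε : ℝ := b / 4 / (‖q t‖ + 1) with hε
  have hε0 : 0 < ε := by positivity
  have hIoc : Ioc t T ∈ 𝓝[>] t := Ioc_mem_nhdsGT hm.2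
  have hcl : ∀ᶠ s in 𝓝[>] t, ∀ r ∈ Ioc t s, ‖(σ r - ξ r) - (σ t - τ)‖ ≤ ε := by
    have h1 : Tendsto (fun s => σ s - ξ s) (𝓝[>] t) (𝓝 (σ t - τ)) := by
      have h2 := (hdc t hm').mono_left (nhdsWithin_mono t (Ioc_subset_Icc_self.trans
        (Icc_subset_Icc_left hm.1.le)) : 𝓝[Ioc t T] t ≤ 𝓝[Icc 0 T] t)
      simp only [hξt] at h2
      exact h2.mono_left (le_of_eq (nhdsWithin_Ioc_eq_nhdsGT hm.2).symm)
    have h2 := (Metric.tendsto_nhds.1 h1) ε hε0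
    obtain ⟨s, hs, hsub⟩ := mem_nhdsGT_iff_exists_Ioc_subset.1 h2
    filter_upwards [Ioc_mem_nhdsGT hs] with s' hs' r hr
    have := hsub ⟨hr.1, hr.2.trans hs'.2⟩
    rw [← dist_eq_norm]
    exact (this : dist _ _ < ε).le
  have hA1 : ∀ᶠ s in 𝓝[>] t,
      b / 2 < inner ℝ (slope (fun s => ∫ r in t..s, q r) t s) (σ t - τ) :=
    (hd1.inner tendsto_const_nhds).eventually_const_lt (by linarith)
  have hA2 : ∀ᶠ s in 𝓝[>] t, slope (fun s => ∫ r in t..s, ‖q r‖) t s < ‖q t‖ + 1 :=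
    hd2.eventually_lt_const (by linarith)
  obtain ⟨s, ⟨⟨hs1, hs2⟩, hs3⟩, hs4⟩ := (((hcl.and hA1).and hA2).and hIoc).exists
  have hst : 0 < s - t := sub_pos.2 hs4.1
  have hqI : IntervalIntegrable q volume t s := hq.mono_set (by
    rw [uIcc_of_le hT.le, uIcc_of_le hs4.1.le]; exact Icc_subset_Icc hm.1.le hs4.2)
  simp only [slope_def_module, intervalIntegral.integral_same, sub_zero] at hs2 hs3
  rw [real_inner_smul_left, inv_mul_eq_div, lt_div_iff₀ hst] at hs2
  rw [smul_eq_mul, inv_mul_eq_div, div_lt_iff₀ hst] at hs3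
  have hI1 : IntervalIntegrable (fun r => inner ℝ (q r) (σ t - τ)) volume t s :=
    ⟨hqI.1.inner_const _, hqI.2.inner_const _⟩
  have hI2 : IntervalIntegrable (fun r => inner ℝ (q r) ((σ r - ξ r) - (σ t - τ))) volume t s := by
    rw [intervalIntegrable_iff_integrableOn_Ioc_of_le hs4.1.le] at hqI ⊢
    refine Integrable.mono' (hqI.norm.mul_const ε) ?_ ?_
    · refine hqI.aestronglyMeasurable.inner ?_
      refine ContinuousOn.aestronglyMeasurable ?_ measurableSet_Ioc
      exact (hdc.mono (fun r hr => ⟨hm.1.le.trans hr.1.le, hr.2.trans hs4.2⟩)).sub continuousOn_const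
    · refine ae_restrict_of_forall_mem measurableSet_Ioc fun r hr => ?_
      exact (norm_inner_le_norm _ _).trans
        (mul_le_mul_of_nonneg_left (hs1 r hr) (norm_nonneg _))
  have hsplit : ∫ r in t..s, inner ℝ (q r) (σ r - ξ r)
      = inner ℝ (∫ r in t..s, q r) (σ t - τ)
        + ∫ r in t..s, inner ℝ (q r) ((σ r - ξ r) - (σ t - τ)) := by
    have h1 : inner ℝ (∫ r in t..s, q r) (σ t - τ)
        = ∫ r in t..s, inner ℝ (q r) (σ t - τ) := by
      simp_rw [real_inner_comm (σ t - τ)]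
      exact ((innerSL ℝ (σ t - τ)).intervalIntegral_comp_comm hqI).symm
    rw [h1, ← intervalIntegral.integral_add hI1 hI2]
    refine intervalIntegral.integral_congr fun r _ => ?_
    rw [← inner_add_right, add_sub_cancel]
  have hrem : -(ε * ∫ r in t..s, ‖q r‖)
      ≤ ∫ r in t..s, inner ℝ (q r) ((σ r - ξ r) - (σ t - τ)) := by
    rw [← intervalIntegral.integral_const_mul]
    refine neg_le_of_abs_le ?_
    rw [← Real.norm_eq_abs]
    refine intervalIntegral.norm_integral_le_of_norm_le hs4.1.le (ae_of_all _ fun r hr => ?_)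
      (hqI.norm.const_mul ε)
    rw [mul_comm]
    exact (norm_inner_le_norm _ _).trans (mul_le_mul_of_nonneg_left (hs1 r hr) (norm_nonneg _))
  have hfin := hint s hs4
  rw [hsplit] at hfin
  have h5 : ε * ∫ r in t..s, ‖q r‖ ≤ ε * ((‖q t‖ + 1) * (s - t)) :=
    mul_le_mul_of_nonneg_left hs3.le hε0.le
  have h6 : ε * ((‖q t‖ + 1) * (s - t)) = b / 4 * (s - t) := by
    rw [hε]; field_simp
  nlinarith [mul_pos hneg hst]

end SweepingProcess

/-! ### Completeness of `V` and its density in `L²` -/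

section VelocitySpace

variable {Ω ΓD : Set E3}

theorem continuous_integral_coord_mul {ι : Type*} [Fintype ι] (i : ι) {ψ : E3 → ℝ}
    (hψ : MemLp ψ 2 (volume.restrict Ω)) :
    Continuous fun z : Lp (EuclideanSpace ℝ ι) 2 (volume.restrict Ω) =>
      ∫ x in Ω, z x i * ψ x := by
  set L := (EuclideanSpace.proj (𝕜 := ℝ) i : EuclideanSpace ℝ ι →L[ℝ] ℝ).compLpL 2
    (volume.restrict Ω) with hL
  have h : ∀ z : Lp (EuclideanSpace ℝ ι) 2 (volume.restrict Ω),
      ∫ x in Ω, z x i * ψ x = inner ℝ (hψ.toLp ψ) (L z) := by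
    intro z
    rw [L2.inner_def]
    refine integral_congr_ae ?_
    filter_upwards [hψ.coeFn_toLp, ContinuousLinearMap.coeFn_compLpL
      (EuclideanSpace.proj (𝕜 := ℝ) i : EuclideanSpace ℝ ι →L[ℝ] ℝ) z] with x h1 h2
    rw [h1, h2]
    simp
  simp_rw [h]
  exact continuous_const.inner L.continuous

theorem isClosed_hasWeakGrad :
    IsClosed {p : WithLp 2 (HVec Ω × HGrad Ω) | HasWeakGrad Ω p.fst p.snd} := by
  have h : {p : WithLp 2 (HVec Ω × HGrad Ω) | HasWeakGrad Ω p.fst p.snd}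
      = ⋂ (φ : E3 → ℝ) (_ : IsTest Ω φ) (i : Fin 3) (j : Fin 3),
        {p : WithLp 2 (HVec Ω × HGrad Ω) |
          ∫ x in Ω, p.fst x i * partialDeriv φ j x = - ∫ x in Ω, p.snd x (i, j) * φ x} := by
    ext p
    simp [HasWeakGrad]
  rw [h]
  refine isClosed_iInter fun φ => isClosed_iInter fun hφ => isClosed_iInter fun i =>
    isClosed_iInter fun j => isClosed_eq ?_ ?_
  · exact (continuous_integral_coord_mul i (hφ.memLp_partialDeriv j)).comp
      (WithLp.fstL 2 ℝ (HVec Ω) (HGrad Ω)).continuous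
  · exact ((continuous_integral_coord_mul (i, j) hφ.memLp).comp
      (WithLp.sndL 2 ℝ (HVec Ω) (HGrad Ω)).continuous).neg

/-- Diagonal argument: for each `n` take one smooth field within `1/(n+1)` of the `n`-th pair in all
three senses. -/
theorem HasZeroTraceOn.of_tendsto {z : ℕ → HVec Ω} {G : ℕ → HGrad Ω} {z₀ : HVec Ω}
    {G₀ : HGrad Ω} (h : ∀ n, HasZeroTraceOn Ω ΓD (z n) (G n)) (hz : Tendsto z atTop (𝓝 z₀))
    (hG : Tendsto G atTop (𝓝 G₀)) : HasZeroTraceOn Ω ΓD z₀ G₀ := by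
  have hex : ∀ n : ℕ, ∃ φ : E3 → E3, ContDiff ℝ ∞ φ ∧
      eLpNorm (fun x => φ x - z n x) 2 (volume.restrict Ω) < ((n : ℝ≥0∞) + 1)⁻¹ ∧
      eLpNorm (fun x => jacobian φ x - G n x) 2 (volume.restrict Ω) < ((n : ℝ≥0∞) + 1)⁻¹ ∧
      eLpNorm φ 2 ((μH[2] : Measure E3).restrict ΓD) < ((n : ℝ≥0∞) + 1)⁻¹ := by
    intro n
    obtain ⟨φ, hφ, h1, h2, h3⟩ := h n
    have hpos : (0 : ℝ≥0∞) < ((n : ℝ≥0∞) + 1)⁻¹ := by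
      rw [ENNReal.inv_pos]
      exact ENNReal.add_ne_top.2 ⟨ENNReal.natCast_ne_top n, ENNReal.one_ne_top⟩
    obtain ⟨m, hm1, hm2, hm3⟩ := ((h1.eventually_lt_const hpos).and
      ((h2.eventually_lt_const hpos).and (h3.eventually_lt_const hpos))).exists
    exact ⟨φ m, hφ m, hm1, hm2, hm3⟩
  choose φ hφ h1 h2 h3 using hex
  have hlim : Tendsto (fun n : ℕ => ((n : ℝ≥0∞) + 1)⁻¹) atTop (𝓝 0) := by
    have := (tendsto_add_atTop_iff_nat 1).2 ENNReal.tendsto_inv_nat_nhds_zero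
    simpa using this
  have hsq : ∀ {a : ℕ → ℝ≥0∞}, (∀ n, a n < ((n : ℝ≥0∞) + 1)⁻¹) → Tendsto a atTop (𝓝 0) :=
    fun ha => tendsto_of_tendsto_of_tendsto_of_le_of_le tendsto_const_nhds hlim
      (fun _ => zero_le) fun n => (ha n).le
  refine ⟨φ, hφ, ?_, ?_, hsq h3⟩
  · refine tendsto_eLpNorm_add (a := fun n x => φ n x - z n x) (b := fun n => ⇑(z n) - ⇑z₀)
      (fun n => (hφ n).continuous.aestronglyMeasurable.sub (Lp.aestronglyMeasurable _))
      (fun n => (Lp.aestronglyMeasurable _).sub (Lp.aestronglyMeasurable _))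
      (fun n => ae_of_all _ fun x => ?_) (hsq h1)
      ((Lp.tendsto_Lp_iff_tendsto_eLpNorm' _ _).1 hz)
    simp
  · refine tendsto_eLpNorm_add (a := fun n x => jacobian (φ n) x - G n x)
      (b := fun n => ⇑(G n) - ⇑G₀)
      (fun n => (continuous_jacobian (hφ n)).aestronglyMeasurable.sub (Lp.aestronglyMeasurable _))
      (fun n => (Lp.aestronglyMeasurable _).sub (Lp.aestronglyMeasurable _))
      (fun n => ae_of_all _ fun x => ?_) (hsq h2)
      ((Lp.tendsto_Lp_iff_tendsto_eLpNorm' _ _).1 hG)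
    simp

theorem isClosed_VSub : IsClosed (VSub Ω ΓD : Set (WithLp 2 (HVec Ω × HGrad Ω))) := by
  refine IsSeqClosed.isClosed fun p p₀ hp hlim => ⟨?_, ?_⟩
  · exact isClosed_hasWeakGrad.mem_of_tendsto hlim (Eventually.of_forall fun n => (hp n).1)
  · exact HasZeroTraceOn.of_tendsto (fun n => (hp n).2)
      (((WithLp.fstL 2 ℝ (HVec Ω) (HGrad Ω)).continuous.tendsto p₀).comp hlim)
      (((WithLp.sndL 2 ℝ (HVec Ω) (HGrad Ω)).continuous.tendsto p₀).comp hlim)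

instance : CompleteSpace (VSp Ω ΓD) := isClosed_VSub.completeSpace_coe

theorem norm_sq_VSp (z : VSp Ω ΓD) : ‖z‖ ^ 2 = ‖toH Ω ΓD z‖ ^ 2 + ‖grad Ω ΓD z‖ ^ 2 :=
  WithLp.prod_norm_sq_eq_of_L2 (z : WithLp 2 (HVec Ω × HGrad Ω))

/-- A smooth compactly supported field in `Ω` belongs to `V`. -/
theorem exists_VSp_of_isTest (hΩ : IsOpen Ω) (hΓm : MeasurableSet ΓD) (hΓ : ΓD ⊆ frontier Ω)
    {φ : E3 → ℝ} (hφ : IsTest Ω φ) (k : Fin 3) :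
    ∃ z : VSp Ω ΓD, toH Ω ΓD z =ᵐ[volume.restrict Ω] fun x => φ x • EuclideanSpace.single k 1 := by
  set e : E3 := EuclideanSpace.single k 1 with he
  set Φ : E3 → E3 := fun x => φ x • e with hΦ
  have hΦs : ContDiff ℝ ∞ Φ := hφ.smooth.smul contDiff_const
  have hΦc : HasCompactSupport Φ := hφ.hasCompactSupport.smul_right
  have hm : MemLp Φ 2 (volume.restrict Ω) :=
    hΦs.continuous.memLp_of_hasCompactSupport hΦc
  have hfd : ∀ x v, fderiv ℝ Φ x v = fderiv ℝ φ x v • e := by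
    intro x v
    have hd : DifferentiableAt ℝ φ x := hφ.smooth.differentiable (by simp) x
    have h := (hd.hasFDerivAt.smul_const e).fderiv
    rw [hΦ, h]
    rfl
  have hjc : HasCompactSupport (jacobian Φ) := by
    refine (hφ.hasCompactSupport.fderiv ℝ).mono' ?_
    refine fun x hx => subset_tsupport _ ?_
    intro h0
    refine hx ?_
    ext p
    simp [jacobian, hfd, h0]
  have hmj : MemLp (jacobian Φ) 2 (volume.restrict Ω) :=
    (continuous_jacobian hΦs).memLp_of_hasCompactSupport hjc
  have hwg : HasWeakGrad Ω (hm.toLp Φ) (hmj.toLp (jacobian Φ)) := by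
    intro ψ hψ i j
    have hcd : Continuous (fderiv ℝ ψ) := hψ.smooth.continuous_fderiv (by simp)
    have hcd' : Continuous (fderiv ℝ φ) := hφ.smooth.continuous_fderiv (by simp)
    have e1 : ∫ x in Ω, (hm.toLp Φ) x i * partialDeriv ψ j x
        = ∫ x, (φ x * e i) * fderiv ℝ ψ x (EuclideanSpace.single j 1) := by
      refine (integral_congr_ae (g := fun x => (φ x * e i)
        * fderiv ℝ ψ x (EuclideanSpace.single j 1)) ?_).trans
        (setIntegral_eq_integral_of_forall_compl_eq_zero ?_)
      · filter_upwards [hm.coeFn_toLp] with x hx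
        rw [hx]
        rfl
      · intro x hx
        rw [image_eq_zero_of_notMem_tsupport (fun h => hx (hφ.tsupport_subset h))]
        simp
    have e2 : ∫ x in Ω, (hmj.toLp (jacobian Φ)) x (i, j) * ψ x
        = ∫ x, (fderiv ℝ φ x (EuclideanSpace.single j 1) * e i) * ψ x := by
      refine (integral_congr_ae (g := fun x => (fderiv ℝ φ x (EuclideanSpace.single j 1) * e i)
        * ψ x) ?_).trans (setIntegral_eq_integral_of_forall_compl_eq_zero ?_)
      · filter_upwards [hmj.coeFn_toLp] with x hx
        rw [hx]
        simp [jacobian, hfd]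
      · intro x hx
        rw [image_eq_zero_of_notMem_tsupport (fun h => hx (hψ.tsupport_subset h))]
        simp
    have hfe : ∀ x, fderiv ℝ (fun y => φ y * e i) x (EuclideanSpace.single j 1)
        = fderiv ℝ φ x (EuclideanSpace.single j 1) * e i := by
      intro x
      have hd : DifferentiableAt ℝ φ x := hφ.smooth.differentiable (by simp) x
      rw [(hd.hasFDerivAt.mul_const (e i)).fderiv]
      simp [mul_comm]
    have hcφ : HasCompactSupport fun x => φ x * e i := hφ.hasCompactSupport.mul_right
    rw [e1, e2, integral_mul_fderiv_eq_neg_fderiv_mul_of_integrable]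
    · simp_rw [hfe]
    · simp_rw [hfe]
      exact (((hcd'.clm_apply continuous_const).mul continuous_const).mul
        hψ.smooth.continuous).integrable_of_hasCompactSupport hψ.hasCompactSupport.mul_left
    · exact ((hφ.smooth.continuous.mul continuous_const).mul
        (hcd.clm_apply continuous_const)).integrable_of_hasCompactSupport hcφ.mul_right
    · exact ((hφ.smooth.continuous.mul continuous_const).mul
        hψ.smooth.continuous).integrable_of_hasCompactSupport hcφ.mul_right
    · exact fun x _ => (hφ.smooth.differentiable (by simp) x).mul_const _
    · exact fun x _ => hψ.smooth.differentiable (by simp) x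
  have htr : HasZeroTraceOn Ω ΓD (hm.toLp Φ) (hmj.toLp (jacobian Φ)) := by
    refine ⟨fun _ => Φ, fun _ => hΦs, ?_, ?_, ?_⟩
    · refine tendsto_const_nhds.congr fun n => ?_
      rw [eq_comm, eLpNorm_congr_ae (g := 0), eLpNorm_zero]
      filter_upwards [hm.coeFn_toLp] with x hx
      simp [hx]
    · refine tendsto_const_nhds.congr fun n => ?_
      rw [eq_comm, eLpNorm_congr_ae (g := 0), eLpNorm_zero]
      filter_upwards [hmj.coeFn_toLp] with x hx
      simp [hx]
    · refine tendsto_const_nhds.congr fun n => ?_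
      rw [eq_comm, eLpNorm_congr_ae (g := 0), eLpNorm_zero]
      refine ae_restrict_of_forall_mem hΓm fun x hx => ?_
      -- An open set does not meet its frontier, so a test function supported in `Ω` vanishes
      -- identically on `Γ_D`.
      have hxΩ : x ∉ Ω := by
        have := hΓ hx
        rw [hΩ.frontier_eq] at this
        exact this.2
      simp only [hΦ, Pi.zero_apply]
      rw [image_eq_zero_of_notMem_tsupport (fun h => hxΩ (hφ.tsupport_subset h)), zero_smul]
  exact ⟨⟨WithLp.toLp 2 (hm.toLp Φ, hmj.toLp (jacobian Φ)), hwg, htr⟩, hm.coeFn_toLp⟩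

/-- `V` is dense in `L²(Ω)³`. -/
theorem eq_zero_of_inner_toH (hΩ : IsOpen Ω) (hΓm : MeasurableSet ΓD) (hΓ : ΓD ⊆ frontier Ω)
    {u : HVec Ω} (hu : ∀ z, inner ℝ u (toH Ω ΓD z) = 0) : u = 0 := by
  have h : ∀ k : Fin 3, ∀ᵐ x ∂(volume.restrict Ω), x ∈ Ω → u x k = 0 := by
    intro k
    refine hΩ.ae_eq_zero_of_integral_contDiff_smul_eq_zero
      (((memLp_coord u k).locallyIntegrable (by norm_num)).locallyIntegrableOn Ω) ?_
    intro φ h1 h2 h3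
    obtain ⟨z, hz⟩ := exists_VSp_of_isTest (ΓD := ΓD) hΩ hΓm hΓ ⟨h1, h2, h3⟩ k
    rw [← hu z, L2.inner_def]
    refine integral_congr_ae ?_
    filter_upwards [hz] with x hx
    rw [hx, inner_smul_right, EuclideanSpace.inner_single_right]
    simp
  refine Lp.ext ?_
  filter_upwards [ae_all_iff.2 h, self_mem_ae_restrict hΩ.measurableSet,
    Lp.coeFn_zero E3 2 (volume.restrict Ω)] with x h1 h2 h3
  rw [h3]
  ext k
  exact h1 k h2

end VelocitySpace

/-! ### The yield sets as a sweeping family -/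

section YieldSet

variable {Ω : Set E3}

/-- The deviator as an operator. -/
def deviatorL : SymTensor →L[ℝ] Tensor :=
  LinearMap.toContinuousLinearMap
    { toFun := deviator
      map_add' := fun a b => by
        ext p
        have h : ∀ q, (a + b).toTensor q = a.toTensor q + b.toTensor q := fun _ => rfl
        simp only [deviator, h, Finset.sum_add_distrib, PiLp.add_apply]
        ring
      map_smul' := fun c a => by
        ext p
        have h : ∀ q, (c • a).toTensor q = c * a.toTensor q := fun _ => rfl
        simp only [deviator, h, ← Finset.mul_sum, PiLp.smul_apply, smul_eq_mul, RingHom.id_apply]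
        ring }

theorem deviatorL_apply (τ : SymTensor) : deviatorL τ = deviator τ := rfl

/-- The yield set for the threshold `γ + c`. -/
def relaxedYieldSet (Ω : Set E3) (γ : closure Ω →ᵇ ℝ) (c : ℝ) : Set (HSym Ω) :=
  {τ | ∀ᵐ x ∂(volume.restrict Ω), ∀ hx : x ∈ Ω,
    (1 / 2 : ℝ) * ‖deviatorL (τ x)‖ ^ 2 ≤ γ ⟨x, subset_closure hx⟩ + c}

theorem relaxedYieldSet_zero (γ : closure Ω →ᵇ ℝ) : relaxedYieldSet Ω γ 0 = Ktilde Ω γ := by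
  simp only [relaxedYieldSet, Ktilde, add_zero, deviatorL_apply]

theorem isClosed_relaxedYieldSet (γ : closure Ω →ᵇ ℝ) :
    IsClosed {p : HSym Ω × ℝ | p.1 ∈ relaxedYieldSet Ω γ p.2} := by
  refine IsSeqClosed.isClosed fun p p₀ hp hlim => ?_
  have h1 : Tendsto (fun n => (p n).1) atTop (𝓝 p₀.1) := (continuous_fst.tendsto p₀).comp hlim
  have h2 : Tendsto (fun n => (p n).2) atTop (𝓝 p₀.2) := (continuous_snd.tendsto p₀).comp hlim
  obtain ⟨φ, hφ, hφt⟩ := (tendstoInMeasure_of_tendsto_Lp h1).exists_seq_tendsto_ae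
  have hp' : ∀ᵐ x ∂(volume.restrict Ω), ∀ n, ∀ hx : x ∈ Ω,
      (1 / 2 : ℝ) * ‖deviatorL ((p n).1 x)‖ ^ 2 ≤ γ ⟨x, subset_closure hx⟩ + (p n).2 :=
    ae_all_iff.2 hp
  filter_upwards [hφt, hp'] with x h3 h4 hx
  have h5 : Tendsto (fun n => (1 / 2 : ℝ) * ‖deviatorL ((p (φ n)).1 x)‖ ^ 2) atTop
      (𝓝 ((1 / 2 : ℝ) * ‖deviatorL (p₀.1 x)‖ ^ 2)) :=
    (((deviatorL.continuous.tendsto _).comp h3).norm.pow 2).const_mul _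
  exact le_of_tendsto_of_tendsto' h5 ((h2.comp hφ.tendsto_atTop).const_add _)
    fun n => h4 (φ n) hx

/-- The constraint function is convex in the tensor and the threshold affine in `c`. Convexity is
needed jointly in both, since separation takes place in the product space. -/
theorem convex_relaxedYieldSet (γ : closure Ω →ᵇ ℝ) :
    Convex ℝ {p : HSym Ω × ℝ | p.1 ∈ relaxedYieldSet Ω γ p.2} := by
  rintro ⟨τ, c⟩ hτ ⟨τ', c'⟩ hτ' a b ha hb hab
  filter_upwards [hτ, hτ', Lp.coeFn_add (a • τ) (b • τ'), Lp.coeFn_smul a τ, Lp.coeFn_smul b τ']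
    with x h1 h2 h3 h4 h5 hx
  change (1 / 2 : ℝ) * ‖deviatorL ((a • τ + b • τ') x)‖ ^ 2
    ≤ γ ⟨x, subset_closure hx⟩ + (a • c + b • c')
  rw [h3, Pi.add_apply, h4, h5, Pi.smul_apply, Pi.smul_apply, map_add, map_smul, map_smul]
  have h6 : (1 / 2 : ℝ) * ‖deviatorL (τ x)‖ ^ 2 ≤ γ ⟨x, subset_closure hx⟩ + c := h1 hx
  have h7 : (1 / 2 : ℝ) * ‖deviatorL (τ' x)‖ ^ 2 ≤ γ ⟨x, subset_closure hx⟩ + c' := h2 hx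
  have h8 : ‖a • deviatorL (τ x) + b • deviatorL (τ' x)‖ ^ 2
      ≤ a * ‖deviatorL (τ x)‖ ^ 2 + b * ‖deviatorL (τ' x)‖ ^ 2 :=
    ((convexOn_univ_norm (E := Tensor)).pow (fun _ _ => norm_nonneg _) 2).2 (mem_univ _) (mem_univ _) ha hb hab
  have h9 : γ ⟨x, subset_closure hx⟩
      = a * γ ⟨x, subset_closure hx⟩ + b * γ ⟨x, subset_closure hx⟩ := by
    rw [← add_mul, hab, one_mul]
  rw [smul_eq_mul, smul_eq_mul, h9]
  nlinarith [mul_le_mul_of_nonneg_left h6 ha, mul_le_mul_of_nonneg_left h7 hb]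

theorem zero_mem_relaxedYieldSet {γ : closure Ω →ᵇ ℝ} (hγ : ∀ x, 0 ≤ γ x) :
    (0 : HSym Ω) ∈ relaxedYieldSet Ω γ 0 := by
  filter_upwards [Lp.coeFn_zero SymTensor 2 (volume.restrict Ω)] with x hx hxΩ
  have hx' : (0 : HSym Ω) x = 0 := hx
  rw [hx', map_zero]
  simpa using hγ _

theorem relaxedYieldSet_mono {γ γ' : closure Ω →ᵇ ℝ} {c c' : ℝ} (h : ∀ x, γ x + c ≤ γ' x + c') :
    relaxedYieldSet Ω γ c ⊆ relaxedYieldSet Ω γ' c' := by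
  intro τ hτ
  rw [relaxedYieldSet, mem_ofPred_eq] at hτ ⊢
  filter_upwards [hτ] with x hx hxΩ
  exact (hx hxΩ).trans (h _)

/-- The factor `l = κ / (κ + c) ≤ 1` multiplies the quadratic yield function by `l² ≤ l`, and `l (γ
+ c) ≤ γ` follows from `κ ≤ γ`. -/
theorem smul_mem_relaxedYieldSet {γ : closure Ω →ᵇ ℝ} {κ c : ℝ} (hκ : 0 < κ)
    (hγ : ∀ x, κ ≤ γ x) (hc : 0 ≤ c) {τ : HSym Ω} (hτ : τ ∈ relaxedYieldSet Ω γ c) :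
    (κ / (κ + c)) • τ ∈ relaxedYieldSet Ω γ 0 := by
  filter_upwards [hτ, Lp.coeFn_smul (κ / (κ + c)) τ] with x h1 h2 hx
  have h3 := h1 hx
  have h4 := hγ ⟨x, subset_closure hx⟩
  set G := γ ⟨x, subset_closure hx⟩
  have hd : 0 < κ + c := by linarith
  have h5 : 0 ≤ κ / (κ + c) := by positivity
  have h6 : κ / (κ + c) ≤ 1 := div_le_one_of_le₀ (by linarith) hd.le
  rw [h2, Pi.smul_apply, map_smul, norm_smul, Real.norm_of_nonneg h5, mul_pow, add_zero]
  have h7 : κ / (κ + c) * (G + c) ≤ G := by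
    rw [div_mul_eq_mul_div, div_le_iff₀ hd]
    nlinarith
  have h8 : 0 ≤ κ / (κ + c) * (G + c) := mul_nonneg h5 (by linarith)
  calc 1 / 2 * ((κ / (κ + c)) ^ 2 * ‖deviatorL (τ x)‖ ^ 2)
      = (κ / (κ + c)) ^ 2 * (1 / 2 * ‖deviatorL (τ x)‖ ^ 2) := by ring
    _ ≤ (κ / (κ + c)) ^ 2 * (G + c) := mul_le_mul_of_nonneg_left h3 (sq_nonneg _)
    _ = κ / (κ + c) * (κ / (κ + c) * (G + c)) := by ring
    _ ≤ κ / (κ + c) * (G + c) := mul_le_of_le_one_left h8 h6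
    _ ≤ G := h7

/-- The yield sets of a threshold of class `H¹` in time form a sweeping family. -/
theorem isSweepingFamily_yieldSet {T κ : ℝ} {g g' : ℝ → (closure Ω →ᵇ ℝ)}
    (hg : HasH1Deriv T g g') (hκ : 0 < κ) (hgκ : ∀ t ∈ Icc 0 T, ∀ x, κ ≤ g t x) :
    IsSweepingFamily T κ (hg.1.norm.toLp _) fun t c => relaxedYieldSet Ω (g t) c := by
  set ρ : TimeL2 T ℝ := hg.1.norm.toLp _ with hρ
  have hρe : ρ =ᵐ[timeMeasure T] fun s => ‖g' s‖ := hg.1.norm.coeFn_toLp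
  have hgi : Integrable g' (timeMeasure T) := hg.1.integrable (by norm_num)
  have hprim : ∀ t ∈ Icc 0 T, primL T ℝ t ρ = ∫ s in (0 : ℝ)..t, ‖g' s‖ := fun t ht => by
    rw [← integral_Iic_timeMeasure _ ht]
    exact integral_congr_ae (ae_restrict_of_ae hρe)
  have hI := fun t (ht : t ∈ Icc 0 T) => intervalIntegrable_of_integrable hgi ht
  refine ⟨hκ, ?_, fun t _ => isClosed_relaxedYieldSet _, fun t _ => convex_relaxedYieldSet _,
    fun t ht => zero_mem_relaxedYieldSet fun x => hκ.le.trans (hgκ t ht x),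
    fun t _ c c' hc => relaxedYieldSet_mono fun x => by linarith, ?_,
    fun t ht c hc τ hτ => smul_mem_relaxedYieldSet hκ (hgκ t ht) hc hτ⟩
  · intro s hs t ht hst
    simp only
    rw [hprim s hs, hprim t ht, ← sub_nonneg,
      intervalIntegral.integral_interval_sub_left (hI t ht).norm (hI s hs).norm]
    exact intervalIntegral.integral_nonneg hst fun _ _ => norm_nonneg _
  · intro s hs t ht
    refine relaxedYieldSet_mono fun x => ?_
    have h1 : g s - g t = ∫ r in t..s, g' r := by
      rw [hg.2 s hs, hg.2 t ht, add_sub_add_left_eq_sub,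
        intervalIntegral.integral_interval_sub_left (hI s hs) (hI t ht)]
    have h2 : ‖g s - g t‖ ≤ |primL T ℝ t ρ - primL T ℝ s ρ| := by
      rw [h1, abs_sub_comm, hprim s hs, hprim t ht,
        intervalIntegral.integral_interval_sub_left (hI s hs).norm (hI t ht).norm]
      exact intervalIntegral.norm_integral_le_abs_integral_norm
    have h3 := (le_abs_self _).trans ((g s - g t).norm_coe_le_norm x)
    rw [BoundedContinuousFunction.sub_apply] at h3
    linarith

end YieldSet

/-! ### The abstract coupled system -/

section CoupledSystem

set_option linter.unusedSectionVars false

variable {V H W X : Type*} [NormedAddCommGroup V] [InnerProductSpace ℝ V] [CompleteSpace V]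
  [NormedAddCommGroup H] [InnerProductSpace ℝ H] [CompleteSpace H]
  [NormedAddCommGroup W] [InnerProductSpace ℝ W] [CompleteSpace W]
  [NormedAddCommGroup X] [InnerProductSpace ℝ X] [CompleteSpace X] {T : ℝ}

/-- Since the set moves, closedness is applied for fixed `t` to the lifted curve `s ↦ (σ s, |r t - r
s|)`, with `r` the primitive of `ρ`, and the fixed set at time `t`; at `s = t` the second component
is `0`. -/
theorem IsSweepingFamily.forall_mem {κ : ℝ} {ρ : TimeL2 T ℝ} {K : ℝ → ℝ → Set X}
    (h : IsSweepingFamily T κ ρ K) (hT : 0 < T) {σ : ℝ → X} (hσ : ContinuousOn σ (Icc 0 T))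
    (hK : ∀ᵐ t ∂(timeMeasure T), σ t ∈ K t 0) : ∀ t ∈ Icc 0 T, σ t ∈ K t 0 := by
  intro t ht
  have h1 := forall_mem_of_ae_mem (E := X × ℝ) hT (h.isClosed t ht)
    ⟨((0 : X), (0 : ℝ)), h.zero_mem t ht⟩
    (u := fun s => (σ s, |primL T ℝ t ρ - primL T ℝ s ρ|))
    (hσ.prodMk (continuousOn_const.sub (continuousOn_primL ρ)).abs) ?_ t ht
  · simpa using h1
  · filter_upwards [hK, ae_restrict_mem (measurableSet_Ioo (a := 0) (b := T))] with s h2 h3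
    exact h.shift s (Ioo_subset_Icc_self h3) t ht h2

theorem primL_toLp {w : ℝ → X} (hw : MemLp w 2 (timeMeasure T)) {t : ℝ} (ht : t ∈ Icc 0 T) :
    primL T X t (hw.toLp w) = ∫ s in (0 : ℝ)..t, w s := by
  rw [← integral_Iic_timeMeasure _ ht]
  exact integral_congr_ae (ae_restrict_of_ae hw.coeFn_toLp)

theorem HasH1Deriv.eq_primL {u w : ℝ → X} (h : HasH1Deriv T u w) {t : ℝ} (ht : t ∈ Icc 0 T) :
    u t = u 0 + primL T X t (h.1.toLp w) := by
  rw [primL_toLp h.1 ht]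
  exact h.2 t ht

/-- `(v, σ)` solves the abstract viscous plasticity system: `v' + ν D*D u + e*σ = i*f` in `V*`
(identified with `V`), where `v = i u`, and `σ' - e u - h` is an inner normal at `σ` of the moving
set `M t`. -/
structure IsCoupledSolution (T ν : ℝ) (i : V →L[ℝ] H) (D : V →L[ℝ] W) (e : V →L[ℝ] X)
    (f : ℝ → H) (h : ℝ → X) (M : ℝ → Set X) (v₀ : H) (σ₀ : X) (v : ℝ → H) (σ : ℝ → X)
    (u v' : ℝ → V) (σ' : ℝ → X) : Prop where
  velocity_deriv : HasH1Deriv T (fun t => i.adjoint (v t)) v'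
  velocity_bounded : MemLp v ∞ (timeMeasure T)
  velocity_memLp : MemLp u 2 (timeMeasure T)
  velocity_eq : ∀ᵐ t ∂(timeMeasure T), v t = i (u t)
  stress_deriv : HasH1Deriv T σ σ'
  stress_mem : ∀ t ∈ Icc 0 T, σ t ∈ M t
  motion : ∀ᵐ t ∂(timeMeasure T),
    v' t + ν • D.adjoint (D (u t)) + e.adjoint (σ t) = i.adjoint (f t)
  flow : ∀ᵐ t ∂(timeMeasure T), ∀ τ ∈ M t, inner ℝ (σ' t - e (u t) - h t) (σ t - τ) ≤ 0
  velocity_zero : v 0 = v₀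
  stress_zero : σ 0 = σ₀

variable {ν : ℝ} {i : V →L[ℝ] H} {D : V →L[ℝ] W} {e : V →L[ℝ] X}

/-- Transfers the positivity of the parabolic solution operator `S` to `e S e*` on each `(0,t)`. -/
theorem inner_chi_lift_adjoint (e : V →L[ℝ] X) (t : ℝ) (y : TimeL2 T V) (x : TimeL2 T X) :
    inner ℝ (chi T X t (lift T e y)) x = inner ℝ (chi T V t (lift T e.adjoint x)) y := by
  rw [chi_lift, real_inner_comm, ← inner_lift_adjoint, inner_chi_right]

/-- The velocity difference is `u = S (-e* x)`, where `x` is the stress difference, hence `∫₀ᵗ (e u,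
x) ≤ 0`. Inserting each stress in the other's inequality and adding gives `½ |x(t)|² ≤ ∫₀ᵗ (e u,
x)`. Injectivity of `i*` then gives equality of the velocities at every time. -/
theorem IsCoupledSolution.unique (hT : 0 < T) (hν : 0 < ν)
    (hnorm : ∀ z, ‖z‖ ^ 2 = ‖i z‖ ^ 2 + ‖D z‖ ^ 2) (hi : Function.Injective i.adjoint)
    {f : ℝ → H} {h : ℝ → X} {M : ℝ → Set X} {v₀ : H} {σ₀ : X} {v₁ v₂ : ℝ → H} {σ₁ σ₂ : ℝ → X}
    {u₁ u₂ v₁' v₂' : ℝ → V} {σ₁' σ₂' : ℝ → X}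
    (h₁ : IsCoupledSolution T ν i D e f h M v₀ σ₀ v₁ σ₁ u₁ v₁' σ₁')
    (h₂ : IsCoupledSolution T ν i D e f h M v₀ σ₀ v₂ σ₂ u₂ v₂' σ₂') :
    ∀ t ∈ Icc 0 T, v₁ t = v₂ t ∧ σ₁ t = σ₂ t := by
  obtain ⟨S, hS, hSpos, -⟩ := exists_parabolicOperator (i := i) (D := D) hT hν hnorm
  set u : TimeL2 T V := h₁.velocity_memLp.toLp u₁ - h₂.velocity_memLp.toLp u₂ with hu
  set p : TimeL2 T V := h₁.velocity_deriv.1.toLp v₁' - h₂.velocity_deriv.1.toLp v₂' with hp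
  set w : TimeL2 T X := h₁.stress_deriv.1.toLp σ₁' - h₂.stress_deriv.1.toLp σ₂' with hw
  set x : TimeL2 T X := volt T X w with hx
  have hσ : ∀ t ∈ Icc 0 T, σ₁ t - σ₂ t = primL T X t w := fun t ht => by
    have e0 : σ₁ 0 - σ₂ 0 = 0 := sub_eq_zero.2 (h₁.stress_zero.trans h₂.stress_zero.symm)
    rw [h₁.stress_deriv.eq_primL ht, h₂.stress_deriv.eq_primL ht, hw, map_sub, add_sub_add_comm,
      e0, zero_add]
  have hv : ∀ t ∈ Icc 0 T, i.adjoint (v₁ t - v₂ t) = primL T V t p := fun t ht => by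
    have e0 : i.adjoint (v₁ 0) - i.adjoint (v₂ 0) = 0 :=
      sub_eq_zero.2 (congrArg _ (h₁.velocity_zero.trans h₂.velocity_zero.symm))
    rw [map_sub, h₁.velocity_deriv.eq_primL ht, h₂.velocity_deriv.eq_primL ht, hp, map_sub,
      add_sub_add_comm, e0, zero_add]
  have hxa : ∀ᵐ t ∂(timeMeasure T), x t = σ₁ t - σ₂ t := by
    filter_upwards [coeFn_volt w, ae_restrict_mem (measurableSet_Ioo (a := 0) (b := T))]
      with t h3 h4
    rw [h3, hσ t (Ioo_subset_Icc_self h4)]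
  have hua : ∀ᵐ t ∂(timeMeasure T), u t = u₁ t - u₂ t := by
    filter_upwards [Lp.coeFn_sub (h₁.velocity_memLp.toLp u₁) (h₂.velocity_memLp.toLp u₂),
      h₁.velocity_memLp.coeFn_toLp, h₂.velocity_memLp.coeFn_toLp] with t h3 h4 h5
    rw [h3, Pi.sub_apply, h4, h5]
  have hwa : ∀ᵐ t ∂(timeMeasure T), w t = σ₁' t - σ₂' t := by
    filter_upwards [Lp.coeFn_sub (h₁.stress_deriv.1.toLp σ₁') (h₂.stress_deriv.1.toLp σ₂'),
      h₁.stress_deriv.1.coeFn_toLp, h₂.stress_deriv.1.coeFn_toLp] with t h3 h4 h5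
    rw [h3, Pi.sub_apply, h4, h5]
  have hpa : ∀ᵐ t ∂(timeMeasure T), p t = v₁' t - v₂' t := by
    filter_upwards [Lp.coeFn_sub (h₁.velocity_deriv.1.toLp v₁') (h₂.velocity_deriv.1.toLp v₂'),
      h₁.velocity_deriv.1.coeFn_toLp, h₂.velocity_deriv.1.coeFn_toLp] with t h3 h4 h5
    rw [h3, Pi.sub_apply, h4, h5]
  have hpe : p = -lift T e.adjoint x - ν • lift T D.adjoint (lift T D u) := by
    refine Lp.ext ?_
    filter_upwards [hpa, hua, hxa, h₁.motion, h₂.motion,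
      Lp.coeFn_sub (-lift T e.adjoint x) (ν • lift T D.adjoint (lift T D u)),
      Lp.coeFn_neg (lift T e.adjoint x), Lp.coeFn_smul ν (lift T D.adjoint (lift T D u)),
      e.adjoint.coeFn_compLpL x, D.adjoint.coeFn_compLpL (lift T D u), D.coeFn_compLpL u]
      with t a1 a2 a3 a4 a5 a6 a7 a8 a9 a10 a11
    rw [a1, a6, Pi.sub_apply, a7, Pi.neg_apply, a8, Pi.smul_apply, a9, a10, a11, a2, a3]
    have b1 : v₁' t = i.adjoint (f t) - ν • D.adjoint (D (u₁ t)) - e.adjoint (σ₁ t) := by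
      rw [← a4]; abel
    have b2 : v₂' t = i.adjoint (f t) - ν • D.adjoint (D (u₂ t)) - e.adjoint (σ₂ t) := by
      rw [← a5]; abel
    rw [b1, b2]
    simp only [map_sub, smul_sub]
    abel
  have hpar : IsParabolicSol i D ν (-lift T e.adjoint x) u := by
    unfold IsParabolicSol
    rw [← hpe]
    refine Lp.ext ?_
    filter_upwards [coeFn_volt p, i.adjoint.coeFn_compLpL (lift T i u), i.coeFn_compLpL u, hua,
      h₁.velocity_eq, h₂.velocity_eq, ae_restrict_mem (measurableSet_Ioo (a := 0) (b := T))]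
      with t a1 a2 a3 a4 a5 a6 a7
    rw [a1, a2, a3, a4, map_sub, ← a5, ← a6, hv t (Ioo_subset_Icc_self a7)]
  have huS : u = S (-lift T e.adjoint x) := hpar.unique hT hν hnorm (hS _)
  have hσ0 : ∀ t ∈ Icc 0 T, primL T X t w = 0 := by
    intro t ht
    have h3 := hSpos (-lift T e.adjoint x) t ht
    rw [← huS, map_neg, inner_neg_left, ← inner_chi_lift_adjoint] at h3
    have h4 : inner ℝ (chi T X t (w - lift T e u)) x ≤ 0 := by
      rw [inner_chi]
      refine integral_nonpos_of_ae (ae_restrict_of_ae ?_)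
      filter_upwards [hwa, hua, hxa, h₁.flow, h₂.flow, Lp.coeFn_sub w (lift T e u),
        e.coeFn_compLpL u, ae_restrict_mem (measurableSet_Ioo (a := 0) (b := T))]
        with s a1 a2 a3 a4 a5 a6 a7 a8
      have hs := Ioo_subset_Icc_self a8
      have b1 := a4 _ (h₂.stress_mem s hs)
      have b2 := a5 _ (h₁.stress_mem s hs)
      rw [a6, Pi.sub_apply, a7, a1, a2, a3, Pi.zero_apply]
      rw [← neg_sub (σ₁ s) (σ₂ s), inner_neg_right] at b2
      simp only [inner_sub_left, map_sub] at b1 b2 ⊢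
      linarith
    rw [map_sub, inner_sub_left, hx, inner_chi_volt w ht] at h4
    have h5 : ‖primL T X t w‖ ^ 2 ≤ 0 := by linarith
    exact norm_eq_zero.1 (sq_eq_zero_iff.1 (le_antisymm h5 (sq_nonneg _)))
  have hw0 : w = 0 := eq_zero_of_primL_eq_zero w hσ0
  have hx0 : x = 0 := by rw [hx, hw0, map_zero]
  have hu0 : u = 0 := by rw [huS, hx0, map_zero, neg_zero, map_zero]
  have hp0 : p = 0 := by rw [hpe, hx0, hu0]; simp
  intro t ht
  constructor
  · have h3 := hv t ht
    rw [hp0, map_zero, ← map_zero i.adjoint] at h3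
    exact sub_eq_zero.1 (hi h3)
  · have h3 := hσ t ht
    rw [hw0, map_zero] at h3
    exact sub_eq_zero.1 h3

/-- Substitute `u = v₀ + S (F₀ - e* x)` with `x = σ + σ_*`. The source `F₀` contains the force, the
constant extension of `v₀` and the correction `e* σ_*`; what remains is a sweeping process for `x`
with operator `e S e*`. -/
theorem exists_coupledSolution (hT : 0 < T) (hν : 0 < ν)
    (hnorm : ∀ z, ‖z‖ ^ 2 = ‖i z‖ ^ 2 + ‖D z‖ ^ 2) (hi : Function.Injective i.adjoint)
    {f : ℝ → H} (hf : MemLp f 2 (timeMeasure T)) {h : ℝ → X} (hh : MemLp h 2 (timeMeasure T))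
    {σstar s' : ℝ → X} (hs : HasH1Deriv T σstar s') {κ : ℝ} {ρ : TimeL2 T ℝ}
    {K : ℝ → ℝ → Set X} (hK : IsSweepingFamily T κ ρ K) (v₀ : V) {σ₀ : X}
    (h0 : σ₀ + σstar 0 ∈ K 0 0) :
    ∃ (v : ℝ → H) (σ : ℝ → X) (u v' : ℝ → V) (σ' : ℝ → X),
      IsCoupledSolution T ν i D e f h (fun t => {τ | τ + σstar t ∈ K t 0}) (i v₀) σ₀ v σ u v' σ' := by
  obtain ⟨S, hS, hSpos, hSv⟩ := exists_parabolicOperator (i := i) (D := D) hT hν hnorm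
  have hm0 : (0 : ℝ) ∈ Icc 0 T := left_mem_Icc.2 hT.le
  set fL : TimeL2 T H := hf.toLp f
  set hL : TimeL2 T X := hh.toLp h
  set sL : TimeL2 T X := hs.1.toLp s'
  set vL : TimeL2 T V := Lp.const 2 (timeMeasure T) v₀
  set rL : TimeL2 T X := Lp.const 2 (timeMeasure T) (σstar 0) + volt T X sL with hrL
  have hfa : ∀ᵐ t ∂(timeMeasure T), fL t = f t := hf.coeFn_toLp
  have hha : ∀ᵐ t ∂(timeMeasure T), hL t = h t := hh.coeFn_toLp
  have hsa : ∀ᵐ t ∂(timeMeasure T), sL t = s' t := hs.1.coeFn_toLp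
  have hva : ∀ᵐ t ∂(timeMeasure T), vL t = v₀ :=
    Lp.coeFn_const (p := 2) (μ := timeMeasure T) v₀
  have hra : ∀ᵐ t ∂(timeMeasure T), rL t = σstar t := by
    filter_upwards [Lp.coeFn_add (Lp.const 2 (timeMeasure T) (σstar 0)) (volt T X sL),
      coeFn_volt sL, Lp.coeFn_const (p := 2) (μ := timeMeasure T) (σstar 0),
      ae_restrict_mem (measurableSet_Ioo (a := 0) (b := T))] with t a1 a2 a3 a4
    rw [a1, Pi.add_apply, a2, a3, Function.const_apply, ← hs.eq_primL (Ioo_subset_Icc_self a4)]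
  set F₀ : TimeL2 T V := lift T i.adjoint fL - ν • lift T D.adjoint (lift T D vL)
    + lift T e.adjoint rL with hF₀
  set A : TimeL2 T X →L[ℝ] TimeL2 T X := (lift T e).comp (S.comp (lift T e.adjoint)) with hA
  have hApos : ∀ x, ∀ t ∈ Icc 0 T, 0 ≤ inner ℝ (chi T X t (A x)) x := by
    intro x t ht
    change 0 ≤ inner ℝ (chi T X t (lift T e (S (lift T e.adjoint x)))) x
    rw [inner_chi_lift_adjoint]
    exact hSpos _ t ht
  obtain ⟨x, w, hxK, hxw, hvi⟩ := exists_sweeping hT hK h0 A hApos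
    (hL + sL + lift T e vL + lift T e (S F₀))
  set σt : ℝ → X := fun t => σ₀ + σstar 0 + primL T X t w with hσt
  have hσtc : ContinuousOn σt (Icc 0 T) := continuousOn_const.add (continuousOn_primL w)
  have hxa : ∀ᵐ t ∂(timeMeasure T), x t = σt t := by
    filter_upwards [Lp.coeFn_add (Lp.const 2 (timeMeasure T) (σ₀ + σstar 0)) (volt T X w),
      coeFn_volt w, Lp.coeFn_const (p := 2) (μ := timeMeasure T) (σ₀ + σstar 0)] with t a1 a2 a3
    rw [hxw, a1, Pi.add_apply, a2, a3]
    rfl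
  have hσK : ∀ t ∈ Icc 0 T, σt t ∈ K t 0 := hK.forall_mem hT hσtc (by
    filter_upwards [hxa, hxK] with t a1 a2
    rwa [← a1])
  set F : TimeL2 T V := F₀ - lift T e.adjoint x with hF
  set y : TimeL2 T V := S F with hy
  set u : TimeL2 T V := vL + y with hu
  set q : TimeL2 T V := F - ν • lift T D.adjoint (lift T D y) with hq
  have hua : ∀ᵐ t ∂(timeMeasure T), u t = v₀ + y t := by
    filter_upwards [Lp.coeFn_add vL y, hva] with t a1 a2
    rw [a1, Pi.add_apply, a2]
  obtain ⟨C, hC⟩ := hSv F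
  have hC' : ∀ t, ∃ v : H, t ∈ Icc 0 T → ‖v‖ ≤ C ∧ i.adjoint v = primL T V t q := by
    intro t
    by_cases ht : t ∈ Icc 0 T
    · obtain ⟨v, hv⟩ := hC t ht
      exact ⟨v, fun _ => hv⟩
    · exact ⟨0, fun h => absurd h ht⟩
  choose v hv using hC'
  have hvy : ∀ᵐ t ∂(timeMeasure T), v t = i (y t) := by
    filter_upwards [coeFn_volt q, i.adjoint.coeFn_compLpL (lift T i y), i.coeFn_compLpL y,
      ae_restrict_mem (measurableSet_Ioo (a := 0) (b := T))] with t a1 a2 a3 a4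
    apply hi
    rw [(hv t (Ioo_subset_Icc_self a4)).2, ← a1, ← a3, ← a2]
    exact congrArg (fun z : TimeL2 T V => z t) (hS F).symm
  have hv0 : v 0 = 0 := by
    apply hi
    rw [(hv 0 hm0).2, primL_zero hT.le, map_zero]
  have hvu : ∀ᵐ t ∂(timeMeasure T), i v₀ + v t = i (u t) := by
    filter_upwards [hvy, hua] with t a1 a2
    rw [a1, a2, map_add]
  refine ⟨fun t => i v₀ + v t, fun t => σt t - σstar t, u, q, fun t => w t - s' t, ?_⟩
  refine ⟨⟨Lp.memLp q, fun t ht => ?_⟩, ?_, Lp.memLp u, hvu, ⟨(Lp.memLp w).sub hs.1, fun t ht => ?_⟩,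
    fun t ht => ?_, ?_, ?_, by simp [hv0], by simp [hσt, primL_zero hT.le]⟩
  · simp only
    rw [map_add, map_add, (hv t ht).2, hv0, map_zero, add_zero, primL_eq q ht]
  · refine MemLp.of_bound ?_ (‖i v₀‖ + C) ?_
    -- The pointwise values were chosen without regard to measurability; it is inherited from `i u`,
    -- with which they agree almost everywhere.
    · exact ((i.comp_memLp u).aestronglyMeasurable).congr (hvu.mono fun t ht => ht.symm)
    · refine ae_restrict_of_forall_mem measurableSet_Ioo fun t ht => (norm_add_le _ _).trans ?_
      have := (hv t (Ioo_subset_Icc_self ht)).1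
      linarith
  · simp only
    rw [intervalIntegral.integral_sub (intervalIntegrable_of_integrable w.integrable ht)
      (intervalIntegrable_of_integrable (hs.1.integrable (by norm_num)) ht), ← primL_eq w ht,
      hs.2 t ht, hσt]
    simp only
    rw [primL_zero hT.le]
    abel
  · change σt t - σstar t + σstar t ∈ K t 0
    rw [sub_add_cancel]
    exact hσK t ht
  · filter_upwards [hfa, hva, hra, hxa, hua, Lp.coeFn_sub F (ν • lift T D.adjoint (lift T D y)),
      Lp.coeFn_smul ν (lift T D.adjoint (lift T D y)), D.adjoint.coeFn_compLpL (lift T D y),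
      D.coeFn_compLpL y, Lp.coeFn_sub F₀ (lift T e.adjoint x), e.adjoint.coeFn_compLpL x,
      Lp.coeFn_add (lift T i.adjoint fL - ν • lift T D.adjoint (lift T D vL))
        (lift T e.adjoint rL), e.adjoint.coeFn_compLpL rL,
      Lp.coeFn_sub (lift T i.adjoint fL) (ν • lift T D.adjoint (lift T D vL)),
      i.adjoint.coeFn_compLpL fL, Lp.coeFn_smul ν (lift T D.adjoint (lift T D vL)),
      D.adjoint.coeFn_compLpL (lift T D vL), D.coeFn_compLpL vL]
      with t a1 a2 a3 a4 a5 a6 a7 a8 a9 a10 a11 a12 a13 a14 a15 a16 a17 a18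
    have b : q t = i.adjoint (f t) - ν • D.adjoint (D v₀) + e.adjoint (σstar t)
        - e.adjoint (σt t) - ν • D.adjoint (D (y t)) := by
      rw [hq, a6, Pi.sub_apply, a7, Pi.smul_apply, a8, a9, hF, a10, Pi.sub_apply, a11, hF₀, a12,
        Pi.add_apply, a13, a14, Pi.sub_apply, a15, a16, Pi.smul_apply, a17, a18, a1, a2, a3, a4]
    rw [b, a5]
    simp only [map_add, map_sub, smul_add]
    abel
  · have hqe : w + A x - (hL + sL + lift T e vL + lift T e (S F₀))
        = w - sL - lift T e u - hL := by
      have h1 : A x = lift T e (S F₀) - lift T e y := by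
        rw [hy, hF, map_sub, map_sub, sub_sub_cancel]
        rfl
      have h2 : lift T e u = lift T e vL + lift T e y := by rw [hu, map_add]
      rw [h1, h2]
      abel
    rw [hqe] at hvi
    have hp := variationalInequality_pointwise hT hK hσtc hxa hxK hvi
    filter_upwards [hp, hha, hsa, Lp.coeFn_sub (w - sL - lift T e u) hL,
      Lp.coeFn_sub (w - sL) (lift T e u), Lp.coeFn_sub w sL, e.coeFn_compLpL u]
      with t a1 a2 a3 a4 a5 a6 a7 τ hτ
    have h1 := a1 _ hτ
    rw [a4, Pi.sub_apply, a5, Pi.sub_apply, a6, Pi.sub_apply, a7, a2, a3] at h1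
    have h2 : σt t - σstar t - τ = σt t - (τ + σstar t) := by abel
    rw [h2]
    exact h1

end CoupledSystem

/-! ### Riesz identification of `V*` with `V` -/

theorem HasH1Deriv.clm_comp {E F : Type*} [NormedAddCommGroup E] [NormedSpace ℝ E]
    [CompleteSpace E] [NormedAddCommGroup F] [NormedSpace ℝ F] [CompleteSpace F] {T : ℝ}
    {u w : ℝ → E} (h : HasH1Deriv T u w) (L : E →L[ℝ] F) :
    HasH1Deriv T (fun t => L (u t)) fun t => L (w t) := by
  refine ⟨L.comp_memLp' h.1, fun t ht => ?_⟩
  simp only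
  rw [L.intervalIntegral_comp_comm
    (intervalIntegrable_of_integrable (h.1.integrable (by norm_num)) ht), ← map_add, ← h.2 t ht]

section Riesz

variable {V W X : Type*} [NormedAddCommGroup V] [InnerProductSpace ℝ V] [CompleteSpace V]
  [NormedAddCommGroup W] [InnerProductSpace ℝ W] [CompleteSpace W]
  [NormedAddCommGroup X] [InnerProductSpace ℝ X] [CompleteSpace X] {T : ℝ}

theorem HasH1Deriv.innerSL {u w : ℝ → V} (h : HasH1Deriv T u w) :
    HasH1Deriv T (fun t => innerSL ℝ (u t)) fun t => innerSL ℝ (w t) :=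
  h.clm_comp (_root_.innerSL ℝ)

theorem HasH1Deriv.toDual_symm {u : ℝ → V} {w : ℝ → StrongDual ℝ V}
    (h : HasH1Deriv T (fun t => _root_.innerSL ℝ (u t)) w) :
    HasH1Deriv T u fun t => (InnerProductSpace.toDual ℝ V).symm (w t) := by
  have h1 := h.clm_comp (F := V)
    (InnerProductSpace.toDual ℝ V).symm.toContinuousLinearEquiv.toContinuousLinearMap
  have h2 : ∀ y : V, (InnerProductSpace.toDual ℝ V).symm.toContinuousLinearEquiv
      (_root_.innerSL ℝ y) = y := (InnerProductSpace.toDual ℝ V).symm_apply_apply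
  simp only [ContinuousLinearEquiv.coe_coe, h2] at h1
  exact h1

theorem inner_balance (D : V →L[ℝ] W) (e : V →L[ℝ] X) (ν : ℝ) (p u z : V) (σ : X) :
    inner ℝ (p + ν • D.adjoint (D u) + e.adjoint σ) z
      = inner ℝ p z + ν * inner ℝ (D u) (D z) + inner ℝ σ (e z) := by
  rw [inner_add_left, inner_add_left, real_inner_smul_left,
    ContinuousLinearMap.adjoint_inner_left, ContinuousLinearMap.adjoint_inner_left]

theorem inner_sub_le_iff {E : Type*} [NormedAddCommGroup E] [InnerProductSpace ℝ E]
    {s a b y : E} :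
    inner ℝ s y - inner ℝ a y ≤ inner ℝ b y ↔ inner ℝ (s - a - b) y ≤ 0 := by
  rw [inner_sub_left, inner_sub_left, sub_nonpos]

end Riesz

/-! ### The plasticity model as an instance of the abstract system -/

section Model

variable {Ω ΓD : Set E3}

/-- The kernel of the adjoint is the orthogonal complement of the range, which is trivial because
`V` is dense in `L²`. -/
theorem injective_adjoint_toH (hΩ : IsOpen Ω) (hΓm : MeasurableSet ΓD) (hΓ : ΓD ⊆ frontier Ω) :
    Function.Injective (toH Ω ΓD).adjoint := by
  refine (injective_iff_map_eq_zero _).2 fun u hu => eq_zero_of_inner_toH hΩ hΓm hΓ fun z => ?_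
  rw [← ContinuousLinearMap.adjoint_inner_left, hu, inner_zero_left]

theorem toVDual_eq (u : HVec Ω) : toVDual Ω ΓD u = innerSL ℝ ((toH Ω ΓD).adjoint u) := by
  ext z
  exact (ContinuousLinearMap.adjoint_inner_left (toH Ω ΓD) z u).symm

theorem motion_iff {ν : ℝ} {p u : VSp Ω ΓD} {σ : HSym Ω} {f : HVec Ω} :
    (∀ z : VSp Ω ΓD, inner ℝ p z + ν * gradForm Ω ΓD u z + inner ℝ σ (strain Ω ΓD z)
        = inner ℝ f (toH Ω ΓD z)) ↔
      p + ν • (grad Ω ΓD).adjoint (grad Ω ΓD u) + (strain Ω ΓD).adjoint σ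
        = (toH Ω ΓD).adjoint f := by
  have h := inner_balance (grad Ω ΓD) (strain Ω ΓD) ν p u (σ := σ)
  simp only [gradForm]
  simp_rw [← h, ← ContinuousLinearMap.adjoint_inner_left (toH Ω ΓD)]
  exact ⟨fun h1 => ext_inner_right ℝ h1, fun h1 z => by rw [h1]⟩

/-- The embedding of `u ∈ H` in `V*` is the Riesz image of `i* u`, so the Riesz isometry carries the
time derivative and the equation of motion from `V*` to `V` and back. -/
theorem isSolution_iff {T ν : ℝ} {f : ℝ → HVec Ω} {h σstar : ℝ → HSym Ω}
    {g : ℝ → (closure Ω →ᵇ ℝ)} {v₀ : VSp Ω ΓD} {σ₀ : HSym Ω} {v : ℝ → HVec Ω}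
    {σ : ℝ → HSym Ω} :
    IsSolution Ω ΓD T ν f h σstar g v₀ σ₀ v σ ↔
      ∃ (u v' : ℝ → VSp Ω ΓD) (σ' : ℝ → HSym Ω),
        IsCoupledSolution T ν (toH Ω ΓD) (grad Ω ΓD) (strain Ω ΓD) f h
          (fun t => {τ | τ + σstar t ∈ relaxedYieldSet Ω (g t) 0}) (toH Ω ΓD v₀) σ₀ v σ u v' σ' := by
  simp only [relaxedYieldSet_zero]
  constructor
  · rintro ⟨u, v', σ', h1, h2, h3, h4, h5, h6, h7, h8, h9, h10⟩
    have e : ∀ p : VDual Ω ΓD, innerSL ℝ ((InnerProductSpace.toDual ℝ (VSp Ω ΓD)).symm p) = p :=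
      (InnerProductSpace.toDual ℝ (VSp Ω ΓD)).apply_symm_apply
    refine ⟨u, fun t => (InnerProductSpace.toDual ℝ _).symm (v' t), σ', ?_, h2, h3, h4, h5, h6,
      ?_, ?_, h9, h10⟩
    · simp_rw [toVDual_eq] at h1
      exact h1.toDual_symm
    · filter_upwards [h7] with t ht
      refine motion_iff.1 fun z => ?_
      rw [← ht z, ← innerSL_apply_apply ℝ, e]
    · filter_upwards [h8] with t ht τ hτ
      exact inner_sub_le_iff.1 (ht τ hτ)
  · rintro ⟨u, v', σ', h⟩
    refine ⟨u, fun t => innerSL ℝ (v' t), σ', ?_, h.velocity_bounded, h.velocity_memLp,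
      h.velocity_eq, h.stress_deriv, h.stress_mem, ?_, ?_, h.velocity_zero, h.stress_zero⟩
    · simp_rw [toVDual_eq]
      exact h.velocity_deriv.innerSL
    · filter_upwards [h.motion] with t ht z
      exact motion_iff.2 ht z
    · filter_upwards [h.flow] with t ht τ hτ
      exact inner_sub_le_iff.2 (ht τ hτ)

end Model

end

end ViscousPlasticity

/-! ### Existence and uniqueness for the model -/

theorem theorem2p3
    (Ω ΓD ΓN : Set ViscousPlasticity.E3) (hΩ : ViscousPlasticity.IsSmoothDomain Ω)
    (hΓDm : MeasurableSet ΓD) (hΓNm : MeasurableSet ΓN)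
    (hΓ : ΓD ∪ ΓN = frontier Ω) (hdisj : Disjoint ΓD ΓN)
    (hΓD : 0 < (μH[2] : Measure ViscousPlasticity.E3) ΓD)
    (hΓN : 0 < (μH[2] : Measure ViscousPlasticity.E3) ΓN)
    (T : ℝ) (hT : 0 < T) (ν : ℝ) (hν : ν ∈ Ioc (0 : ℝ) 1)
    -- the force and the strain-rate datum
    (f : ℝ → ViscousPlasticity.HVec Ω) (hf : MemLp f 2 (ViscousPlasticity.timeMeasure T))
    (h : ℝ → ViscousPlasticity.HSym Ω) (hh : MemLp h 2 (ViscousPlasticity.timeMeasure T))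
    -- the translation of the constraint set
    (σstar : ℝ → ViscousPlasticity.HSym Ω)
    (hσstar : ∃ σstar', ViscousPlasticity.HasH1Deriv T σstar σstar')
    -- the threshold function
    (g : ℝ → (closure Ω →ᵇ ℝ)) (hg : ∃ g', ViscousPlasticity.HasH1Deriv T g g')
    (hgc : ContinuousOn (fun p : ℝ × closure Ω => g p.1 p.2) (Icc 0 T ×ˢ univ))
    (hgb : ∃ C₁ C₂ : ℝ, 0 < C₁ ∧ 0 < C₂ ∧ ∀ t ∈ Icc 0 T, ∀ x, C₁ ≤ g t x ∧ g t x ≤ C₂)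
    -- the initial data
    (v₀ : ViscousPlasticity.VSp Ω ΓD) (σ₀ : ViscousPlasticity.HSym Ω)
    (hσ₀ : σ₀ ∈ ViscousPlasticity.K Ω g σstar 0 ∩ ViscousPlasticity.VSym Ω ΓD) :
    (∃ (v : ℝ → ViscousPlasticity.HVec Ω) (σ : ℝ → ViscousPlasticity.HSym Ω),
      ViscousPlasticity.IsSolution Ω ΓD T ν f h σstar g v₀ σ₀ v σ) ∧
    (∀ (v₁ v₂ : ℝ → ViscousPlasticity.HVec Ω) (σ₁ σ₂ : ℝ → ViscousPlasticity.HSym Ω),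
      ViscousPlasticity.IsSolution Ω ΓD T ν f h σstar g v₀ σ₀ v₁ σ₁ →
      ViscousPlasticity.IsSolution Ω ΓD T ν f h σstar g v₀ σ₀ v₂ σ₂ →
      ∀ t ∈ Icc 0 T, v₁ t = v₂ t ∧ σ₁ t = σ₂ t) := by
  obtain ⟨σstar', hσ'⟩ := hσstar
  obtain ⟨g', hg'⟩ := hg
  obtain ⟨C₁, C₂, hC₁, -, hC⟩ := hgb
  have hi := ViscousPlasticity.injective_adjoint_toH hΩ.isOpen hΓDm
    (hΓ ▸ subset_union_left : ΓD ⊆ frontier Ω)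
  -- The positive lower bound of the threshold serves as the scaling constant `κ`.
  have hK := ViscousPlasticity.isSweepingFamily_yieldSet hg' hC₁ fun t ht x => (hC t ht x).1
  simp only [ViscousPlasticity.isSolution_iff]
  constructor
  · refine ViscousPlasticity.exists_coupledSolution hT hν.1 ViscousPlasticity.norm_sq_VSp hi hf hh
      hσ' hK v₀ ?_
    rw [ViscousPlasticity.relaxedYieldSet_zero]
    exact hσ₀.1
  · rintro v₁ v₂ σ₁ σ₂ ⟨u₁, v₁', σ₁', h₁⟩ ⟨u₂, v₂', σ₂', h₂⟩
    exact h₁.unique hT hν.1 ViscousPlasticity.norm_sq_VSp hi h₂
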